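/- **Theorem (local error order of energy-preserving collocation-like methods).** Let $(M,g)$ be a finite-dimensional smooth Riemannian manifold with Riemannian distance $d$. Let $H\in C^\infty(M)$, let $\Omega$ be a smooth $(1,1)$-tensor field on $M$ that is skew-symmetric with respect to $g$, let $F=\Omega\,\mathrm{grad}\,H$, and let $\varphi_t$ be the flow of $F$. Let $\phi:TM\to M$ be a retraction: $\phi$ is defined and smooth on an open set of the form $\{(p,x): x\in T_pM,\ |x|<r_p\}$ with $r_p\in(0,\infty]$, and $\phi_p:=\phi|_{T_pM}$ satisfies $\phi_p(x)=p$ if and only if $x=0_p$, and $T_{0_p}\phi_p=\mathrm{Id}_{T_pM}$. Let $(u,v)\mapsto c(u,v)\in M$ be a continuous map on $M\times M$ with $c(u,u)=u$. Let $\mathsf c_1,\dots,\mathsf c_s$ be distinct real numbers, $l_i(\xi)=\prod_{j\ne i}\frac{\xi-\mathsf c_j}{\mathsf c_i-\mathsf c_j}$ and $b_i=\int_0^1 l_i(\xi)\,d\xi$, and assume $b_i\neq0$ for all $i$. Let $r$ be the order of the quadrature formula, i.e. the largest integer with $\sum_{i=1}^s b_i\mathsf c_i^{\,q-1}=\frac1q$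 for $1\le q\le r$, and let $$p=\min(r,\,2r-2s+2).$$ One step of size $h$ of the method with base point $c$, from $u$ to $v$, is given by a polynomial $\sigma:\mathbb R\to T_{c}M$ of degree at most $s$ with $$\sigma(0)=\phi_c^{-1}(u),\qquad \sigma'(\mathsf c_jh)=T_{U_j}\phi_c^{-1}\bigl(\Omega(U_j)\,\mathrm{grad}_jH\bigr),\quad U_j=\phi_c(\sigma(\mathsf c_jh)),\qquad v=\phi_c(\sigma(h)),$$ $$\mathrm{grad}_jH=\int_0^1\frac{l_j(\xi)}{b_j}\,(T_{U_j}\phi_c^{-1})^{\mathsf T}(T_{\sigma(\xi h)}\phi_c)^{\mathsf T}\,\mathrm{grad}\,H\bigl(\phi_c(\sigma(\xi h))\bigr)\,d\xi ,$$ where $\phi_c^{-1}$ is the local inverse of $\phi_c$ near $0_c$ and ${}^{\mathsf T}$ is the adjoint with respect to $g$. Call such a step *$\varepsilon$-local* if $d(v,u)<\varepsilon$ and $|\sigma(t)|<\varepsilon$ for $t\in[0,h]\cup\{\mathsf c_1h,\dots,\mathsf c_sh\}$. Then for every compact set $K\subseteq M$ (for $K=M$ if $M$ is compact) there are positive constants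 $C,h_0,\varepsilon,\delta$ such that for all $u\in K$ and all $0<h<h_0$: 1. the exact solution $\varphi_t(u)$ exists for $t\in[0,h]$; 2. for every base point $q\in M$ with $d(q,u)<\delta$ there is an $\varepsilon$-local step of size $h$ with base point $q$ starting at $u$; 3. every $\varepsilon$-local step of the method, from $u$ to $v=\psi_h(u)$ with base point $c(u,v)$, satisfies $$d\bigl(\psi_h(u),\varphi_h(u)\bigr)\le C\,h^{p+1}.$$ -/

import Mathlib

open Set Bundle Manifold MeasureTheory
open scoped ContDiff Topology ENNReal

namespace CollocationMethod

noncomputable section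

/-! ### Quadrature data -/

/-- The Lagrange basis polynomial `l_i(ξ) = ∏_{j ≠ i} (ξ - c_j) / (c_i - c_j)`. -/
def lagrangeBasis {s : ℕ} (c : Fin s → ℝ) (i : Fin s) (ξ : ℝ) : ℝ :=
  ∏ j ∈ Finset.univ.erase i, (ξ - c j) / (c i - c j)

/-- The weight `b_i = ∫₀¹ l_i(ξ) dξ`. -/
def weight {s : ℕ} (c : Fin s → ℝ) (i : Fin s) : ℝ :=
  ∫ ξ in (0 : ℝ)..1, lagrangeBasis c i ξ

/-- `r` is the order of the quadrature formula with nodes `c_i` and weights `b_i`: the largest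
integer with `∑ b_i c_i^(q-1) = 1/q` for all `1 ≤ q ≤ r`. -/
def IsQuadratureOrder {s : ℕ} (c : Fin s → ℝ) (r : ℕ) : Prop :=
  IsGreatest {r : ℕ | ∀ q : ℕ, 1 ≤ q → q ≤ r →
    ∑ i, weight c i * c i ^ (q - 1) = 1 / (q : ℝ)} r

section Manifold

variable {E : Type*} [NormedAddCommGroup E] [NormedSpace ℝ E]
  {M : Type*} [TopologicalSpace M] [ChartedSpace E M]

instance instFiniteDimensionalTangentSpace [FiniteDimensional ℝ E] (x : M) :
    FiniteDimensional ℝ (TangentSpace 𝓘(ℝ, E) x) :=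
  inferInstanceAs (FiniteDimensional ℝ E)

variable [RiemannianBundle (fun x : M => TangentSpace 𝓘(ℝ, E) x)]

/-- A retraction on a Riemannian manifold: a map `φ : TM → M`, defined and smooth on an open set
consisting of open balls `B_{r_p}(0_p) ⊆ T_pM` (the radius `r_p ∈ (0, ∞]` may be infinite). The
values of `toFun` outside of this set are irrelevant. -/
structure Retraction (E M : Type*) [NormedAddCommGroup E] [NormedSpace ℝ E]
    [TopologicalSpace M] [ChartedSpace E M] [IsManifold 𝓘(ℝ, E) ∞ M]
    [RiemannianBundle (fun x : M => TangentSpace 𝓘(ℝ, E) x)] where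
  /-- the map `φ` -/
  toFun : TangentBundle 𝓘(ℝ, E) M → M
  /-- the radii `r_p` -/
  radius : M → ℝ≥0∞
  radius_pos : ∀ p, 0 < radius p
  isOpen_domain : IsOpen {v : TangentBundle 𝓘(ℝ, E) M | ‖v.2‖ₑ < radius v.1}
  smooth : ContMDiffOn 𝓘(ℝ, E).tangent 𝓘(ℝ, E) ∞ toFun
    {v : TangentBundle 𝓘(ℝ, E) M | ‖v.2‖ₑ < radius v.1}
  eq_base_iff : ∀ (p : M) (x : TangentSpace 𝓘(ℝ, E) p), ‖x‖ₑ < radius p →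
    (toFun ⟨p, x⟩ = p ↔ x = 0)
  tangentMap_zero : ∀ p : M,
    HasMFDerivAt 𝓘(ℝ, TangentSpace 𝓘(ℝ, E) p) 𝓘(ℝ, E)
      (fun x : TangentSpace 𝓘(ℝ, E) p => toFun ⟨p, x⟩) 0
      (ContinuousLinearMap.id ℝ (TangentSpace 𝓘(ℝ, E) p))

/-- The Riemannian gradient: `g(grad H, ·) = dH`. -/
def riemannianGradient [FiniteDimensional ℝ E] (H : M → ℝ) (x : M) : TangentSpace 𝓘(ℝ, E) x :=
  (InnerProductSpace.toDual ℝ (TangentSpace 𝓘(ℝ, E) x)).symm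
    (mfderiv 𝓘(ℝ, E) 𝓘(ℝ, ℝ) H x : TangentSpace 𝓘(ℝ, E) x →L[ℝ] ℝ)

variable [IsManifold 𝓘(ℝ, E) ∞ M]

/-- The restriction `φ_p : T_pM → M`. -/
def Retraction.at (φ : Retraction E M) (p : M) (x : TangentSpace 𝓘(ℝ, E) p) : M :=
  φ.toFun ⟨p, x⟩

/-- The tangent map `T_xφ_p : T_pM → T_{φ_p(x)}M`. -/
def Retraction.tangentMap (φ : Retraction E M) (p : M) (x : TangentSpace 𝓘(ℝ, E) p) :
    TangentSpace 𝓘(ℝ, E) p →L[ℝ] TangentSpace 𝓘(ℝ, E) (φ.at p x) :=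
  mfderiv 𝓘(ℝ, TangentSpace 𝓘(ℝ, E) p) 𝓘(ℝ, E) (φ.at p) x

/-- The tangent map `T_Uφ_p⁻¹ : T_UM → T_pM` of the local inverse of `φ_p` at `U = φ_p(x)` that
takes `U` to `x`; it is the inverse of `T_xφ_p`. -/
def Retraction.tangentMapInv (φ : Retraction E M) (p : M) (x : TangentSpace 𝓘(ℝ, E) p) :
    TangentSpace 𝓘(ℝ, E) (φ.at p x) →L[ℝ] TangentSpace 𝓘(ℝ, E) p :=
  (φ.tangentMap p x).inverse

variable [FiniteDimensional ℝ E]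

/-- The averaged gradient
`grad_j H = ∫₀¹ l_j(ξ)/b_j (T_{U_j}φ_p⁻¹)ᵀ (T_{σ(ξh)}φ_p)ᵀ grad H(φ_p(σ(ξh))) dξ ∈ T_{U_j}M`,
where `U_j = φ_p(σ(c_j h))`. -/
def stageGradient {s : ℕ} (c : Fin s → ℝ) (φ : Retraction E M) (H : M → ℝ) (p : M) (h : ℝ)
    (σ : ℝ → TangentSpace 𝓘(ℝ, E) p) (j : Fin s) :
    TangentSpace 𝓘(ℝ, E) (φ.at p (σ (c j * h))) :=
  ∫ ξ in (0 : ℝ)..1, (lagrangeBasis c j ξ / weight c j) •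
    ContinuousLinearMap.adjoint (φ.tangentMapInv p (σ (c j * h)))
      (ContinuousLinearMap.adjoint (φ.tangentMap p (σ (ξ * h)))
        (riemannianGradient H (φ.at p (σ (ξ * h)))))

/-- `σ : ℝ → T_pM` is a solution of the equations of one step, of size `h`, of the
energy-preserving collocation-like method with nodes `c_j` and base point `p`, leading from `u`
to `v`. -/
structure IsStep {s : ℕ} (c : Fin s → ℝ) (φ : Retraction E M)
    (Ω : ∀ x : M, TangentSpace 𝓘(ℝ, E) x →L[ℝ] TangentSpace 𝓘(ℝ, E) x) (H : M → ℝ)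
    (p : M) (h : ℝ) (u v : M) (σ : ℝ → TangentSpace 𝓘(ℝ, E) p) : Prop where
  /-- `σ` is a polynomial of degree at most `s` -/
  polynomial : ∃ a : Fin (s + 1) → TangentSpace 𝓘(ℝ, E) p, ∀ t, σ t = ∑ k : Fin (s + 1), t ^ (k : ℕ) • a k
  /-- all the points at which `φ_p` is evaluated lie in its domain -/
  mem_domain : ∀ ξ ∈ Icc (0 : ℝ) 1, ‖σ (ξ * h)‖ₑ < φ.radius p
  mem_domain_node : ∀ j, ‖σ (c j * h)‖ₑ < φ.radius p
  /-- the local inverses of `φ_p` at the points `U_j` make sense -/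
  invertible : ∀ j, (φ.tangentMap p (σ (c j * h))).IsInvertible
  /-- `σ(0) = φ_p⁻¹(u)` -/
  initial : φ.at p (σ 0) = u
  /-- `σ'(c_j h) = T_{U_j}φ_p⁻¹ (Ω(U_j) grad_j H)` -/
  collocation : ∀ j, deriv σ (c j * h) = φ.tangentMapInv p (σ (c j * h))
    (Ω (φ.at p (σ (c j * h))) (stageGradient c φ H p h σ j))
  /-- `v = φ_p(σ(h))` -/
  final : v = φ.at p (σ h)

/-- The relevant values of `σ` lie in the ball of radius `ε` of `T_pM`. -/
def IsSmall {s : ℕ} (c : Fin s → ℝ) (p : M) (h : ℝ) (σ : ℝ → TangentSpace 𝓘(ℝ, E) p)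
    (ε : ℝ) : Prop :=
  (∀ ξ ∈ Icc (0 : ℝ) 1, ‖σ (ξ * h)‖ < ε) ∧ ∀ j, ‖σ (c j * h)‖ < ε

end Manifold

end

end CollocationMethod

namespace CollocationMethod

/-! ### Exactness of Lagrange interpolation and of the quadrature formula. -/

section Quadrature

variable {s : ℕ} {c : Fin s → ℝ}

/-! The problem is first reduced to a vector space. Pulled back by φ_p, the equation becomes y' =
B(z, y) g(z, y), where z is the coordinate of p, g is the covector d(H ∘ φ_p), and B is the pullback
of α ↦ Ω α^♯. The adjoints in the averaged gradient turn gradients into pulled-back covectors, so a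
step of the method becomes a step of the analogous method for this equation, with all averages taken
in one fixed dual space (`tangentMap_modelField`, `tangentCoord_stage`). After a cut-off, B and g
are globally smooth with compact support (`nonempty_localModel`).

In the vector space, σ' is the interpolant of its stages, so σ solves the equation for f = B g up to
the collocation defect Θ. Along the exact solution y the defect is O(h^(m-1)) with m = min(s, r - s
+ 1) + 1, which gives the preliminary bound σ - y = O(h^m) (`exists_bound_sub`). The higher order at
the endpoint comes from variation of constants. Let Z' = -Z Df(y), Z(0) = 1. Then the derivative of
Z(σ - y) is ZΘ + ZR with R quadratic in σ - y. Since R = O(h^(2m)) and 2m ≥ p, only the integral of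
ZΘ matters (`exists_bound_error`).

That integral is trilinear in Z, B(z, σ) and g(z, σ). Each of these is expanded in powers of ξ,
where t = ξh. The term of degrees (a, b, e) carries a scalar moment that depends on the nodes alone.
Either this moment vanishes, by exactness of interpolation and quadrature, or the coefficients
supply at least h^p (`integral_pow_mul_defectMoment_vanishing`). The coefficients of σ are
controlled only through the preliminary bound, so degree k ≤ s yields just h^min(k, m);
`solutionWeight` records this loss.

Solvability is a contraction argument for the stages (`exists_isModelStep`). Uniqueness of integral
curves identifies the transported solution with the flow, and compactness makes the local constants
uniform. -/

theorem lagrangeBasis_eq_eval (c : Fin s → ℝ) (i : Fin s) (ξ : ℝ) :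
    lagrangeBasis c i ξ = (Lagrange.basis Finset.univ c i).eval ξ := by
  simp only [lagrangeBasis, Lagrange.basis, Polynomial.eval_prod, Lagrange.basisDivisor,
    Polynomial.eval_mul, Polynomial.eval_C, Polynomial.eval_sub, Polynomial.eval_X]
  refine Finset.prod_congr rfl fun j _ => ?_
  rw [div_eq_inv_mul]

theorem continuous_lagrangeBasis (c : Fin s → ℝ) (i : Fin s) :
    Continuous (lagrangeBasis c i) := by
  have : lagrangeBasis c i = fun ξ => (Lagrange.basis Finset.univ c i).eval ξ :=
    funext (lagrangeBasis_eq_eval c i)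
  rw [this]
  exact Polynomial.continuous _

theorem lagrangeBasis_node (hc : Function.Injective c) (i j : Fin s) :
    lagrangeBasis c i (c j) = if i = j then 1 else 0 := by
  rw [lagrangeBasis_eq_eval]
  split_ifs with h
  · subst h
    exact Lagrange.eval_basis_self hc.injOn (Finset.mem_univ _)
  · exact Lagrange.eval_basis_of_ne h (Finset.mem_univ _)

/-- Lagrange interpolation is exact on polynomials of degree less than the number of nodes. -/
theorem sum_lagrangeBasis_mul_eval (hc : Function.Injective c) (P : Polynomial ℝ)
    (hP : P.degree < s) (ξ : ℝ) : ∑ j, lagrangeBasis c j ξ * P.eval (c j) = P.eval ξ := by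
  have h := Lagrange.eq_interpolate (s := Finset.univ) (v := c) (f := P) hc.injOn (by simpa using hP)
  conv_rhs => rw [h]
  simp only [Lagrange.interpolate_apply, Polynomial.eval_finsetSum, Polynomial.eval_mul,
    Polynomial.eval_C, lagrangeBasis_eq_eval]
  exact Finset.sum_congr rfl fun j _ => mul_comm _ _

theorem sum_lagrangeBasis_mul_pow (hc : Function.Injective c) {k : ℕ} (hk : k < s) (ξ : ℝ) :
    ∑ j, lagrangeBasis c j ξ * c j ^ k = ξ ^ k := by
  have := sum_lagrangeBasis_mul_eval hc (Polynomial.X ^ k)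
    (by rw [Polynomial.degree_X_pow]; exact_mod_cast hk) ξ
  simpa using this

/-- The order condition with index q is exactness on the monomial of degree q - 1, so order r means
exactness in degree strictly below r. -/
theorem integral_eval_eq_sum {r : ℕ} (hr : IsQuadratureOrder c r) (P : Polynomial ℝ)
    (hP : P.degree < r) : ∫ ξ in (0 : ℝ)..1, P.eval ξ = ∑ i, weight c i * P.eval (c i) := by
  have hP' : P.natDegree < r ∨ P = 0 := by
    by_cases h : P = 0
    · exact Or.inr h
    · exact Or.inl ((Polynomial.natDegree_lt_iff_degree_lt h).2 hP)
  rcases hP' with hP' | rfl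
  swap
  · simp
  simp only [Polynomial.eval_eq_sum_range' hP', Finset.mul_sum]
  rw [intervalIntegral.integral_finsetSum
    (fun i _ => (Continuous.intervalIntegrable (by fun_prop) _ _)), Finset.sum_comm]
  refine Finset.sum_congr rfl fun k hk => ?_
  have := hr.1 (k + 1) (by omega) (by have := Finset.mem_range.1 hk; omega)
  rw [intervalIntegral.integral_const_mul, integral_pow]
  simp only [Nat.add_sub_cancel] at this
  push_cast at this
  rw [show (1 ^ (k + 1) - 0 ^ (k + 1) : ℝ) / (k + 1) = 1 / (k + 1) by simp, ← this, Finset.mul_sum]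
  exact Finset.sum_congr rfl fun j _ => by ring

theorem degree_lagrange_basis_lt (hc : Function.Injective c) (j : Fin s) :
    (Lagrange.basis Finset.univ c j).degree < s := by
  rw [Lagrange.degree_basis hc.injOn (Finset.mem_univ _)]
  have : 0 < s := j.pos
  simp only [Finset.card_univ, Fintype.card_fin]
  exact_mod_cast Nat.sub_lt this one_pos

/-- The integrand has degree at most a + s - 1 < r, so the quadrature is exact, and at the nodes the
basis polynomial is a Kronecker delta. -/
theorem integral_pow_mul_lagrangeBasis (hc : Function.Injective c) {r : ℕ}
    (hr : IsQuadratureOrder c r) {a : ℕ} (ha : a + s ≤ r) (j : Fin s) :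
    ∫ ξ in (0 : ℝ)..1, ξ ^ a * lagrangeBasis c j ξ = weight c j * c j ^ a := by
  have h := integral_eval_eq_sum hr (Polynomial.X ^ a * Lagrange.basis Finset.univ c j) (by
    rw [Polynomial.degree_mul, Polynomial.degree_X_pow]
    calc (a : WithBot ℕ) + (Lagrange.basis Finset.univ c j).degree
        < (a : WithBot ℕ) + s := by
          exact WithBot.add_lt_add_left (by simp) (degree_lagrange_basis_lt hc j)
      _ ≤ r := by exact_mod_cast ha)
  simp only [Polynomial.eval_mul, Polynomial.eval_pow, Polynomial.eval_X,
    ← lagrangeBasis_eq_eval, lagrangeBasis_node hc] at h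
  rw [h]
  simp

theorem integral_pow_eq_sum {r : ℕ} (hr : IsQuadratureOrder c r) {a : ℕ} (ha : a < r) :
    ∫ ξ in (0 : ℝ)..1, ξ ^ a = ∑ i, weight c i * c i ^ a := by
  have h := integral_eval_eq_sum hr (Polynomial.X ^ a) (by
    rw [Polynomial.degree_X_pow]; exact_mod_cast ha)
  simpa using h

/-- The weights are interpolatory: integrating the interpolation identity for a monomial of degree
below s gives its order condition. -/
theorem card_nodes_le_order (hc : Function.Injective c) {r : ℕ} (hr : IsQuadratureOrder c r) :
    s ≤ r := by
  refine hr.2 fun q hq hqs => ?_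
  have h : ∀ ξ : ℝ, ξ ^ (q - 1) = ∑ j, lagrangeBasis c j ξ * c j ^ (q - 1) :=
    fun ξ => (sum_lagrangeBasis_mul_pow hc (lt_of_lt_of_le (Nat.sub_lt hq one_pos) hqs) ξ).symm
  have h1 : ∫ ξ in (0 : ℝ)..1, ξ ^ (q - 1) = 1 / (q : ℝ) := by
    rw [integral_pow]
    have : ((q - 1 : ℕ) : ℝ) + 1 = q := by
      rw [Nat.cast_sub hq, Nat.cast_one, sub_add_cancel]
    rw [this, one_pow, zero_pow (by omega), sub_zero]
  rw [← h1]
  rw [funext h, intervalIntegral.integral_finsetSum (fun i _ => ?_)]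
  · simp [intervalIntegral.integral_mul_const, weight]
  · exact ((continuous_lagrangeBasis c i).mul continuous_const).intervalIntegrable _ _

/-- The square of the nodal polynomial has degree 2s and vanishes at every node, while its integral
is positive. -/
theorem order_le_two_mul_card_nodes {r : ℕ} (hr : IsQuadratureOrder c r) : r ≤ 2 * s := by
  by_contra! hlt
  have hmonic : (∏ j, (Polynomial.X - Polynomial.C (c j))).Monic :=
    Polynomial.monic_prod_of_monic _ _ fun j _ => Polynomial.monic_X_sub_C _
  have hdeg : (∏ j, (Polynomial.X - Polynomial.C (c j))).natDegree = s := by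
    rw [Polynomial.natDegree_prod_of_monic _ _ fun j _ => Polynomial.monic_X_sub_C _]
    simp
  have h := integral_eval_eq_sum hr ((∏ j, (Polynomial.X - Polynomial.C (c j))) ^ 2) (by
    rw [Polynomial.degree_eq_natDegree (hmonic.pow 2).ne_zero, hmonic.natDegree_pow, hdeg]
    exact_mod_cast hlt)
  have h0 : ∑ i, weight c i * ((∏ j, (Polynomial.X - Polynomial.C (c j))) ^ 2).eval (c i) = 0 := by
    refine Finset.sum_eq_zero fun i _ => ?_
    rw [Polynomial.eval_pow, Polynomial.eval_prod, Finset.prod_eq_zero (Finset.mem_univ i)] <;> simp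
  rw [h0] at h
  set P := (∏ j, (Polynomial.X - Polynomial.C (c j))) ^ 2 with hP
  have hroots : (Ioo (0 : ℝ) 1 ∩ {ξ | P.eval ξ ≠ 0}).Nonempty := by
    have hfin : {ξ | P.IsRoot ξ}.Finite := Polynomial.finite_setOfPred_isRoot (hmonic.pow 2).ne_zero
    obtain ⟨ξ, hξ, hξ'⟩ := (Ioo_infinite (zero_lt_one (α := ℝ))).exists_notMem_finite hfin
    exact ⟨ξ, hξ, hξ'⟩
  obtain ⟨ξ, hξ, hne⟩ := hroots
  have hpos : 0 < ∫ ξ in (0 : ℝ)..1, P.eval ξ := by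
    refine intervalIntegral.integral_pos one_pos (Polynomial.continuous _).continuousOn
      (fun x _ => ?_) ⟨ξ, Ioo_subset_Icc_self hξ, ?_⟩
    · rw [hP, Polynomial.eval_pow]; positivity
    · refine lt_of_le_of_ne ?_ (Ne.symm hne)
      rw [hP, Polynomial.eval_pow]; positivity
  exact hpos.ne' h

end Quadrature

/-! ### Expansions in ξ with weights in the step size. -/

section Expansion

variable {ι : Type*} {h : ι → ℝ} {T : ℝ} {N : ℕ}
  {V V₁ V₂ : Type*} [NormedAddCommGroup V] [NormedSpace ℝ V]
  [NormedAddCommGroup V₁] [NormedSpace ℝ V₁] [NormedAddCommGroup V₂] [NormedSpace ℝ V₂]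

/-- A family of functions `F i` on `[-T, T]` that, up to an error `O(h^N)`, is a sum of monomials
`ξ^k • a i` whose coefficients are `O(h^(w k))`, uniformly in the index `i`. -/
inductive HasExpansion {ι : Type*} (h : ι → ℝ) (T : ℝ) (N : ℕ) (w : ℕ → ℕ) {V : Type*}
    [NormedAddCommGroup V] [NormedSpace ℝ V] : (ι → ℝ → V) → Prop
  | monomial (k : ℕ) (a : ι → V) (C : ℝ) (hC : 0 ≤ C) (ha : ∀ i, ‖a i‖ ≤ C * h i ^ w k) :
      HasExpansion h T N w (fun i ξ => ξ ^ k • a i)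
  | small (F : ι → ℝ → V) (C : ℝ) (hC : 0 ≤ C) (hF : ∀ i, ContinuousOn (F i) (Icc (-T) T))
      (hb : ∀ i, ∀ ξ ∈ Icc (-T) T, ‖F i ξ‖ ≤ C * h i ^ N) : HasExpansion h T N w F
  | add (F G : ι → ℝ → V) : HasExpansion h T N w F → HasExpansion h T N w G →
      HasExpansion h T N w (fun i ξ => F i ξ + G i ξ)

namespace HasExpansion

theorem continuousOn {w : ℕ → ℕ} {F : ι → ℝ → V} (hF : HasExpansion h T N w F) (i : ι) :
    ContinuousOn (F i) (Icc (-T) T) := by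
  induction hF with
  | monomial k a C hC ha => fun_prop
  | small F C hC hF hb => exact hF i
  | add F G _ _ h1 h2 => exact h1.add h2

theorem zero (w : ℕ → ℕ) : HasExpansion h T N w (fun _ _ => (0 : V)) :=
  small _ 0 le_rfl (fun _ => continuousOn_const) (by simp)

theorem sum {w : ℕ → ℕ} {κ : Type*} (S : Finset κ) {F : κ → ι → ℝ → V}
    (hF : ∀ k ∈ S, HasExpansion h T N w (F k)) :
    HasExpansion h T N w (fun i ξ => ∑ k ∈ S, F k i ξ) := by
  classical
  induction S using Finset.induction_on with
  | empty => simpa using zero w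
  | insert k S hk ih =>
    simp only [Finset.sum_insert hk]
    exact add _ _ (hF k (Finset.mem_insert_self _ _))
      (ih fun j hj => hF j (Finset.mem_insert_of_mem hj))

theorem map_continuousLinear {w : ℕ → ℕ} {F : ι → ℝ → V} (hF : HasExpansion h T N w F)
    (L : V →L[ℝ] V₁) : HasExpansion h T N w (fun i ξ => L (F i ξ)) := by
  induction hF with
  | monomial k a C hC ha =>
    simp only [map_smul]
    refine monomial k _ (‖L‖ * C) (by positivity) fun i => ?_
    calc ‖L (a i)‖ ≤ ‖L‖ * ‖a i‖ := L.le_opNorm _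
      _ ≤ ‖L‖ * (C * h i ^ w k) := by gcongr; exact ha i
      _ = _ := by ring
  | small F C hC hF hb =>
    refine small _ (‖L‖ * C) (by positivity) (fun i => L.continuous.comp_continuousOn (hF i))
      fun i ξ hξ => ?_
    calc ‖L (F i ξ)‖ ≤ ‖L‖ * ‖F i ξ‖ := L.le_opNorm _
      _ ≤ ‖L‖ * (C * h i ^ N) := by gcongr; exact hb i ξ hξ
      _ = _ := by ring
  | add F G _ _ h1 h2 => simpa only [map_add] using add _ _ h1 h2

theorem sub {w : ℕ → ℕ} {F G : ι → ℝ → V} (hF : HasExpansion h T N w F)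
    (hG : HasExpansion h T N w G) : HasExpansion h T N w (fun i ξ => F i ξ - G i ξ) := by
  simpa [sub_eq_add_neg] using add _ _ hF (hG.map_continuousLinear (-ContinuousLinearMap.id ℝ V))

section Bounded

theorem exists_bound (hh : ∀ i, 0 < h i ∧ h i ≤ 1)
    {w : ℕ → ℕ} {F : ι → ℝ → V} (hF : HasExpansion h T N w F) :
    ∃ C : ℝ, 0 ≤ C ∧ ∀ i, ∀ ξ ∈ Icc (-T) T, ‖F i ξ‖ ≤ C := by
  have hpow : ∀ i (n : ℕ), h i ^ n ≤ 1 := fun i n => pow_le_one₀ (hh i).1.le (hh i).2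
  induction hF with
  | monomial k a C hC ha =>
    refine ⟨|T| ^ k * C, by positivity, fun i ξ hξ => ?_⟩
    have hξT : |ξ| ≤ |T| := (abs_le.2 hξ).trans (le_abs_self T)
    rw [norm_smul, norm_pow, Real.norm_eq_abs]
    gcongr
    exact (ha i).trans (mul_le_of_le_one_right hC (hpow i _))
  | small F C hC hF hb =>
    exact ⟨C, hC, fun i ξ hξ => (hb i ξ hξ).trans (mul_le_of_le_one_right hC (hpow i _))⟩
  | add F G _ _ h1 h2 =>
    obtain ⟨C₁, hC₁, h1⟩ := h1
    obtain ⟨C₂, hC₂, h2⟩ := h2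
    exact ⟨C₁ + C₂, by positivity, fun i ξ hξ =>
      (norm_add_le _ _).trans (add_le_add (h1 i ξ hξ) (h2 i ξ hξ))⟩

theorem mono (hh : ∀ i, 0 < h i ∧ h i ≤ 1)
    {w w' : ℕ → ℕ} (hw : ∀ k, w' k ≤ w k) {F : ι → ℝ → V}
    (hF : HasExpansion h T N w F) : HasExpansion h T N w' F := by
  induction hF with
  | monomial k a C hC ha =>
    exact monomial k a C hC fun i => (ha i).trans
      (mul_le_mul_of_nonneg_left (pow_le_pow_of_le_one (hh i).1.le (hh i).2 (hw k)) hC)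
  | small F C hC hF hb => exact small F C hC hF hb
  | add F G _ _ h1 h2 => exact add _ _ h1 h2

/-- Degrees in ξ add and so do orders in h; the hypothesis `hw` says that the target weight asks for
no more than this sum. A remainder in one factor stays a remainder because the other factor is
bounded. -/
theorem bilinear (hh : ∀ i, 0 < h i ∧ h i ≤ 1)
    {w w₁ w₂ : ℕ → ℕ} (hw : ∀ a b, w (a + b) ≤ w₁ a + w₂ b)
    {F : ι → ℝ → V₁ →L[ℝ] V} {G : ι → ℝ → V₁} (hF : HasExpansion h T N w₁ F)
    (hG : HasExpansion h T N w₂ G) : HasExpansion h T N w (fun i ξ => F i ξ (G i ξ)) := by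
  obtain ⟨D, hD, hGb⟩ := hG.exists_bound hh
  have hGc := hG.continuousOn
  have hpos : ∀ i (n : ℕ), 0 ≤ h i ^ n := fun i n => pow_nonneg (hh i).1.le n
  induction hF with
  | small F C hC hF hb =>
    refine small _ (C * D) (by positivity) (fun i => (hF i).clm_apply (hGc i)) fun i ξ hξ => ?_
    calc ‖F i ξ (G i ξ)‖ ≤ ‖F i ξ‖ * ‖G i ξ‖ := (F i ξ).le_opNorm _
      _ ≤ (C * h i ^ N) * D := by
        gcongr
        · exact mul_nonneg hC (hpos i N)
        · exact hb i ξ hξ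
        · exact hGb i ξ hξ
      _ = _ := by ring
  | add F F' _ _ h1 h2 => simpa only [add_apply] using add _ _ h1 h2
  | monomial k a C hC ha =>
    clear hGb hGc hD D
    induction hG with
    | monomial l b D hD hb =>
      have : (fun (i : ι) (ξ : ℝ) => (ξ ^ k • a i) (ξ ^ l • b i)) =
          fun i ξ => ξ ^ (k + l) • (a i (b i)) := by
        funext i ξ
        rw [smul_apply, map_smul, smul_smul, pow_add]
      rw [this]
      refine monomial (k + l) _ (C * D) (by positivity) fun i => ?_
      calc ‖a i (b i)‖ ≤ ‖a i‖ * ‖b i‖ := (a i).le_opNorm _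
        _ ≤ (C * h i ^ w₁ k) * (D * h i ^ w₂ l) := by
          gcongr
          · exact mul_nonneg hC (hpos i _)
          · exact ha i
          · exact hb i
        _ = C * D * h i ^ (w₁ k + w₂ l) := by ring
        _ ≤ _ := mul_le_mul_of_nonneg_left (pow_le_pow_of_le_one (hh i).1.le (hh i).2 (hw k l))
              (by positivity)
    | add G G' _ _ h1 h2 => simpa only [map_add] using add _ _ h1 h2
    | small G D hD hG hb =>
      refine small _ (|T| ^ k * C * D) (by positivity)
        (fun i => ContinuousOn.clm_apply (by fun_prop) (hG i)) fun i ξ hξ => ?_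
      have hξT : |ξ| ≤ |T| := (abs_le.2 hξ).trans (le_abs_self T)
      calc ‖(ξ ^ k • a i) (G i ξ)‖ ≤ ‖ξ ^ k • a i‖ * ‖G i ξ‖ := ContinuousLinearMap.le_opNorm _ _
        _ ≤ (|T| ^ k * C) * (D * h i ^ N) := by
          gcongr
          · rw [norm_smul, norm_pow, Real.norm_eq_abs]
            gcongr
            exact (ha i).trans
              (mul_le_of_le_one_right hC (pow_le_one₀ (hh i).1.le (hh i).2))
          · exact hb i ξ hξ
        _ = _ := by ring

end Bounded

end HasExpansion

end Expansion

/-! ### The collocation defect and its scalar moments. -/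

section Defect

variable {s : ℕ}
  {V V₁ V₂ : Type*} [NormedAddCommGroup V] [NormedSpace ℝ V]
  [NormedAddCommGroup V₁] [NormedSpace ℝ V₁] [NormedAddCommGroup V₂] [NormedSpace ℝ V₂]

/-- The function `∑ l_j(ξ) β(c_j) (∫₀¹ l_j/b_j G) - β(ξ) G(ξ)`. -/
noncomputable def collocationDefect (c : Fin s → ℝ) (β : ℝ → V₁ →L[ℝ] V) (G : ℝ → V₁) (ξ : ℝ) : V :=
  ∑ j, lagrangeBasis c j ξ •
    β (c j) ((weight c j)⁻¹ • ∫ η in (0 : ℝ)..1, lagrangeBasis c j η • G η) - β ξ (G ξ)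

/-- The value of the collocation defect on monomials. -/
noncomputable def defectMoment (c : Fin s → ℝ) (b e : ℕ) (ξ : ℝ) : ℝ :=
  ∑ j, lagrangeBasis c j ξ *
    (c j ^ b * ((weight c j)⁻¹ * ∫ η in (0 : ℝ)..1, lagrangeBasis c j η * η ^ e)) - ξ ^ (b + e)

variable {c : Fin s → ℝ}

theorem continuous_defectMoment (b e : ℕ) : Continuous (defectMoment c b e) := by
  have := continuous_lagrangeBasis c
  unfold defectMoment
  fun_prop

/-- The vector part factors out, so the order analysis concerns only a scalar function determined by
the nodes. -/
theorem collocationDefect_monomial [CompleteSpace V₁] (b e : ℕ) (B : V₁ →L[ℝ] V) (g : V₁) (ξ : ℝ) :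
    collocationDefect c (fun η => η ^ b • B) (fun η => η ^ e • g) ξ =
      defectMoment c b e ξ • B g := by
  have : ∀ j, ∫ η in (0 : ℝ)..1, lagrangeBasis c j η • η ^ e • g =
      (∫ η in (0 : ℝ)..1, lagrangeBasis c j η * η ^ e) • g := fun j => by
    simp only [smul_smul]
    exact intervalIntegral.integral_smul_const _ _
  simp only [collocationDefect, this, defectMoment, smul_apply, map_smul, sub_smul,
    Finset.sum_smul]
  congr 1
  · refine Finset.sum_congr rfl fun j _ => ?_
    simp only [smul_smul]
    congr 1
    ring
  · rw [smul_smul, ← pow_add, add_comm]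

theorem collocationDefect_add_left (β β' : ℝ → V₁ →L[ℝ] V) (G : ℝ → V₁) (ξ : ℝ) :
    collocationDefect c (fun η => β η + β' η) G ξ =
      collocationDefect c β G ξ + collocationDefect c β' G ξ := by
  simp only [collocationDefect, add_apply, smul_add, Finset.sum_add_distrib]
  abel

variable {T : ℝ}

theorem unitInterval_subset (hT : 1 ≤ T)
    : uIcc (0 : ℝ) 1 ⊆ Icc (-T) T := by
  rw [uIcc_of_le zero_le_one]
  exact Icc_subset_Icc (by linarith) hT

theorem intervalIntegrable_of_continuousOn (hT : 1 ≤ T)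
    {G : ℝ → V} (hG : ContinuousOn G (Icc (-T) T)) :
    IntervalIntegrable G volume 0 1 :=
  (hG.mono (unitInterval_subset hT)).intervalIntegrable

theorem intervalIntegrable_lagrangeBasis_smul (hT : 1 ≤ T)
    {G : ℝ → V} (hG : ContinuousOn G (Icc (-T) T))
    (j : Fin s) : IntervalIntegrable (fun η => lagrangeBasis c j η • G η) volume 0 1 :=
  intervalIntegrable_of_continuousOn hT ((continuous_lagrangeBasis c j).continuousOn.smul hG)

theorem collocationDefect_add_right (hT : 1 ≤ T)
    (β : ℝ → V₁ →L[ℝ] V) {G G' : ℝ → V₁}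
    (hG : ContinuousOn G (Icc (-T) T)) (hG' : ContinuousOn G' (Icc (-T) T)) (ξ : ℝ) :
    collocationDefect c β (fun η => G η + G' η) ξ =
      collocationDefect c β G ξ + collocationDefect c β G' ξ := by
  have : ∀ j, ∫ η in (0 : ℝ)..1, lagrangeBasis c j η • (G η + G' η) =
      (∫ η in (0 : ℝ)..1, lagrangeBasis c j η • G η) +
        ∫ η in (0 : ℝ)..1, lagrangeBasis c j η • G' η := fun j => by
    simp only [smul_add]
    exact intervalIntegral.integral_add (intervalIntegrable_lagrangeBasis_smul hT hG j)
      (intervalIntegrable_lagrangeBasis_smul hT hG' j)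
  simp only [collocationDefect, this]
  simp only [smul_add, map_add, Finset.sum_add_distrib]
  abel

theorem continuousOn_collocationDefect {β : ℝ → V₁ →L[ℝ] V} {G : ℝ → V₁}
    (hβ : ContinuousOn β (Icc (-T) T)) (hG : ContinuousOn G (Icc (-T) T)) :
    ContinuousOn (collocationDefect c β G) (Icc (-T) T) := by
  have := continuous_lagrangeBasis c
  exact (continuousOn_finsetSum _ fun j _ =>
    ((this j).continuousOn.smul continuousOn_const)).sub (hβ.clm_apply hG)

theorem exists_bound_lagrangeBasis (c : Fin s → ℝ) (T : ℝ) :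
    ∃ C : ℝ, 0 ≤ C ∧ ∀ j, ∀ ξ ∈ Icc (-T) T, |lagrangeBasis c j ξ| ≤ C := by
  have h : ∀ j, ∃ C : ℝ, ∀ ξ ∈ Icc (-T) T, ‖lagrangeBasis c j ξ‖ ≤ C := fun j =>
    isCompact_Icc.exists_bound_of_continuousOn (continuous_lagrangeBasis c j).continuousOn
  choose C hC using h
  refine ⟨∑ j, |C j|, Finset.sum_nonneg fun _ _ => abs_nonneg _, fun j ξ hξ => ?_⟩
  exact (hC j ξ hξ).trans ((le_abs_self _).trans
    (Finset.single_le_sum (f := fun j => |C j|) (fun _ _ => abs_nonneg _) (Finset.mem_univ j)))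

theorem norm_integral_lagrangeBasis_smul_le (hT : 1 ≤ T)
    {D C : ℝ} (hC : 0 ≤ C)
    (hl : ∀ j, ∀ ξ ∈ Icc (-T) T, |lagrangeBasis c j ξ| ≤ C) {G : ℝ → V}
    (hG : ∀ ξ ∈ Icc (0 : ℝ) 1, ‖G ξ‖ ≤ D) (j : Fin s) :
    ‖∫ η in (0 : ℝ)..1, lagrangeBasis c j η • G η‖ ≤ C * D := by
  have := intervalIntegral.norm_integral_le_of_norm_le_const (a := (0 : ℝ)) (b := 1) (C := C * D)
    (f := fun η => lagrangeBasis c j η • G η) (fun ξ hξ => by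
      rw [uIoc_of_le zero_le_one] at hξ
      rw [norm_smul, Real.norm_eq_abs]
      gcongr
      · exact hl j ξ ⟨by linarith [hξ.1], by linarith [hξ.2]⟩
      · exact hG ξ ⟨hξ.1.le, hξ.2⟩)
  simpa using this

/-- A crude bilinear bound, used to dispose of expansion remainders: if one factor is O(h^N) and the
other is bounded, the defect is O(h^N). The interval must contain [0, 1] and the nodes, which may
lie outside [0, 1]. -/
theorem exists_bound_collocationDefect (hT : 1 ≤ T)
    (hcT : ∀ j, c j ∈ Icc (-T) T) :
    ∃ C : ℝ, 0 ≤ C ∧ ∀ (β : ℝ → V₁ →L[ℝ] V) (G : ℝ → V₁) (b g : ℝ),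
      (∀ ξ ∈ Icc (-T) T, ‖β ξ‖ ≤ b) → (∀ ξ ∈ Icc (-T) T, ‖G ξ‖ ≤ g) →
      ∀ ξ ∈ Icc (-T) T, ‖collocationDefect c β G ξ‖ ≤ C * (b * g) := by
  obtain ⟨C, hC, hl⟩ := exists_bound_lagrangeBasis c T
  refine ⟨∑ j, C * (|(weight c j)⁻¹| * C) + 1, by positivity, fun β G b g hβ hG ξ hξ => ?_⟩
  have hb : 0 ≤ b := (norm_nonneg _).trans (hβ ξ hξ)
  have hg : 0 ≤ g := (norm_nonneg _).trans (hG ξ hξ)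
  unfold collocationDefect
  refine (norm_sub_le _ _).trans ?_
  rw [add_mul, one_mul]
  refine add_le_add ((norm_sum_le _ _).trans ?_) (((β ξ).le_opNorm _).trans ?_)
  · rw [Finset.sum_mul]
    refine Finset.sum_le_sum fun j _ => ?_
    rw [norm_smul, Real.norm_eq_abs]
    have h1 := norm_integral_lagrangeBasis_smul_le hT hC hl (G := G)
      (fun ξ hξ => hG ξ ⟨by linarith [hξ.1], by linarith [hξ.2]⟩) j
    calc _ ≤ C * (b * (|(weight c j)⁻¹| * (C * g))) := by
          gcongr
          · exact hl j ξ hξ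
          · refine ((β (c j)).le_opNorm _).trans ?_
            rw [norm_smul, Real.norm_eq_abs]
            gcongr
            exact hβ _ (hcT j)
      _ = _ := by ring
  · gcongr
    · exact hβ ξ hξ
    · exact hG ξ hξ

variable {ι : Type*} {h : ι → ℝ} {N : ℕ}

/-- If the collocation defect vanishes on all monomials of low weight, it is small. -/
theorem exists_bound_collocationDefect_of_moment (hT : 1 ≤ T) (hh : ∀ i, 0 < h i ∧ h i ≤ 1)
    [CompleteSpace V₁] (hcT : ∀ j, c j ∈ Icc (-T) T) {n : ℕ}
    (hn : n ≤ N) {wβ wG : ℕ → ℕ}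
    (hw : ∀ b e, (∀ ξ, defectMoment c b e ξ = 0) ∨ n ≤ wβ b + wG e)
    {β : ι → ℝ → V₁ →L[ℝ] V} {G : ι → ℝ → V₁}
    (hβ : HasExpansion h T N wβ β) (hG : HasExpansion h T N wG G) :
    ∃ C : ℝ, 0 ≤ C ∧ ∀ i, ∀ ξ ∈ Icc (-T) T, ‖collocationDefect c (β i) (G i) ξ‖ ≤ C * h i ^ n := by
  obtain ⟨C₀, hC₀, hbd⟩ := exists_bound_collocationDefect (V := V) (V₁ := V₁) hT hcT
  have hNn : ∀ i, h i ^ N ≤ h i ^ n := fun i => pow_le_pow_of_le_one (hh i).1.le (hh i).2 hn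
  have hGc := hG.continuousOn
  obtain ⟨g, hg, hGb⟩ := hG.exists_bound hh
  -- The defect is bilinear, so only pairs of monomials need the moment condition; a remainder in
  -- either slot is covered by the crude bound.
  induction hβ with
  | small β C hC hβ hb =>
    refine ⟨C₀ * (C * g), by positivity, fun i ξ hξ =>
      (hbd _ _ _ _ (hb i) (hGb i) ξ hξ).trans ?_⟩
    calc _ = C₀ * (C * g) * h i ^ N := by ring
      _ ≤ _ := mul_le_mul_of_nonneg_left (hNn i) (by positivity)
  | add β β' _ _ h1 h2 =>
    obtain ⟨C₁, hC₁, h1⟩ := h1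
    obtain ⟨C₂, hC₂, h2⟩ := h2
    refine ⟨C₁ + C₂, by positivity, fun i ξ hξ => ?_⟩
    rw [collocationDefect_add_left, add_mul]
    exact (norm_add_le _ _).trans (add_le_add (h1 i ξ hξ) (h2 i ξ hξ))
  | monomial k a C hC ha =>
    clear hGb hg g
    obtain ⟨b, hb, hβb⟩ := (HasExpansion.monomial (T := T) (N := N) k a C hC ha).exists_bound hh
    induction hG with
    | small G D hD hG hGb =>
      refine ⟨C₀ * (b * D), by positivity, fun i ξ hξ =>
        (hbd _ _ _ _ (hβb i) (hGb i) ξ hξ).trans ?_⟩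
      calc _ = C₀ * (b * D) * h i ^ N := by ring
        _ ≤ _ := mul_le_mul_of_nonneg_left (hNn i) (by positivity)
    | add G G' hG hG' h1 h2 =>
      obtain ⟨C₁, hC₁, h1⟩ := h1 hG.continuousOn
      obtain ⟨C₂, hC₂, h2⟩ := h2 hG'.continuousOn
      refine ⟨C₁ + C₂, by positivity, fun i ξ hξ => ?_⟩
      rw [collocationDefect_add_right hT _ (hG.continuousOn i) (hG'.continuousOn i), add_mul]
      exact (norm_add_le _ _).trans (add_le_add (h1 i ξ hξ) (h2 i ξ hξ))
    | monomial l v D hD hv =>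
      obtain ⟨M, hM⟩ := isCompact_Icc.exists_bound_of_continuousOn (s := Icc (-T) T)
        (continuous_defectMoment (c := c) k l).continuousOn
      refine ⟨|M| * (C * D), by positivity, fun i ξ hξ => ?_⟩
      rw [collocationDefect_monomial]
      have hhn : ∀ n : ℕ, 0 ≤ h i ^ n := fun n => pow_nonneg (hh i).1.le n
      rcases hw k l with h0 | h0
      · rw [h0, zero_smul, norm_zero]
        exact mul_nonneg (by positivity) (hhn n)
      · rw [norm_smul]
        calc _ ≤ |M| * ((C * h i ^ wβ k) * (D * h i ^ wG l)) := by
              gcongr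
              · exact (hM ξ hξ).trans (le_abs_self _)
              · refine ((a i).le_opNorm _).trans ?_
                gcongr
                · exact mul_nonneg hC (hhn _)
                · exact ha i
                · exact hv i
          _ = |M| * (C * D) * h i ^ (wβ k + wG l) := by ring
          _ ≤ _ := mul_le_mul_of_nonneg_left (pow_le_pow_of_le_one (hh i).1.le (hh i).2 h0)
              (by positivity)

/-- If the pairing of the collocation defect with monomials vanishes for low weights, its pairing
with a slowly varying function is small. -/
theorem exists_bound_integral_collocationDefect (hT : 1 ≤ T) (hh : ∀ i, 0 < h i ∧ h i ≤ 1)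
    [CompleteSpace V₁] [CompleteSpace V₂]
    (hcT : ∀ j, c j ∈ Icc (-T) T)
    {wQ wβ wG : ℕ → ℕ}
    (hw : ∀ a b e, ∫ ξ in (0 : ℝ)..1, ξ ^ a * defectMoment c b e ξ = 0 ∨
      N ≤ wQ a + wβ b + wG e)
    {Q : ι → ℝ → V →L[ℝ] V₂} {β : ι → ℝ → V₁ →L[ℝ] V} {G : ι → ℝ → V₁}
    (hQ : HasExpansion h T N wQ Q) (hβ : HasExpansion h T N wβ β) (hG : HasExpansion h T N wG G) :
    ∃ C : ℝ, 0 ≤ C ∧ ∀ i,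
      ‖∫ ξ in (0 : ℝ)..1, Q i ξ (collocationDefect c (β i) (G i) ξ)‖ ≤ C * h i ^ N := by
  obtain ⟨C₀, hC₀, hbd⟩ := exists_bound_collocationDefect (V := V) (V₁ := V₁) hT hcT
  have hbd' : ∀ (Q : ℝ → V →L[ℝ] V₂) (β : ℝ → V₁ →L[ℝ] V) (G : ℝ → V₁) (q b g : ℝ), 0 ≤ q →
      (∀ ξ ∈ Icc (-T) T, ‖Q ξ‖ ≤ q) →
      (∀ ξ ∈ Icc (-T) T, ‖β ξ‖ ≤ b) → (∀ ξ ∈ Icc (-T) T, ‖G ξ‖ ≤ g) →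
      ‖∫ ξ in (0 : ℝ)..1, Q ξ (collocationDefect c β G ξ)‖ ≤ q * (C₀ * (b * g)) := by
    intro Q β G q b g hq hQ hβ hG
    have := intervalIntegral.norm_integral_le_of_norm_le_const (a := (0 : ℝ)) (b := 1)
      (C := q * (C₀ * (b * g))) (f := fun ξ => Q ξ (collocationDefect c β G ξ)) (fun ξ hξ => by
        rw [uIoc_of_le zero_le_one] at hξ
        have hξ' : ξ ∈ Icc (-T) T := ⟨by linarith [hξ.1], by linarith [hξ.2]⟩
        refine ((Q ξ).le_opNorm _).trans ?_
        gcongr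
        · exact hQ ξ hξ'
        · exact hbd _ _ _ _ hβ hG ξ hξ')
    simpa using this
  have hGc := hG.continuousOn
  have hβc := hβ.continuousOn
  obtain ⟨g, hg, hGb⟩ := hG.exists_bound hh
  obtain ⟨b, hb, hβb⟩ := hβ.exists_bound hh
  -- The integral is trilinear: nested inductions on the three expansions leave a single product of
  -- monomials, whose integral is a moment times a product of coefficients.
  induction hQ with
  | small Q C hC hQ hQb =>
    refine ⟨C * (C₀ * (b * g)), by positivity, fun i =>
      (hbd' _ _ _ _ _ _ (mul_nonneg hC (pow_nonneg (hh i).1.le _))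
        (hQb i) (hβb i) (hGb i)).trans (le_of_eq (by ring))⟩
  | add Q Q' hQ hQ' h1 h2 =>
    obtain ⟨C₁, hC₁, h1⟩ := h1
    obtain ⟨C₂, hC₂, h2⟩ := h2
    refine ⟨C₁ + C₂, by positivity, fun i => ?_⟩
    simp only [add_apply]
    have hd := continuousOn_collocationDefect (c := c) (hβc i) (hGc i)
    rw [intervalIntegral.integral_add
      (intervalIntegrable_of_continuousOn hT ((hQ.continuousOn i).clm_apply hd))
      (intervalIntegrable_of_continuousOn hT ((hQ'.continuousOn i).clm_apply hd)), add_mul]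
    exact (norm_add_le _ _).trans (add_le_add (h1 i) (h2 i))
  | monomial m p K hK hp =>
    have hQ := HasExpansion.monomial (T := T) (N := N) m p K hK hp
    obtain ⟨q, hq, hQb⟩ := hQ.exists_bound hh
    have hQc := hQ.continuousOn
    clear hβb hb b hQ
    induction hβ with
    | small β C hC hβ hb =>
      exact ⟨q * (C₀ * (C * g)), by positivity, fun i =>
        (hbd' _ _ _ _ _ _ hq (hQb i) (hb i) (hGb i)).trans (le_of_eq (by ring))⟩
    | add β β' hβ hβ' h1 h2 =>
      obtain ⟨C₁, hC₁, h1⟩ := h1 hβ.continuousOn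
      obtain ⟨C₂, hC₂, h2⟩ := h2 hβ'.continuousOn
      refine ⟨C₁ + C₂, by positivity, fun i => ?_⟩
      simp only [collocationDefect_add_left, map_add]
      rw [intervalIntegral.integral_add
        (intervalIntegrable_of_continuousOn hT ((hQc i).clm_apply
          (continuousOn_collocationDefect (hβ.continuousOn i) (hGc i))))
        (intervalIntegrable_of_continuousOn hT ((hQc i).clm_apply
          (continuousOn_collocationDefect (hβ'.continuousOn i) (hGc i)))), add_mul]
      exact (norm_add_le _ _).trans (add_le_add (h1 i) (h2 i))
    | monomial k a C hC ha =>
      have hβ := HasExpansion.monomial (T := T) (N := N) k a C hC ha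
      obtain ⟨b, hb, hβb⟩ := hβ.exists_bound hh
      clear hGb hg g
      induction hG with
      | small G D hD hG hGb =>
        exact ⟨q * (C₀ * (b * D)), by positivity, fun i =>
          (hbd' _ _ _ _ _ _ hq (hQb i) (hβb i) (hGb i)).trans (le_of_eq (by ring))⟩
      | add G G' hG hG' h1 h2 =>
        obtain ⟨C₁, hC₁, h1⟩ := h1 hG.continuousOn
        obtain ⟨C₂, hC₂, h2⟩ := h2 hG'.continuousOn
        refine ⟨C₁ + C₂, by positivity, fun i => ?_⟩
        simp only [collocationDefect_add_right hT _ (hG.continuousOn i) (hG'.continuousOn i),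
          map_add]
        rw [intervalIntegral.integral_add
          (intervalIntegrable_of_continuousOn hT ((hQc i).clm_apply
            (continuousOn_collocationDefect (hβc i) (hG.continuousOn i))))
          (intervalIntegrable_of_continuousOn hT ((hQc i).clm_apply
            (continuousOn_collocationDefect (hβc i) (hG'.continuousOn i)))), add_mul]
        exact (norm_add_le _ _).trans (add_le_add (h1 i) (h2 i))
      | monomial l v D hD hv =>
        refine ⟨|∫ ξ in (0 : ℝ)..1, ξ ^ m * defectMoment c k l ξ| * (K * C * D), by positivity,
          fun i => ?_⟩
        simp only [collocationDefect_monomial, map_smul, smul_apply, smul_smul]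
        simp only [mul_comm (defectMoment c k l _)]
        rw [intervalIntegral.integral_smul_const]
        have hhn : ∀ n : ℕ, 0 ≤ h i ^ n := fun n => pow_nonneg (hh i).1.le n
        rcases hw m k l with h0 | h0
        · rw [h0, zero_smul, norm_zero, abs_zero, zero_mul, zero_mul]
        · rw [norm_smul, Real.norm_eq_abs, mul_assoc]
          refine mul_le_mul_of_nonneg_left ?_ (abs_nonneg _)
          calc _ ≤ (K * h i ^ wQ m) * ((C * h i ^ wβ k) * (D * h i ^ wG l)) := by
                refine ((p i).le_opNorm _).trans ?_
                gcongr
                · exact mul_nonneg hK (hhn _)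
                · exact hp i
                · refine ((a i).le_opNorm _).trans ?_
                  gcongr
                  · exact mul_nonneg hC (hhn _)
                  · exact ha i
                  · exact hv i
            _ = K * C * D * h i ^ (wQ m + wβ k + wG l) := by ring
            _ ≤ _ := mul_le_mul_of_nonneg_left (pow_le_pow_of_le_one (hh i).1.le (hh i).2 h0)
              (by positivity)

end Defect

/-! ### Local flows and Taylor expansion along integral curves. -/

section Flow

variable {W V : Type*} [NormedAddCommGroup W] [NormedSpace ℝ W]
  [NormedAddCommGroup V] [NormedSpace ℝ V]

/-- A locally smooth map agrees near a given point with a smooth map of compact support. -/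
theorem exists_contDiff_hasCompactSupport [FiniteDimensional ℝ W] {f : W → V} {U : Set W} {w₀ : W}
    (hU : U ∈ 𝓝 w₀) (hf : ContDiffOn ℝ ∞ f U) :
    ∃ g : W → V, ContDiff ℝ ∞ g ∧ HasCompactSupport g ∧ ∃ ρ > 0, ∀ w ∈ Metric.ball w₀ ρ,
      g w = f w := by
  obtain ⟨R, hR, hRU⟩ := Metric.mem_nhds_iff.1 hU
  let φ : ContDiffBump w₀ := ⟨R / 4, R / 2, by positivity, by linarith⟩
  refine ⟨fun w => φ w • f w, ?_, φ.hasCompactSupport.smul_right, R / 4, by positivity,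
    fun w hw => ?_⟩
  · rw [contDiff_iff_contDiffAt]
    intro w
    by_cases hw : w ∈ Metric.ball w₀ R
    · exact φ.contDiffAt.smul
        ((hf.mono hRU).contDiffAt (Metric.isOpen_ball.mem_nhds hw))
    · have : (fun w => φ w • f w) =ᶠ[𝓝 w] fun _ => 0 := by
        have hw' : w ∈ {w | R / 2 < dist w w₀} := by
          have : R ≤ dist w w₀ := not_lt.1 hw
          show R / 2 < dist w w₀
          linarith
        filter_upwards [(isOpen_lt continuous_const (by fun_prop)).mem_nhds hw'] with x hx
        rw [φ.zero_of_le_dist (le_of_lt hx), zero_smul]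
      exact contDiffAt_const.congr_of_eventuallyEq this
  · simp only
    rw [φ.one_of_mem_closedBall (Metric.ball_subset_closedBall hw), one_smul]

/-- Local existence of the flow of a vector field, in a prescribed ball. -/
theorem exists_uniform_local_flow [FiniteDimensional ℝ W] {X : W → W} (hX : ContDiff ℝ ∞ X)
    (w₀ : W) {R : ℝ} (hR : 0 < R) :
    ∃ ρ > 0, ∃ τ > 0, ∀ w ∈ Metric.closedBall w₀ ρ, ∃ α : ℝ → W, α 0 = w ∧
      ∀ t ∈ Icc (-τ) τ, HasDerivAt α (X (α t)) t ∧ α t ∈ Metric.closedBall w₀ R := by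
  -- The cut-off is 1 on the ball of radius R, and the truncated field is bounded by some M. A curve
  -- starting within R/2 of the centre cannot leave that ball before time R/2/(M + 1), so on this
  -- interval it solves the original equation.
  let φ : ContDiffBump w₀ := ⟨R, 2 * R, hR, by linarith⟩
  have hY : ContDiff ℝ 1 (fun w => φ w • X w) := φ.contDiff.smul (hX.of_le (by simp))
  obtain ⟨M, hM⟩ := (φ.hasCompactSupport.smul_right (f' := X)).exists_bound_of_continuous
    hY.continuous
  have hM0 : 0 ≤ M := (norm_nonneg _).trans (hM w₀)
  have := FiniteDimensional.complete ℝ W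
  obtain ⟨r, hr, ε, hε, h⟩ :=
    (hY.contDiffAt (x := w₀)).exists_forall_mem_closedBall_exists_eq_forall_mem_Ioo_hasDerivAt 0
  have hM1 : 0 < R / 2 / (M + 1) := by positivity
  refine ⟨min r (R / 2), by positivity, min (ε / 2) (R / 2 / (M + 1)), by positivity,
    fun w hw => ?_⟩
  obtain ⟨α, hα0, hα⟩ := h w (Metric.closedBall_subset_closedBall (min_le_left _ _) hw)
  refine ⟨α, hα0, ?_⟩
  set τ := min (ε / 2) (R / 2 / (M + 1))
  have hτ : 0 < τ := by positivity
  have hτε : τ ≤ ε / 2 := min_le_left _ _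
  have hτM : τ ≤ R / 2 / (M + 1) := min_le_right _ _
  have hα' : ∀ t ∈ Icc (-τ) τ, HasDerivAt α (φ (α t) • X (α t)) t := fun t ht =>
    hα t ⟨by linarith [ht.1], by linarith [ht.2]⟩
  have hmem : ∀ t ∈ Icc (-τ) τ, α t ∈ Metric.closedBall w₀ R := fun t ht => by
    have h1 := (convex_Icc (-τ) τ).norm_image_sub_le_of_norm_hasDerivWithin_le
      (fun x hx => (hα' x hx).hasDerivWithinAt) (fun x _ => hM (α x))
      (x := 0) (y := t) ⟨by linarith, hτ.le⟩ ht
    rw [hα0, sub_zero, Real.norm_eq_abs] at h1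
    have h2 : |t| ≤ τ := abs_le.2 ht
    have h3 : M * |t| ≤ R / 2 := by
      calc M * |t| ≤ (M + 1) * (R / 2 / (M + 1)) := by
            gcongr
            · linarith
            · exact h2.trans hτM
        _ = R / 2 := by field_simp
    have h4 : dist w w₀ ≤ R / 2 := (Metric.mem_closedBall.1 hw).trans (min_le_right _ _)
    rw [Metric.mem_closedBall]
    have h5 : dist (α t) w ≤ R / 2 := by rw [dist_eq_norm]; exact h1.trans h3
    linarith [dist_triangle (α t) w w₀]
  intro t ht
  refine ⟨?_, hmem t ht⟩
  have := hα' t ht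
  rwa [φ.one_of_mem_closedBall (hmem t ht), one_smul] at this

/-- Uniform Taylor expansions of a smooth function along the integral curves of a smooth vector
field that lie in a given compact set. -/
theorem exists_taylor_along_integral_curve {X : W → W} (hX : ContDiff ℝ ∞ X) {S : Set W}
    (hS : IsCompact S) (N : ℕ) {b : W → V} (hb : ContDiff ℝ ∞ b) :
    ∃ C : ℝ, 0 ≤ C ∧ ∀ τ : ℝ, 0 ≤ τ → ∀ α : ℝ → W,
      (∀ t ∈ Icc (-τ) τ, HasDerivAt α (X (α t)) t ∧ α t ∈ S) →
      ∃ a : ℕ → V, (∀ k, ‖a k‖ ≤ C) ∧ ∀ t ∈ Icc (-τ) τ,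
        ‖b (α t) - ∑ k ∈ Finset.range N, t ^ k • a k‖ ≤ C * |t| ^ N := by
  induction N generalizing b with
  | zero =>
    obtain ⟨C, hC⟩ := hS.exists_bound_of_continuousOn hb.continuous.continuousOn
    refine ⟨|C|, abs_nonneg _, fun τ _ α hα => ⟨fun _ => 0, by simp, fun t ht => ?_⟩⟩
    simpa using (hC _ (hα t ht).2).trans (le_abs_self C)
  | succ N ih =>
    -- Along an integral curve the derivative of b ∘ α is (Db · X) ∘ α, again a smooth function of
    -- the state. The induction hypothesis expands it with constants independent of the curve, and
    -- the mean value inequality integrates the expansion.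
    have hb' : ContDiff ℝ ∞ (fun w => fderiv ℝ b w (X w)) :=
      (hb.fderiv_right (m := ∞) (by simp)).clm_apply hX
    obtain ⟨C, hC, hT⟩ := ih hb'
    obtain ⟨D, hD⟩ := hS.exists_bound_of_continuousOn hb.continuous.continuousOn
    refine ⟨C + |D|, by positivity, fun τ hτ α hα => ?_⟩
    obtain ⟨a, ha, hat⟩ := hT τ hτ α hα
    have h0 : (0 : ℝ) ∈ Icc (-τ) τ := ⟨by linarith, hτ⟩
    -- Termwise integration: the initial value, followed by the coefficients of the derivative
    -- divided by k + 1.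
    refine ⟨fun k => Nat.casesOn k (b (α 0)) fun k => ((k : ℝ) + 1)⁻¹ • a k, fun k => ?_,
      fun t ht => ?_⟩
    · cases k with
      | zero => exact (hD _ (hα 0 h0).2).trans ((le_abs_self D).trans (by linarith))
      | succ k =>
        show ‖((k : ℝ) + 1)⁻¹ • a k‖ ≤ _
        rw [norm_smul, norm_inv, Real.norm_eq_abs, abs_of_pos (by positivity)]
        calc ((k : ℝ) + 1)⁻¹ * ‖a k‖ ≤ 1 * C := by
              gcongr
              · exact inv_le_one_of_one_le₀ (by linarith [Nat.cast_nonneg (α := ℝ) k])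
              · exact ha k
          _ ≤ _ := by linarith [abs_nonneg D]
    · rw [Finset.sum_range_succ']
      simp only [pow_zero, one_smul]
      have hderiv : ∀ x ∈ uIcc 0 t, HasDerivWithinAt
          (fun x => b (α x) - ∑ k ∈ Finset.range N, x ^ (k + 1) • ((k : ℝ) + 1)⁻¹ • a k)
          (fderiv ℝ b (α x) (X (α x)) - ∑ k ∈ Finset.range N, x ^ k • a k) (uIcc 0 t) x := by
        intro x hx
        have hx' : x ∈ Icc (-τ) τ := uIcc_subset_Icc h0 ht hx
        refine (HasDerivAt.sub ?_ ?_).hasDerivWithinAt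
        · exact ((hb.differentiable (by simp) (α x)).hasFDerivAt).comp_hasDerivAt x (hα x hx').1
        · refine HasDerivAt.fun_sum fun k _ => ?_
          have h1 := ((hasDerivAt_pow (k + 1) x).smul_const (((k : ℝ) + 1)⁻¹ • a k))
          convert h1 using 1
          rw [smul_smul]
          congr 1
          push_cast
          field_simp
      have hmv := (convex_uIcc (0 : ℝ) t).norm_image_sub_le_of_norm_hasDerivWithin_le hderiv
        (C := C * |t| ^ N) (fun x hx => (hat x (uIcc_subset_Icc h0 ht hx)).trans (by
          have : |x| ≤ |t| := by
            have := abs_sub_left_of_mem_uIcc hx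
            simpa using this
          gcongr)) left_mem_uIcc right_mem_uIcc
      simp only [sub_zero, Real.norm_eq_abs, zero_pow (Nat.succ_ne_zero _), zero_smul,
        Finset.sum_const_zero] at hmv
      calc _ = ‖b (α t) - ∑ k ∈ Finset.range N, t ^ (k + 1) • ((k : ℝ) + 1)⁻¹ • a k - b (α 0)‖ := by
            congr 1; abel
        _ ≤ C * |t| ^ N * |t| := hmv
        _ = C * |t| ^ (N + 1) := by ring
        _ ≤ _ := by gcongr; linarith [abs_nonneg D]

/-- A smooth function has an expansion with full weights along a family of integral curves. -/
theorem hasExpansion_comp_integral_curve {X : W → W} (hX : ContDiff ℝ ∞ X) {S : Set W}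
    (hS : IsCompact S) {b : W → V} (hb : ContDiff ℝ ∞ b) {ι : Type*} {h : ι → ℝ} {T τ : ℝ} {N : ℕ}
    (hT : 0 ≤ T) (hh : ∀ i, 0 < h i ∧ T * h i ≤ τ) {α : ι → ℝ → W}
    (hα : ∀ i, ∀ t ∈ Icc (-τ) τ, HasDerivAt (α i) (X (α i t)) t ∧ α i t ∈ S) :
    HasExpansion h T N id (fun i ξ => b (α i (ξ * h i))) := by
  obtain ⟨C, hC, H⟩ := exists_taylor_along_integral_curve hX hS N hb
  have hτ : ∀ i, 0 ≤ τ := fun i => (mul_nonneg hT (hh i).1.le).trans (hh i).2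
  choose a ha hat using fun i => H τ (hτ i) (α i) (hα i)
  have hmem : ∀ i, ∀ ξ ∈ Icc (-T) T, ξ * h i ∈ Icc (-τ) τ := fun i ξ hξ => by
    have h1 : |ξ| ≤ T := abs_le.2 hξ
    rw [mem_Icc, ← abs_le, abs_mul, abs_of_pos (hh i).1]
    exact (mul_le_mul_of_nonneg_right h1 (hh i).1.le).trans (hh i).2
  -- Substituting t = ξh moves the factor h^k into the coefficient of ξ^k, which is the full weight.
  have hsum : HasExpansion h T N id
      (fun i ξ => ∑ k ∈ Finset.range N, ξ ^ k • (h i ^ k • a i k)) :=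
    HasExpansion.sum (F := fun k i ξ => ξ ^ k • (h i ^ k • a i k)) _ fun k _ =>
      HasExpansion.monomial k _ C hC fun i => by
        rw [norm_smul, norm_pow, Real.norm_eq_abs, abs_of_pos (hh i).1, mul_comm]
        exact mul_le_mul_of_nonneg_right (ha i k) (pow_nonneg (hh i).1.le _)
  have hrem : HasExpansion h T N id
      (fun i ξ => b (α i (ξ * h i)) - ∑ k ∈ Finset.range N, ξ ^ k • (h i ^ k • a i k)) := by
    refine HasExpansion.small _ (C * T ^ N) (by positivity) (fun i => ?_) fun i ξ hξ => ?_
    · refine ContinuousOn.sub ?_ (by fun_prop)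
      refine hb.continuous.comp_continuousOn (ContinuousOn.comp (t := Icc (-τ) τ)
        (fun t ht => (hα i t ht).1.continuousAt.continuousWithinAt) (by fun_prop)
        fun ξ hξ => hmem i ξ hξ)
    · have h1 := hat i (ξ * h i) (hmem i ξ hξ)
      simp only [mul_pow, ← smul_smul] at h1
      refine h1.trans ?_
      have h2 : |ξ| ≤ T := abs_le.2 hξ
      rw [abs_mul, mul_pow, abs_of_pos (hh i).1, ← mul_assoc]
      exact mul_le_mul_of_nonneg_right (by gcongr) (pow_nonneg (hh i).1.le _)
  simpa using HasExpansion.add _ _ hrem hsum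

end Flow

/-! ### Vanishing of the moments below the claimed order. -/

section Moments

variable {s : ℕ} {c : Fin s → ℝ} {r : ℕ}

/-- The averages in the method act as point evaluations at the nodes on monomials of degree at most
r - s. -/
theorem inv_weight_mul_integral_lagrangeBasis (hc : Function.Injective c)
    (hb : ∀ i, weight c i ≠ 0) (hr : IsQuadratureOrder c r)
    {e : ℕ} (he : e + s ≤ r) (j : Fin s) :
    (weight c j)⁻¹ * ∫ η in (0 : ℝ)..1, lagrangeBasis c j η * η ^ e = c j ^ e := by
  simp only [mul_comm (lagrangeBasis c j _)]
  rw [integral_pow_mul_lagrangeBasis hc hr he, inv_mul_cancel_left₀ (hb j)]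

/-- Here the average of η^e is the point value c_j^e, and interpolation at s nodes reproduces degree
b + e < s. -/
theorem defectMoment_eq_zero (hc : Function.Injective c) (hb : ∀ i, weight c i ≠ 0)
    (hr : IsQuadratureOrder c r)
    {b e : ℕ} (he : e + s ≤ r) (hbe : b + e < s) (ξ : ℝ) :
    defectMoment c b e ξ = 0 := by
  simp only [defectMoment, inv_weight_mul_integral_lagrangeBasis hc hb hr he, ← pow_add,
    sum_lagrangeBasis_mul_pow hc hbe, sub_self]

/-- Testing against ξ^a with a ≤ r - s turns the interpolant into a quadrature sum, since each basis
polynomial integrates to b_j c_j^a. -/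
theorem integral_pow_mul_defectMoment (hc : Function.Injective c) (hr : IsQuadratureOrder c r)
    {a b e : ℕ} (ha : a + s ≤ r) :
    ∫ ξ in (0 : ℝ)..1, ξ ^ a * defectMoment c b e ξ =
      ∑ j, weight c j * c j ^ a *
        (c j ^ b * ((weight c j)⁻¹ * ∫ η in (0 : ℝ)..1, lagrangeBasis c j η * η ^ e)) -
      ∫ ξ in (0 : ℝ)..1, ξ ^ (a + b + e) := by
  have hl := continuous_lagrangeBasis c
  simp only [defectMoment, mul_sub, Finset.mul_sum, ← pow_add, ← add_assoc, ← mul_assoc]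
  rw [intervalIntegral.integral_sub, intervalIntegral.integral_finsetSum]
  · congr 1
    refine Finset.sum_congr rfl fun j _ => ?_
    simp only [intervalIntegral.integral_mul_const, integral_pow_mul_lagrangeBasis hc hr ha]
  · exact fun j _ => Continuous.intervalIntegrable (by fun_prop) _ _
  · exact Continuous.intervalIntegrable (by fun_prop) _ _
  · exact Continuous.intervalIntegrable (by fun_prop) _ _

/-- Two mechanisms. If the average of η^e is a point value, the claim is quadrature exactness in
degree a + b + e. Otherwise the factor b_j cancels the normalisation of the average, and
interpolation reproduces η^(a+b) under the integral, with no condition on e. -/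
theorem integral_pow_mul_defectMoment_eq_zero (hc : Function.Injective c)
    (hb : ∀ i, weight c i ≠ 0) (hr : IsQuadratureOrder c r)
    {a b e : ℕ} (ha : a + s ≤ r)
    (h : (e + s ≤ r ∧ a + b + e < r) ∨ a + b < s) :
    ∫ ξ in (0 : ℝ)..1, ξ ^ a * defectMoment c b e ξ = 0 := by
  have hl := continuous_lagrangeBasis c
  rw [integral_pow_mul_defectMoment hc hr ha, sub_eq_zero]
  rcases h with ⟨he, hlt⟩ | hlt
  · simp only [inv_weight_mul_integral_lagrangeBasis hc hb hr he]
    rw [integral_pow_eq_sum hr hlt]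
    exact Finset.sum_congr rfl fun j _ => by ring
  · have h1 : ∀ j, weight c j * c j ^ a *
        (c j ^ b * ((weight c j)⁻¹ * ∫ η in (0 : ℝ)..1, lagrangeBasis c j η * η ^ e)) =
        ∫ η in (0 : ℝ)..1, lagrangeBasis c j η * c j ^ (a + b) * η ^ e := fun j => by
      have : ∀ η, lagrangeBasis c j η * c j ^ (a + b) * η ^ e =
          c j ^ (a + b) * (lagrangeBasis c j η * η ^ e) := fun η => by ring
      simp only [this, intervalIntegral.integral_const_mul]
      have := hb j
      rw [pow_add]
      field_simp
    simp only [h1]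
    rw [← intervalIntegral.integral_finsetSum
      (fun j _ => Continuous.intervalIntegrable (by fun_prop) _ _)]
    simp only [← Finset.sum_mul, sum_lagrangeBasis_mul_pow hc hlt, ← pow_add]

/-- The weights of the numerical solution: its coefficients of degree `k` are `O(h^(w k))`. -/
def solutionWeight (s r k : ℕ) : ℕ := min k (min (s + 1) (r - s + 2) + (k - s))

theorem defectMoment_vanishing (hc : Function.Injective c) (hb : ∀ i, weight c i ≠ 0)
    (hr : IsQuadratureOrder c r)
    (b e : ℕ) :
    (∀ ξ, defectMoment c b e ξ = 0) ∨ min s (r - s + 1) ≤ id b + id e := by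
  have hsr := card_nodes_le_order hc hr
  by_cases h : b + e < min s (r - s + 1)
  · exact Or.inl fun ξ => defectMoment_eq_zero hc hb hr (by omega) (by omega) ξ
  · exact Or.inr (not_lt.1 h)

/-- Let w = `solutionWeight s r`, m = min(s + 1, r - s + 2), and suppose the total weight is below
p. If a > r - s, then w b + w e < min(s, r - s + 1). Both weights are therefore full, and the defect
vanishes pointwise. Let a ≤ r - s. If both weights are full, then a + b + e < r, and either e ≤ r -
s or a + b < s. A reduced weight is at least m and forces m = r - s + 2, because r = 2s otherwise
and no weight is reduced. A reduced w b then gives e ≤ r - s and a + b + e < r; a reduced w e gives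
a + b < r - s ≤ s. -/
theorem integral_pow_mul_defectMoment_vanishing (hc : Function.Injective c)
    (hb : ∀ i, weight c i ≠ 0) (hr : IsQuadratureOrder c r)
    (a b e : ℕ) :
    ∫ ξ in (0 : ℝ)..1, ξ ^ a * defectMoment c b e ξ = 0 ∨
      min r (2 * r - 2 * s + 2) ≤ id a + solutionWeight s r b + solutionWeight s r e := by
  have hsr := card_nodes_le_order hc hr
  have hrs := order_le_two_mul_card_nodes hr
  by_cases h : min r (2 * r - 2 * s + 2) ≤ id a + solutionWeight s r b + solutionWeight s r e
  · exact Or.inr h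
  left
  simp only [solutionWeight, id] at h
  have h3 : (a + s ≤ r ∧ ((e + s ≤ r ∧ a + b + e < r) ∨ a + b < s)) ∨ (e + s ≤ r ∧ b + e < s) := by
    omega
  rcases h3 with ⟨ha, h3⟩ | ⟨he, hbe⟩
  · exact integral_pow_mul_defectMoment_eq_zero hc hb hr ha h3
  · simp [defectMoment_eq_zero hc hb hr he hbe]

end Moments

/-- The tail with k - s in `solutionWeight` exists for this inequality. In a product of a
full-weight factor with the polynomial σ, degree beyond s comes from the full-weight factor and
earns one power of h per degree. -/
theorem solutionWeight_add_le {s r : ℕ} (a b : ℕ) :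
    solutionWeight s r (a + b) ≤ id a + solutionWeight s r b := by
  simp only [solutionWeight, id]
  omega

theorem solutionWeight_le {s r : ℕ} (k : ℕ) : solutionWeight s r k ≤ id k := min_le_left _ _

/-! ### Global Lipschitz and second-order Taylor bounds. -/

section CompactSupport

variable {W V : Type*} [NormedAddCommGroup W] [NormedSpace ℝ W]
  [NormedAddCommGroup V] [NormedSpace ℝ V]

theorem exists_lipschitz_of_hasCompactSupport {f : W → V} (hf : ContDiff ℝ ∞ f)
    (hfs : HasCompactSupport f) : ∃ K : ℝ, 0 ≤ K ∧ ∀ x y, ‖f x - f y‖ ≤ K * ‖x - y‖ := by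
  obtain ⟨K, hK⟩ := (hfs.fderiv (𝕜 := ℝ)).exists_bound_of_continuous
    (hf.continuous_fderiv (by simp))
  refine ⟨K, (norm_nonneg _).trans (hK 0), fun x y => ?_⟩
  exact convex_univ.norm_image_sub_le_of_norm_fderiv_le
    (fun z _ => hf.differentiable (by simp) z) (fun z _ => hK z) (mem_univ y) (mem_univ x)

theorem exists_taylor_two_of_hasCompactSupport {f : W → V} (hf : ContDiff ℝ ∞ f)
    (hfs : HasCompactSupport f) :
    ∃ K : ℝ, 0 ≤ K ∧ ∀ x v, ‖f (x + v) - f x - fderiv ℝ f x v‖ ≤ K * ‖v‖ ^ 2 := by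
  obtain ⟨K, hK, hL⟩ := exists_lipschitz_of_hasCompactSupport
    (hf.fderiv_right (m := ∞) (by simp)) (hfs.fderiv (𝕜 := ℝ))
  refine ⟨K, hK, fun x v => ?_⟩
  have h := (convex_segment x (x + v)).norm_image_sub_le_of_norm_fderiv_le'
    (f := f) (φ := fderiv ℝ f x) (C := K * ‖v‖) (𝕜 := ℝ)
    (fun z _ => hf.differentiable (by simp) z) (fun z hz => (hL z x).trans (by
      gcongr
      obtain ⟨t, ht, rfl⟩ := (segment_eq_image' ℝ x (x + v)) ▸ hz
      rw [add_sub_cancel_left, add_sub_cancel_left, norm_smul, Real.norm_eq_abs,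
        abs_of_nonneg ht.1]
      exact mul_le_of_le_one_left (norm_nonneg _) ht.2))
    (left_mem_segment ℝ x (x + v)) (right_mem_segment ℝ x (x + v))
  rw [add_sub_cancel_left] at h
  calc _ ≤ K * ‖v‖ * ‖v‖ := h
    _ = _ := by ring

end CompactSupport

/-! ### Recovering polynomial coefficients from values. -/

section Coefficients

/-- The coefficients of a polynomial are controlled by its values on `[0, 1]`. -/
theorem exists_bound_coefficients (n : ℕ) (V : Type*) [NormedAddCommGroup V] [NormedSpace ℝ V] :
    ∃ C : ℝ, 0 ≤ C ∧ ∀ (a : Fin (n + 1) → V) (D : ℝ),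
      (∀ ξ ∈ Icc (0 : ℝ) 1, ‖∑ k : Fin (n + 1), ξ ^ (k : ℕ) • a k‖ ≤ D) → ∀ k, ‖a k‖ ≤ C * D := by
  -- Equidistant sample points in [0, 1); the inverse Vandermonde matrix expresses each coefficient
  -- by the sampled values.
  let x : Fin (n + 1) → ℝ := fun i => (i : ℝ) / (n + 1)
  have hx : Function.Injective x := fun i j hij => by
    have h1 : (n : ℝ) + 1 ≠ 0 := by positivity
    have h2 : (i : ℝ) = j := by
      simpa [x, div_left_inj' h1] using hij
    exact Fin.ext (by exact_mod_cast h2)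
  have hx01 : ∀ i, x i ∈ Icc (0 : ℝ) 1 := fun i => by
    refine ⟨by positivity, ?_⟩
    rw [div_le_one (by positivity)]
    exact_mod_cast i.2.le
  have hdet : IsUnit (Matrix.vandermonde x).det :=
    isUnit_iff_ne_zero.2 (Matrix.det_vandermonde_ne_zero_iff.2 hx)
  set A := (Matrix.vandermonde x)⁻¹
  have hA : A * Matrix.vandermonde x = 1 := Matrix.nonsing_inv_mul _ hdet
  refine ⟨∑ k, ∑ i, |A k i|, by positivity, fun a D hD k => ?_⟩
  have hD0 : 0 ≤ D := (norm_nonneg _).trans (hD 0 (by simp))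
  have hak : a k = ∑ i, A k i • ∑ l : Fin (n + 1), x i ^ (l : ℕ) • a l := by
    simp only [Finset.smul_sum, smul_smul]
    rw [Finset.sum_comm]
    simp only [← Finset.sum_smul]
    have h1 : ∀ l : Fin (n + 1), ∑ i, A k i * x i ^ (l : ℕ) = if k = l then 1 else 0 := fun l => by
      have := congrFun (congrFun hA k) l
      rw [Matrix.mul_apply, Matrix.one_apply] at this
      simpa [Matrix.vandermonde_apply] using this
    simp [h1]
  rw [hak]
  refine (norm_sum_le _ _).trans ?_
  calc ∑ i, ‖A k i • ∑ l : Fin (n + 1), x i ^ (l : ℕ) • a l‖ ≤ ∑ i, |A k i| * D := by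
        refine Finset.sum_le_sum fun i _ => ?_
        rw [norm_smul, Real.norm_eq_abs]
        gcongr
        exact hD _ (hx01 i)
    _ = (∑ i, |A k i|) * D := by rw [Finset.sum_mul]
    _ ≤ _ := mul_le_mul_of_nonneg_right (Finset.single_le_sum (f := fun k => ∑ i, |A k i|)
        (fun k _ => Finset.sum_nonneg fun _ _ => abs_nonneg _) (Finset.mem_univ k)) hD0

end Coefficients

theorem HasExpansion.congr {ι : Type*} {h : ι → ℝ} {T : ℝ} {N : ℕ} {V : Type*}
    [NormedAddCommGroup V] [NormedSpace ℝ V] {w : ℕ → ℕ}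
    {F G : ι → ℝ → V} (hF : HasExpansion h T N w F)
    (hFG : ∀ i, ∀ ξ ∈ Icc (-T) T, G i ξ = F i ξ) : HasExpansion h T N w G := by
  have : HasExpansion h T N w (fun i ξ => G i ξ - F i ξ) :=
    small _ 0 le_rfl (fun i => (continuousOn_const (c := (0 : V))).congr fun ξ hξ => by
      simp [hFG i ξ hξ]) fun i ξ hξ => by simp [hFG i ξ hξ]
  simpa using add _ _ this hF

/-! ### The method in a vector space and its solvability. -/

section ModelStep

variable {s : ℕ} {P E F : Type*} [NormedAddCommGroup P] [NormedSpace ℝ P]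
  [NormedAddCommGroup E] [NormedSpace ℝ E] [NormedAddCommGroup F] [NormedSpace ℝ F]

/-- The right hand side of the collocation conditions in a vector space. -/
noncomputable def modelStage (c : Fin s → ℝ) (B : P × E → F →L[ℝ] E) (g : P × E → F) (z : P)
    (u : ℝ → E) (j : Fin s) : E :=
  B (z, u (c j)) (∫ ξ in (0 : ℝ)..1, (lagrangeBasis c j ξ / weight c j) • g (z, u ξ))

/-- One step of the collocation-like method for `y' = B(z, y) g(z, y)` in a vector space. -/
structure IsModelStep (c : Fin s → ℝ) (B : P × E → F →L[ℝ] E) (g : P × E → F) (z : P) (h : ℝ)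
    (σ : ℝ → E) : Prop where
  polynomial : ∃ a : Fin (s + 1) → E, ∀ t, σ t = ∑ k : Fin (s + 1), t ^ (k : ℕ) • a k
  collocation : ∀ j, deriv σ (c j * h) = modelStage c B g z (fun ξ => σ (ξ * h)) j

variable {c : Fin s → ℝ} {B : P × E → F →L[ℝ] E} {g : P × E → F}

theorem modelStage_eq (z : P) (u : ℝ → E) (j : Fin s) :
    modelStage c B g z u j = B (z, u (c j))
      ((weight c j)⁻¹ • ∫ ξ in (0 : ℝ)..1, lagrangeBasis c j ξ • g (z, u ξ)) := by
  rw [modelStage, ← intervalIntegral.integral_smul]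
  simp only [smul_smul, div_eq_inv_mul]

theorem collocationDefect_eq_sum_modelStage (z : P) (u : ℝ → E) (ξ : ℝ) :
    collocationDefect c (fun ξ => B (z, u ξ)) (fun ξ => g (z, u ξ)) ξ =
      ∑ j, lagrangeBasis c j ξ • modelStage c B g z u j - B (z, u ξ) (g (z, u ξ)) := by
  simp only [collocationDefect, modelStage_eq]

/-- Compact support bounds B, g and their first derivatives globally, so one constant serves all
parameters z and all curves. It drives both the contraction argument and the preliminary error
bound. -/
theorem exists_lipschitz_modelStage {T : ℝ} (hT : 1 ≤ T) (hcT : ∀ j, c j ∈ Icc (-T) T)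
    (hB : ContDiff ℝ ∞ B) (hBs : HasCompactSupport B) (hg : ContDiff ℝ ∞ g)
    (hgs : HasCompactSupport g) :
    ∃ L : ℝ, 0 ≤ L ∧ ∀ (z : P) (u : ℝ → E), ContinuousOn u (Icc (-T) T) →
      (∀ j, ‖modelStage c B g z u j‖ ≤ L) ∧
      ∀ (u' : ℝ → E) (D : ℝ), ContinuousOn u' (Icc (-T) T) →
      (∀ ξ ∈ Icc (-T) T, ‖u ξ - u' ξ‖ ≤ D) →
      ∀ j, ‖modelStage c B g z u j - modelStage c B g z u' j‖ ≤ L * D := by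
  obtain ⟨KB, hKB, hBL⟩ := exists_lipschitz_of_hasCompactSupport hB hBs
  obtain ⟨Kg, hKg, hgL⟩ := exists_lipschitz_of_hasCompactSupport hg hgs
  obtain ⟨bB, hbB⟩ := hBs.exists_bound_of_continuous hB.continuous
  obtain ⟨bg, hbg⟩ := hgs.exists_bound_of_continuous hg.continuous
  obtain ⟨Cl, hCl, hl⟩ := exists_bound_lagrangeBasis c T
  have hbB0 : 0 ≤ bB := (norm_nonneg _).trans (hbB 0)
  have hbg0 : 0 ≤ bg := (norm_nonneg _).trans (hbg 0)
  set wt := ∑ j, |(weight c j)⁻¹|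
  have hwt : ∀ j, |(weight c j)⁻¹| ≤ wt := fun j =>
    Finset.single_le_sum (f := fun j => |(weight c j)⁻¹|) (fun _ _ => abs_nonneg _)
      (Finset.mem_univ j)
  have hwt0 : 0 ≤ wt := Finset.sum_nonneg fun _ _ => abs_nonneg _
  have hint : ∀ (G : ℝ → F) (D : ℝ), (∀ ξ ∈ Icc (0 : ℝ) 1, ‖G ξ‖ ≤ D) → ∀ j,
      ‖(weight c j)⁻¹ • ∫ ξ in (0 : ℝ)..1, lagrangeBasis c j ξ • G ξ‖ ≤ wt * (Cl * D) := by
    intro G D hG j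
    rw [norm_smul, Real.norm_eq_abs]
    gcongr
    · exact hwt j
    · exact norm_integral_lagrangeBasis_smul_le hT hCl hl hG j
  refine ⟨bB * (wt * (Cl * bg)) + (bB * (wt * (Cl * Kg)) + KB * (wt * (Cl * bg))), by positivity,
    fun z u hu => ⟨fun j => ?_, fun u' D hu' hD j => ?_⟩⟩
  · rw [modelStage_eq]
    calc _ ≤ bB * (wt * (Cl * bg)) := by
          refine ((B _).le_opNorm _).trans ?_
          gcongr
          · exact hbB _
          · exact hint _ _ (fun ξ _ => hbg _) j
      _ ≤ _ := le_add_of_nonneg_right (by positivity)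
  · have hD0 : 0 ≤ D := (norm_nonneg _).trans (hD _ (hcT j))
    have hgd : ∀ ξ ∈ Icc (0 : ℝ) 1, ‖g (z, u ξ) - g (z, u' ξ)‖ ≤ Kg * D := fun ξ hξ => by
      refine (hgL _ _).trans ?_
      gcongr
      rw [Prod.mk_sub_mk, sub_self, Prod.norm_mk, norm_zero, max_eq_right (norm_nonneg _)]
      exact hD ξ ⟨by linarith [hξ.1], by linarith [hξ.2]⟩
    have hc1 : ContinuousOn (fun ξ => g (z, u ξ)) (Icc (-T) T) :=
      hg.continuous.comp_continuousOn (by fun_prop)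
    have hc2 : ContinuousOn (fun ξ => g (z, u' ξ)) (Icc (-T) T) :=
      hg.continuous.comp_continuousOn (by fun_prop)
    have hBd : ‖B (z, u (c j)) - B (z, u' (c j))‖ ≤ KB * D := by
      refine (hBL _ _).trans ?_
      gcongr
      rw [Prod.mk_sub_mk, sub_self, Prod.norm_mk, norm_zero, max_eq_right (norm_nonneg _)]
      exact hD _ (hcT j)
    have hsplit : modelStage c B g z u j - modelStage c B g z u' j =
        B (z, u (c j)) ((weight c j)⁻¹ • ∫ ξ in (0 : ℝ)..1, lagrangeBasis c j ξ •
          (g (z, u ξ) - g (z, u' ξ))) +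
        (B (z, u (c j)) - B (z, u' (c j))) ((weight c j)⁻¹ •
          ∫ ξ in (0 : ℝ)..1, lagrangeBasis c j ξ • g (z, u' ξ)) := by
      simp only [smul_sub]
      rw [intervalIntegral.integral_sub (intervalIntegrable_lagrangeBasis_smul hT hc1 j)
        (intervalIntegrable_lagrangeBasis_smul hT hc2 j), modelStage_eq, modelStage_eq,
        smul_sub, map_sub, sub_apply]
      abel
    rw [hsplit]
    calc _ ≤ bB * (wt * (Cl * (Kg * D))) + KB * D * (wt * (Cl * bg)) := by
          refine (norm_add_le _ _).trans (add_le_add ?_ ?_)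
          · refine ((B _).le_opNorm _).trans ?_
            gcongr
            · exact hbB _
            · exact hint _ _ hgd j
          · refine (ContinuousLinearMap.le_opNorm _ _).trans ?_
            gcongr
            exact hint _ _ (fun ξ _ => hbg _) j
      _ = (bB * (wt * (Cl * Kg)) + KB * (wt * (Cl * bg))) * D := by ring
      _ ≤ _ := mul_le_mul_of_nonneg_right (le_add_of_nonneg_left (by positivity)) hD0

theorem hasDerivAt_polynomial (a : Fin (s + 1) → E) (t : ℝ) :
    HasDerivAt (fun t => ∑ k : Fin (s + 1), t ^ (k : ℕ) • a k)
      (∑ k : Fin (s + 1), ((k : ℕ) * t ^ ((k : ℕ) - 1)) • a k) t :=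
  HasDerivAt.fun_sum fun k _ => (hasDerivAt_pow (k : ℕ) t).smul_const (a k)

/-- The derivative of a polynomial of degree at most `s` is determined by its values at `s`
nodes. -/
theorem deriv_polynomial_eq_sum (hc : Function.Injective c) (a : Fin (s + 1) → E) (h ξ : ℝ) :
    ∑ k : Fin (s + 1), ((k : ℕ) * (ξ * h) ^ ((k : ℕ) - 1)) • a k =
      ∑ j, lagrangeBasis c j ξ •
        ∑ k : Fin (s + 1), ((k : ℕ) * (c j * h) ^ ((k : ℕ) - 1)) • a k := by
  simp only [Finset.smul_sum, smul_smul]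
  rw [Finset.sum_comm]
  refine Finset.sum_congr rfl fun k _ => ?_
  rw [← Finset.sum_smul]
  congr 1
  rcases Nat.eq_zero_or_pos (k : ℕ) with hk | hk
  · simp [hk]
  · have hk' : (k : ℕ) - 1 < s := by have := k.2; omega
    rw [mul_pow, ← sum_lagrangeBasis_mul_pow hc hk', Finset.sum_mul, Finset.mul_sum]
    refine Finset.sum_congr rfl fun j _ => ?_
    rw [mul_pow]
    ring

namespace IsModelStep

variable {z : P} {h : ℝ} {σ : ℝ → E}

theorem hasDerivAt (hσ : IsModelStep c B g z h σ) (t : ℝ) : HasDerivAt σ (deriv σ t) t := by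
  obtain ⟨a, ha⟩ := hσ.polynomial
  rw [show σ = fun t => ∑ k : Fin (s + 1), t ^ (k : ℕ) • a k from funext ha]
  exact (hasDerivAt_polynomial a t).differentiableAt.hasDerivAt

theorem continuous (hσ : IsModelStep c B g z h σ) : Continuous σ :=
  continuous_iff_continuousAt.2 fun t => (hσ.hasDerivAt t).continuousAt

/-- Since σ' has degree below s, it equals the interpolant of its collocation values everywhere. The
discrete conditions thereby become a perturbed differential equation. -/
theorem hasDerivAt_eq_sum (hσ : IsModelStep c B g z h σ) (hc : Function.Injective c) (ξ : ℝ) :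
    HasDerivAt σ (∑ j, lagrangeBasis c j ξ • modelStage c B g z (fun ξ => σ (ξ * h)) j)
      (ξ * h) := by
  obtain ⟨a, ha⟩ := hσ.polynomial
  have hσa : σ = fun t => ∑ k : Fin (s + 1), t ^ (k : ℕ) • a k := funext ha
  have hd : ∀ t, deriv σ t = ∑ k : Fin (s + 1), ((k : ℕ) * t ^ ((k : ℕ) - 1)) • a k := fun t => by
    rw [hσa]; exact (hasDerivAt_polynomial a t).deriv
  have := hσ.hasDerivAt (ξ * h)
  rw [hd, deriv_polynomial_eq_sum hc] at this
  simpa only [← hd, hσ.collocation] using this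

end IsModelStep

/-- The primitive of the Lagrange basis polynomial that vanishes at `0`. -/
noncomputable def lagrangePrimitive (c : Fin s → ℝ) (j : Fin s) (ξ : ℝ) : ℝ :=
  ∑ k : Fin s, (Lagrange.basis Finset.univ c j).coeff k / ((k : ℕ) + 1) * ξ ^ ((k : ℕ) + 1)

theorem hasDerivAt_lagrangePrimitive (hc : Function.Injective c) (j : Fin s) (ξ : ℝ) :
    HasDerivAt (lagrangePrimitive c j) (lagrangeBasis c j ξ) ξ := by
  have hdeg : (Lagrange.basis Finset.univ c j).natDegree < s := by
    rw [Lagrange.natDegree_basis hc.injOn (Finset.mem_univ _), Finset.card_univ, Fintype.card_fin]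
    exact Nat.sub_lt j.pos one_pos
  rw [lagrangeBasis_eq_eval, Polynomial.eval_eq_sum_range' hdeg, ← Fin.sum_univ_eq_sum_range
    (fun k => (Lagrange.basis Finset.univ c j).coeff k * ξ ^ k)]
  refine HasDerivAt.fun_sum fun k _ => ?_
  have := (hasDerivAt_pow ((k : ℕ) + 1) ξ).const_mul
    ((Lagrange.basis Finset.univ c j).coeff k / ((k : ℕ) + 1))
  refine this.congr_deriv ?_
  have h1 : ((k : ℕ) : ℝ) + 1 ≠ 0 := by positivity
  rw [Nat.add_sub_cancel, Nat.cast_add, Nat.cast_one]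
  field_simp

theorem lagrangePrimitive_zero (j : Fin s) : lagrangePrimitive c j 0 = 0 := by
  simp [lagrangePrimitive]

theorem exists_bound_lagrangePrimitive (hc : Function.Injective c) (T : ℝ) :
    ∃ C : ℝ, 0 ≤ C ∧ ∀ j, ∀ ξ ∈ Icc (-T) T, |lagrangePrimitive c j ξ| ≤ C := by
  have h : ∀ j, ∃ C : ℝ, ∀ ξ ∈ Icc (-T) T, ‖lagrangePrimitive c j ξ‖ ≤ C := fun j =>
    isCompact_Icc.exists_bound_of_continuousOn
      fun ξ _ => (hasDerivAt_lagrangePrimitive hc j ξ).continuousAt.continuousWithinAt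
  choose C hC using h
  refine ⟨∑ j, |C j|, Finset.sum_nonneg fun _ _ => abs_nonneg _, fun j ξ hξ => ?_⟩
  exact (hC j ξ hξ).trans ((le_abs_self _).trans
    (Finset.single_le_sum (f := fun j => |C j|) (fun _ _ => abs_nonneg _) (Finset.mem_univ j)))

/-- The method is solvable for small step sizes. -/
theorem exists_isModelStep [CompleteSpace E] (hc : Function.Injective c) {T : ℝ} (hT : 1 ≤ T)
    (hcT : ∀ j, c j ∈ Icc (-T) T)
    (hB : ContDiff ℝ ∞ B) (hBs : HasCompactSupport B) (hg : ContDiff ℝ ∞ g)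
    (hgs : HasCompactSupport g) :
    ∃ h₀ > 0, ∃ M : ℝ, 0 ≤ M ∧ ∀ (z : P) (y₀ : E) (h : ℝ), 0 < h → h < h₀ →
      ∃ σ : ℝ → E, IsModelStep c B g z h σ ∧ σ 0 = y₀ ∧
        ∀ ξ ∈ Icc (-T) T, ‖σ (ξ * h) - y₀‖ ≤ M * h := by
  obtain ⟨L, hL, hst⟩ := exists_lipschitz_modelStage hT hcT hB hBs hg hgs
  obtain ⟨A, hA, hAb⟩ := exists_bound_lagrangePrimitive hc T
  refine ⟨1 / (2 * (L * (s * A) + 1)), by positivity, s * A * L, by positivity,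
    fun z y₀ h hh hh₀ => ?_⟩
  -- The unknowns are the derivatives κ_j = σ'(c_j h); `u κ` is the resulting ξ ↦ σ(ξh), and the
  -- collocation conditions become the fixed-point equation Ψ κ = κ.
  let u : (Fin s → E) → ℝ → E := fun κ ξ => y₀ + h • ∑ j, lagrangePrimitive c j ξ • κ j
  have huc : ∀ κ, Continuous (u κ) := fun κ => by
    have : ∀ j, Continuous (lagrangePrimitive c j) := fun j => continuous_iff_continuousAt.2
      fun ξ => (hasDerivAt_lagrangePrimitive hc j ξ).continuousAt
    fun_prop
  have hsum : ∀ κ : Fin s → E, ∀ D : ℝ, (∀ j, ‖κ j‖ ≤ D) → ∀ ξ ∈ Icc (-T) T,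
      ‖h • ∑ j, lagrangePrimitive c j ξ • κ j‖ ≤ h * (s * A * D) := fun κ D hκ ξ hξ => by
    rw [norm_smul, Real.norm_eq_abs, abs_of_pos hh]
    gcongr
    refine (norm_sum_le _ _).trans ?_
    calc _ ≤ ∑ j : Fin s, A * D := by
          refine Finset.sum_le_sum fun j _ => ?_
          rw [norm_smul, Real.norm_eq_abs]
          gcongr
          · exact hAb j ξ hξ
          · exact hκ j
      _ = _ := by simp; ring
  have hdiff : ∀ κ κ' : Fin s → E, ∀ ξ ∈ Icc (-T) T,
      ‖u κ ξ - u κ' ξ‖ ≤ h * (s * A * ‖κ - κ'‖) := fun κ κ' ξ hξ => by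
    have := hsum (κ - κ') ‖κ - κ'‖ (fun j => norm_le_pi_norm _ j) ξ hξ
    convert this using 2
    simp only [u, Pi.sub_apply, smul_sub, Finset.sum_sub_distrib]
    abel
  let Ψ : (Fin s → E) → (Fin s → E) := fun κ j => modelStage c B g z (u κ) j
  -- The factor 2 in the bound on h makes the Lipschitz constant 1/2, independently of z and y₀.
  have hcontr : ContractingWith (1 / 2) Ψ := by
    refine ⟨by rw [← NNReal.coe_lt_coe]; norm_num, LipschitzWith.of_dist_le_mul fun κ κ' => ?_⟩
    rw [dist_eq_norm, dist_eq_norm]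
    refine (pi_norm_le_iff_of_nonneg (by positivity)).2 fun j => ?_
    refine ((hst z (u κ) (huc κ).continuousOn).2 (u κ') _ (huc κ').continuousOn
      (hdiff κ κ') j).trans ?_
    have h1 : h * (2 * (L * (s * A) + 1)) ≤ 1 := by
      rw [lt_div_iff₀ (by positivity)] at hh₀
      exact hh₀.le
    have h2 : L * (h * (s * A)) ≤ 1 / 2 := by nlinarith
    calc _ = L * (h * (s * A)) * ‖κ - κ'‖ := by ring
      _ ≤ 1 / 2 * ‖κ - κ'‖ := by gcongr
      _ = _ := by norm_num
  set κ := hcontr.fixedPoint Ψ with hκdef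
  have hκ : Ψ κ = κ := hcontr.fixedPoint_isFixedPt
  refine ⟨fun t => u κ (t / h), ⟨?_, fun j => ?_⟩, ?_, fun ξ hξ => ?_⟩
  · refine ⟨Fin.cons y₀ fun k => ∑ j, (h * ((Lagrange.basis Finset.univ c j).coeff k /
      ((k : ℕ) + 1) / h ^ ((k : ℕ) + 1))) • κ j, fun t => ?_⟩
    rw [Fin.sum_univ_succ]
    simp only [Fin.cons_zero, Fin.cons_succ, Fin.val_zero, pow_zero, one_smul, Fin.val_succ, u,
      lagrangePrimitive, Finset.sum_smul, Finset.smul_sum, smul_smul]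
    congr 1
    rw [Finset.sum_comm]
    refine Finset.sum_congr rfl fun k _ => Finset.sum_congr rfl fun j _ => ?_
    rw [div_pow]
    congr 1
    ring
  · have hd : HasDerivAt (fun t => u κ (t / h)) (∑ i, lagrangeBasis c i (c j) • κ i) (c j * h) := by
      have h1 : HasDerivAt (fun ξ => u κ ξ) (h • ∑ i, lagrangeBasis c i (c j) • κ i)
          (c j * h / h) := by
        rw [mul_div_cancel_right₀ _ hh.ne']
        exact ((HasDerivAt.fun_sum fun i _ =>
          (hasDerivAt_lagrangePrimitive hc i (c j)).smul_const (κ i)).const_smul h).const_add y₀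
      have h2 := h1.scomp (c j * h) ((hasDerivAt_id (c j * h)).div_const h)
      rw [smul_smul, one_div, inv_mul_cancel₀ hh.ne', one_smul] at h2
      exact h2
    rw [hd.deriv]
    simp only [lagrangeBasis_node hc, ite_smul, one_smul, zero_smul, Finset.sum_ite_eq',
      Finset.mem_univ, if_true, mul_div_cancel_right₀ _ hh.ne']
    exact (congrFun hκ j).symm
  · simp [u, lagrangePrimitive_zero]
  · simp only [mul_div_cancel_right₀ _ hh.ne']
    have h1 : ∀ j, ‖κ j‖ ≤ L := fun j => by
      rw [← hκ]; exact (hst z (u κ) (huc κ).continuousOn).1 j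
    have := hsum κ L h1 ξ hξ
    simp only [u, add_sub_cancel_left]
    linarith

end ModelStep

/-! ### Preliminary and final error estimates in a vector space. -/

section ModelError

variable {s : ℕ} {P E F : Type*} [NormedAddCommGroup P] [NormedSpace ℝ P]
  [NormedAddCommGroup E] [NormedSpace ℝ E] [NormedAddCommGroup F] [NormedSpace ℝ F]

/-- The vector field `y ↦ B(z, y) g(z, y)`. -/
def modelField (B : P × E → F →L[ℝ] E) (g : P × E → F) (w : P × E) : E := B w (g w)

/-- The vector field of the equation `y' = B(z, y) g(z, y)`, extended by the parameter `z` and by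
the adjoint variational equation. -/
noncomputable def variationalField (B : P × E → F →L[ℝ] E) (g : P × E → F)
    (w : P × E × (E →L[ℝ] E)) : P × E × (E →L[ℝ] E) :=
  (0, modelField B g (w.1, w.2.1), -(w.2.2 ∘L (fderiv ℝ (modelField B g) (w.1, w.2.1) ∘L
    ContinuousLinearMap.inr ℝ P E)))

theorem contDiff_modelField {B : P × E → F →L[ℝ] E} {g : P × E → F} (hB : ContDiff ℝ ∞ B)
    (hg : ContDiff ℝ ∞ g) : ContDiff ℝ ∞ (modelField B g) :=
  hB.clm_apply hg

theorem hasCompactSupport_modelField {B : P × E → F →L[ℝ] E} {g : P × E → F}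
    (hgs : HasCompactSupport g) : HasCompactSupport (modelField B g) :=
  hgs.mono fun w hw h0 => hw (by rw [modelField, h0, map_zero])

theorem contDiff_variationalField {B : P × E → F →L[ℝ] E} {g : P × E → F} (hB : ContDiff ℝ ∞ B)
    (hg : ContDiff ℝ ∞ g) : ContDiff ℝ ∞ (variationalField B g) := by
  have hf := contDiff_modelField hB hg
  have hf' : ContDiff ℝ ∞ (fderiv ℝ (modelField B g)) := hf.fderiv_right (by simp)
  have hpr : ContDiff ℝ ∞ (fun w : P × E × (E →L[ℝ] E) => (w.1, w.2.1)) := by fun_prop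
  refine contDiff_const.prodMk ((hf.comp hpr).prodMk (ContDiff.neg ?_))
  exact ContDiff.clm_comp (by fun_prop) ((hf'.comp hpr).clm_comp contDiff_const)

/-- A family of steps of the collocation-like method in a vector space, each with the exact
solution with the same initial value. -/
structure ModelFamily (c : Fin s → ℝ) (B : P × E → F →L[ℝ] E) (g : P × E → F)
    (S : Set (P × E × (E →L[ℝ] E))) (T τ : ℝ) (ι : Type*) where
  z : ι → P
  h : ι → ℝ
  σ : ι → ℝ → E
  α : ι → ℝ → P × E × (E →L[ℝ] E)
  h_mem : ∀ i, 0 < h i ∧ h i ≤ 1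
  h_le : ∀ i, T * h i ≤ τ
  isModelStep : ∀ i, IsModelStep c B g (z i) (h i) (σ i)
  isIntegralCurve : ∀ i, ∀ t ∈ Icc (-τ) τ,
    HasDerivAt (α i) (variationalField B g (α i t)) t ∧ α i t ∈ S
  param_zero : ∀ i, (α i 0).1 = z i
  initial : ∀ i, (α i 0).2.1 = σ i 0

namespace ModelFamily

variable {c : Fin s → ℝ} {B : P × E → F →L[ℝ] E} {g : P × E → F}
  {S : Set (P × E × (E →L[ℝ] E))} {T τ : ℝ} {ι : Type*} (A : ModelFamily c B g S T τ ι)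

/-- The exact solution. -/
def y (i : ι) (t : ℝ) : E := (A.α i t).2.1

/-- The solution of the adjoint variational equation. -/
def Z (i : ι) (t : ℝ) : E →L[ℝ] E := (A.α i t).2.2

theorem mul_mem (i : ι) {ξ : ℝ} (hξ : ξ ∈ Icc (-T) T) : ξ * A.h i ∈ Icc (-τ) τ := by
  have h1 : |ξ| ≤ T := abs_le.2 hξ
  rw [mem_Icc, ← abs_le, abs_mul, abs_of_pos (A.h_mem i).1]
  exact (mul_le_mul_of_nonneg_right h1 (A.h_mem i).1.le).trans (A.h_le i)

theorem fst_eq (i : ι) {t : ℝ} (ht : t ∈ Icc (-τ) τ) : (A.α i t).1 = A.z i := by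
  have h0 : (0 : ℝ) ∈ Icc (-τ) τ := ⟨by linarith [ht.1, ht.2], by linarith [ht.1, ht.2]⟩
  have hd : ∀ x ∈ Icc (-τ) τ, HasDerivWithinAt (fun t => (A.α i t).1) 0 (Icc (-τ) τ) x :=
    fun x hx => ((hasFDerivAt_fst (𝕜 := ℝ) (p := A.α i x)).comp_hasDerivAt x
      (A.isIntegralCurve i x hx).1).hasDerivWithinAt
  have := (convex_Icc (-τ) τ).norm_image_sub_le_of_norm_hasDerivWithin_le hd (C := 0)
    (fun x _ => by simp) h0 ht
  rw [zero_mul, norm_le_zero_iff, sub_eq_zero, A.param_zero] at this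
  exact this

theorem hasDerivAt_y (i : ι) {t : ℝ} (ht : t ∈ Icc (-τ) τ) :
    HasDerivAt (A.y i) (modelField B g (A.z i, A.y i t)) t := by
  have h1 : HasDerivAt (fun t => (A.α i t).2.1) _ t :=
    ((hasFDerivAt_fst (𝕜 := ℝ)).comp (A.α i t) hasFDerivAt_snd).comp_hasDerivAt t
      (A.isIntegralCurve i t ht).1
  have h2 := A.fst_eq i ht
  refine h1.congr_deriv ?_
  simp [variationalField, h2, y]

theorem hasDerivAt_Z (i : ι) {t : ℝ} (ht : t ∈ Icc (-τ) τ) :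
    HasDerivAt (A.Z i) (-(A.Z i t ∘L (fderiv ℝ (modelField B g) (A.z i, A.y i t) ∘L
      ContinuousLinearMap.inr ℝ P E))) t := by
  have h1 : HasDerivAt (fun t => (A.α i t).2.2) _ t :=
    ((hasFDerivAt_snd (𝕜 := ℝ)).comp (A.α i t) hasFDerivAt_snd).comp_hasDerivAt t
      (A.isIntegralCurve i t ht).1
  have h2 := A.fst_eq i ht
  refine h1.congr_deriv ?_
  simp [variationalField, h2, y, Z]

theorem hasDerivAt_y_mul (i : ι) {ξ : ℝ} (hξ : ξ ∈ Icc (-T) T) :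
    HasDerivAt (fun ξ => A.y i (ξ * A.h i))
      (A.h i • modelField B g (A.z i, A.y i (ξ * A.h i))) ξ := by
  have := (A.hasDerivAt_y i (A.mul_mem i hξ)).scomp ξ ((hasDerivAt_id ξ).mul_const (A.h i))
  simpa [Function.comp_def] using this

theorem hasDerivAt_σ_mul (hc : Function.Injective c) (i : ι) (ξ : ℝ) :
    HasDerivAt (fun ξ => A.σ i (ξ * A.h i)) (A.h i • ∑ j, lagrangeBasis c j ξ •
      modelStage c B g (A.z i) (fun ξ => A.σ i (ξ * A.h i)) j) ξ := by
  have := ((A.isModelStep i).hasDerivAt_eq_sum hc ξ).scomp ξ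
    ((hasDerivAt_id ξ).mul_const (A.h i))
  simpa [Function.comp_def] using this

theorem continuousOn_y_mul (i : ι) :
    ContinuousOn (fun ξ => A.y i (ξ * A.h i)) (Icc (-T) T) := fun _ hξ =>
  (A.hasDerivAt_y_mul i hξ).continuousAt.continuousWithinAt

theorem continuous_σ_mul (i : ι) : Continuous (fun ξ => A.σ i (ξ * A.h i)) :=
  (A.isModelStep i).continuous.comp (by fun_prop)

theorem hasExpansion_comp (hT : 1 ≤ T) (hB : ContDiff ℝ ∞ B) (hg : ContDiff ℝ ∞ g)
    (hS : IsCompact S)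
    {V : Type*} [NormedAddCommGroup V] [NormedSpace ℝ V] {N : ℕ}
    {b : P × E × (E →L[ℝ] E) → V} (hb : ContDiff ℝ ∞ b) :
    HasExpansion A.h T N id (fun i ξ => b (A.α i (ξ * A.h i))) :=
  hasExpansion_comp_integral_curve (contDiff_variationalField hB hg) hS hb (by linarith)
    (fun i => ⟨(A.h_mem i).1, A.h_le i⟩) A.isIntegralCurve

theorem hasExpansion_comp_y (hT : 1 ≤ T) (hB : ContDiff ℝ ∞ B) (hg : ContDiff ℝ ∞ g)
    (hS : IsCompact S)
    {V : Type*} [NormedAddCommGroup V] [NormedSpace ℝ V] {N : ℕ}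
    {b : P × E → V} (hb : ContDiff ℝ ∞ b) :
    HasExpansion A.h T N id (fun i ξ => b (A.z i, A.y i (ξ * A.h i))) :=
  (A.hasExpansion_comp hT hB hg hS (b := fun w => b (w.1, w.2.1))
    (hb.comp (by fun_prop))).congr fun i ξ hξ => by rw [A.fst_eq i (A.mul_mem i hξ), y]

variable {r : ℕ}

/-- A preliminary error bound. -/
theorem exists_bound_sub (hT : 1 ≤ T) (hB : ContDiff ℝ ∞ B) (hg : ContDiff ℝ ∞ g)
    (hS : IsCompact S) (hc : Function.Injective c) (hb : ∀ i, weight c i ≠ 0)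
    (hr : IsQuadratureOrder c r) (hcT : ∀ j, c j ∈ Icc (-T) T)
    [CompleteSpace F] {L Cl : ℝ} (hL : 0 ≤ L) (hCl : 0 ≤ Cl)
    (hst : ∀ (z : P) (u : ℝ → E), ContinuousOn u (Icc (-T) T) →
      ∀ (u' : ℝ → E) (D : ℝ), ContinuousOn u' (Icc (-T) T) →
      (∀ ξ ∈ Icc (-T) T, ‖u ξ - u' ξ‖ ≤ D) →
      ∀ j, ‖modelStage c B g z u j - modelStage c B g z u' j‖ ≤ L * D)
    (hl : ∀ j, ∀ ξ ∈ Icc (-T) T, |lagrangeBasis c j ξ| ≤ Cl)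
    (hsmall : ∀ i, A.h i * (T * (s * Cl * L)) ≤ 1 / 2) :
    ∃ C : ℝ, 0 ≤ C ∧ ∀ i, ∀ ξ ∈ Icc (-T) T, ‖A.σ i (ξ * A.h i) - A.y i (ξ * A.h i)‖ ≤
      C * A.h i ^ (min s (r - s + 1) + 1) := by
  set n := min s (r - s + 1)
  obtain ⟨C₂, hC₂, hΘ⟩ := exists_bound_collocationDefect_of_moment hT A.h_mem hcT (le_refl n)
    (defectMoment_vanishing hc hb hr) (A.hasExpansion_comp_y hT hB hg hS hB)
    (A.hasExpansion_comp_y hT hB hg hS hg)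
  refine ⟨2 * (T * C₂), by positivity, fun i ξ hξ => ?_⟩
  set d : ℝ → E := fun ξ => A.σ i (ξ * A.h i) - A.y i (ξ * A.h i)
  have h0T : (0 : ℝ) ∈ Icc (-T) T := ⟨by linarith, by linarith⟩
  have hdc : ContinuousOn d (Icc (-T) T) :=
    (A.continuous_σ_mul i).continuousOn.sub (A.continuousOn_y_mul i)
  -- The stages depend on σ over the whole interval, so the maximal error D is estimated at a point
  -- where it is attained. The Lipschitz contribution is at most D/2 for small h and is absorbed,
  -- which produces the factor 2 in the constant.
  obtain ⟨ξ₀, hξ₀, hmax⟩ := isCompact_Icc.exists_isMaxOn ⟨0, h0T⟩ hdc.norm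
  set D := ‖d ξ₀‖
  have hD : ∀ ξ ∈ Icc (-T) T, ‖d ξ‖ ≤ D := fun ξ hξ => hmax hξ
  have hD0 : 0 ≤ D := norm_nonneg _
  have hhi := (A.h_mem i).1
  have hder : ∀ ξ ∈ Icc (-T) T, HasDerivWithinAt d (A.h i • (∑ j, lagrangeBasis c j ξ •
      modelStage c B g (A.z i) (fun ξ => A.σ i (ξ * A.h i)) j -
        modelField B g (A.z i, A.y i (ξ * A.h i)))) (Icc (-T) T) ξ := fun ξ hξ => by
    rw [smul_sub]
    exact ((A.hasDerivAt_σ_mul hc i ξ).sub (A.hasDerivAt_y_mul i hξ)).hasDerivWithinAt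
  have hbound : ∀ ξ ∈ Icc (-T) T, ‖A.h i • (∑ j, lagrangeBasis c j ξ •
      modelStage c B g (A.z i) (fun ξ => A.σ i (ξ * A.h i)) j -
        modelField B g (A.z i, A.y i (ξ * A.h i)))‖ ≤
      A.h i * (s * Cl * L * D + C₂ * A.h i ^ n) := fun ξ hξ => by
    rw [norm_smul, Real.norm_eq_abs, abs_of_pos hhi]
    gcongr
    -- Subtracting the stages of the exact solution leaves a part that is Lipschitz in the error and
    -- the defect along the exact solution, whose expansions have full weights.
    have hsplit : ∑ j, lagrangeBasis c j ξ •
        modelStage c B g (A.z i) (fun ξ => A.σ i (ξ * A.h i)) j -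
          modelField B g (A.z i, A.y i (ξ * A.h i)) =
        ∑ j, lagrangeBasis c j ξ • (modelStage c B g (A.z i) (fun ξ => A.σ i (ξ * A.h i)) j -
          modelStage c B g (A.z i) (fun ξ => A.y i (ξ * A.h i)) j) +
        collocationDefect c (fun ξ => B (A.z i, A.y i (ξ * A.h i)))
          (fun ξ => g (A.z i, A.y i (ξ * A.h i))) ξ := by
      rw [collocationDefect_eq_sum_modelStage (A.z i) (fun ξ => A.y i (ξ * A.h i)) ξ, modelField]
      simp only [smul_sub, Finset.sum_sub_distrib]
      abel
    rw [hsplit]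
    refine (norm_add_le _ _).trans (add_le_add ((norm_sum_le _ _).trans ?_) (hΘ i ξ hξ))
    calc _ ≤ ∑ j : Fin s, Cl * (L * D) := by
          refine Finset.sum_le_sum fun j _ => ?_
          rw [norm_smul, Real.norm_eq_abs]
          gcongr
          · exact hl j ξ hξ
          · exact hst _ _ (A.continuous_σ_mul i).continuousOn _ _ (A.continuousOn_y_mul i) hD j
      _ = _ := by simp; ring
  have hmv := (convex_Icc (-T) T).norm_image_sub_le_of_norm_hasDerivWithin_le hder hbound h0T hξ₀
  have hd0 : d 0 = 0 := by simp [d, y, A.initial i]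
  rw [hd0, sub_zero, sub_zero, Real.norm_eq_abs] at hmv
  have hξT : |ξ₀| ≤ T := abs_le.2 hξ₀
  have hfin : D ≤ A.h i * (s * Cl * L * D + C₂ * A.h i ^ n) * T :=
    hmv.trans (mul_le_mul_of_nonneg_left hξT (by positivity))
  have h2 : A.h i * (T * (s * Cl * L)) * D ≤ 1 / 2 * D :=
    mul_le_mul_of_nonneg_right (hsmall i) hD0
  have h3 : D ≤ 2 * (T * C₂) * A.h i ^ (n + 1) := by
    rw [pow_succ]
    nlinarith [hfin, h2]
  exact (hD ξ hξ).trans h3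

/-- The numerical solution has an expansion with reduced weights. -/
theorem hasExpansion_σ (hT : 1 ≤ T) (hB : ContDiff ℝ ∞ B) (hg : ContDiff ℝ ∞ g) (hS : IsCompact S)
    {N : ℕ} {C : ℝ} (hC : 0 ≤ C)
    (hbd : ∀ i, ∀ ξ ∈ Icc (-T) T, ‖A.σ i (ξ * A.h i) - A.y i (ξ * A.h i)‖ ≤
      C * A.h i ^ (min s (r - s + 1) + 1)) :
    HasExpansion A.h T N (solutionWeight s r) (fun i ξ => A.σ i (ξ * A.h i)) := by
  set m := min s (r - s + 1) + 1 with hm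
  have hms : m ≤ s + 1 := by omega
  obtain ⟨C₁, hC₁, H⟩ := exists_taylor_along_integral_curve (contDiff_variationalField hB hg) hS m
    (b := fun w => w.2.1) (by fun_prop)
  have hτ : ∀ i, 0 ≤ τ := fun i => (mul_nonneg (by linarith) (A.h_mem i).1.le).trans (A.h_le i)
  choose a' ha' hat using fun i => H τ (hτ i) (A.α i) (A.isIntegralCurve i)
  choose a ha using fun i => (A.isModelStep i).polynomial
  obtain ⟨C₃, hC₃, hcoef⟩ := exists_bound_coefficients s E
  have hpow : ∀ i (n : ℕ), 0 ≤ A.h i ^ n := fun i n => pow_nonneg (A.h_mem i).1.le n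
  -- The Taylor polynomial of y of degree below m has degree at most s, and its difference from σ is
  -- O(h^m) on [0, 1]. Hence every scaled coefficient differs by O(h^m).
  have hq : ∀ i (k : Fin (s + 1)),
      ‖A.h i ^ (k : ℕ) • a i k - (if (k : ℕ) < m then A.h i ^ (k : ℕ) • a' i k else 0)‖ ≤
        C₃ * ((C + C₁) * A.h i ^ m) := by
    intro i
    refine hcoef (fun k : Fin (s + 1) => A.h i ^ (k : ℕ) • a i k -
      (if (k : ℕ) < m then A.h i ^ (k : ℕ) • a' i k else 0)) _ fun ξ hξ => ?_
    have hξT : ξ ∈ Icc (-T) T := ⟨by linarith [hξ.1], by linarith [hξ.2]⟩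
    have hsum : ∑ k : Fin (s + 1), ξ ^ (k : ℕ) • (A.h i ^ (k : ℕ) • a i k -
        (if (k : ℕ) < m then A.h i ^ (k : ℕ) • a' i k else 0)) =
        (A.σ i (ξ * A.h i) - A.y i (ξ * A.h i)) +
        (A.y i (ξ * A.h i) - ∑ k ∈ Finset.range m, (ξ * A.h i) ^ k • a' i k) := by
      have h1 : ∑ k ∈ Finset.range m, (ξ * A.h i) ^ k • a' i k =
          ∑ k : Fin (s + 1), ξ ^ (k : ℕ) •
            (if (k : ℕ) < m then A.h i ^ (k : ℕ) • a' i k else 0) := by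
        rw [Fin.sum_univ_eq_sum_range
          (fun k => ξ ^ k • (if k < m then A.h i ^ k • a' i k else 0))]
        rw [← Finset.sum_subset (Finset.range_subset_range.2 hms)]
        · refine Finset.sum_congr rfl fun k hk => ?_
          rw [if_pos (Finset.mem_range.1 hk), smul_smul, mul_pow]
        · intro k _ hk
          rw [if_neg (by simpa using hk), smul_zero]
      rw [h1, ha i]
      simp only [smul_sub, Finset.sum_sub_distrib, mul_pow, smul_smul]
      abel
    rw [hsum]
    refine (norm_add_le _ _).trans ?_
    rw [add_mul]
    refine add_le_add (hbd i ξ hξT) ((hat i _ (A.mul_mem i hξT)).trans ?_)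
    have h2 : |ξ * A.h i| ≤ A.h i := by
      rw [abs_mul, abs_of_pos (A.h_mem i).1, abs_of_nonneg hξ.1]
      exact mul_le_of_le_one_left (A.h_mem i).1.le hξ.2
    gcongr
  have heq : (fun i ξ => A.σ i (ξ * A.h i)) = fun i ξ => ∑ k ∈ (Finset.univ : Finset (Fin (s + 1))),
      ξ ^ (k : ℕ) • (A.h i ^ (k : ℕ) • a i k) := by
    funext i ξ
    rw [ha i]
    simp only [mul_pow, smul_smul]
  rw [heq]
  refine HasExpansion.sum (F := fun (k : Fin (s + 1)) i ξ => ξ ^ (k : ℕ) • (A.h i ^ (k : ℕ) • a i k))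
    _ fun k _ => HasExpansion.monomial k _ (C₃ * (C + C₁) + C₁) (by positivity) fun i => ?_
  have hle := (A.h_mem i)
  -- Only degrees k ≤ s occur in σ, where the tail of `solutionWeight` is inactive.
  have hw : solutionWeight s r k = min (k : ℕ) m := by
    have := k.2
    simp only [solutionWeight]
    omega
  rw [hw]
  have h1 : A.h i ^ m ≤ A.h i ^ min (k : ℕ) m :=
    pow_le_pow_of_le_one hle.1.le hle.2 (min_le_right _ _)
  have h3 : ‖(if (k : ℕ) < m then A.h i ^ (k : ℕ) • a' i k else 0)‖ ≤
      C₁ * A.h i ^ min (k : ℕ) m := by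
    split_ifs with hk
    · rw [min_eq_left hk.le, norm_smul, Real.norm_eq_abs, abs_of_nonneg (hpow i _), mul_comm]
      exact mul_le_mul_of_nonneg_right (ha' i k) (hpow i _)
    · rw [norm_zero]
      exact mul_nonneg hC₁ (hpow i _)
  calc ‖A.h i ^ (k : ℕ) • a i k‖ ≤ C₃ * ((C + C₁) * A.h i ^ m) + C₁ * A.h i ^ min (k : ℕ) m := by
        rw [← sub_add_cancel (A.h i ^ (k : ℕ) • a i k)
          (if (k : ℕ) < m then A.h i ^ (k : ℕ) • a' i k else 0)]
        exact (norm_add_le _ _).trans (add_le_add (hq i k) h3)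
    _ ≤ C₃ * ((C + C₁) * A.h i ^ min (k : ℕ) m) + C₁ * A.h i ^ min (k : ℕ) m := by gcongr
    _ = _ := by ring

/-- Linearise b at the exact solution. The quadratic remainder is O(h^(2m)), negligible because N ≤
2m. Thus σ enters only linearly, multiplied by a full-weight factor, and its powers never have to be
expanded. -/
theorem hasExpansion_comp_σ (hT : 1 ≤ T) (hB : ContDiff ℝ ∞ B) (hg : ContDiff ℝ ∞ g)
    (hS : IsCompact S)
    {V : Type*} [NormedAddCommGroup V] [NormedSpace ℝ V] {N : ℕ}
    (hN : N ≤ 2 * (min s (r - s + 1) + 1)) {C : ℝ} (hC : 0 ≤ C)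
    (hbd : ∀ i, ∀ ξ ∈ Icc (-T) T, ‖A.σ i (ξ * A.h i) - A.y i (ξ * A.h i)‖ ≤
      C * A.h i ^ (min s (r - s + 1) + 1))
    {b : P × E → V} (hbc : ContDiff ℝ ∞ b) (hbs : HasCompactSupport b) :
    HasExpansion A.h T N (solutionWeight s r) (fun i ξ => b (A.z i, A.σ i (ξ * A.h i))) := by
  set m := min s (r - s + 1) + 1 with hm
  have hb' : ContDiff ℝ ∞ (fderiv ℝ b) := hbc.fderiv_right (by simp)
  obtain ⟨K, hK, hTaylor⟩ := exists_taylor_two_of_hasCompactSupport hbc hbs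
  -- The linear term Db(y)(σ - y) is split in two: Db(y)y depends on the exact solution alone and
  -- keeps full weights, and only Db(y)σ has reduced weights.
  have hi1 : ContDiff ℝ ∞ (fun w : P × E => fderiv ℝ b w (0, w.2)) := by
    exact hb'.clm_apply (by fun_prop)
  have hi2 : ContDiff ℝ ∞ (fun w : P × E => fderiv ℝ b w ∘L ContinuousLinearMap.inr ℝ P E) :=
    hb'.clm_comp contDiff_const
  have h1 := ((A.hasExpansion_comp_y hT hB hg hS (N := N) hbc).sub
    (A.hasExpansion_comp_y hT hB hg hS hi1)).mono A.h_mem (solutionWeight_le (s := s) (r := r))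
  have h2 := (A.hasExpansion_comp_y hT hB hg hS (N := N) hi2).bilinear A.h_mem
    solutionWeight_add_le (A.hasExpansion_σ hT hB hg hS hC hbd)
  have h3 : HasExpansion A.h T N (solutionWeight s r) (fun i ξ =>
      b (A.z i, A.σ i (ξ * A.h i)) - (b (A.z i, A.y i (ξ * A.h i)) -
        fderiv ℝ b (A.z i, A.y i (ξ * A.h i)) (0, A.y i (ξ * A.h i)) +
        (fderiv ℝ b (A.z i, A.y i (ξ * A.h i)) ∘L ContinuousLinearMap.inr ℝ P E)
          (A.σ i (ξ * A.h i)))) := by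
    refine HasExpansion.small _ (K * C ^ 2) (by positivity) (fun i => ?_) fun i ξ hξ => ?_
    · refine ContinuousOn.sub ?_ ((HasExpansion.add _ _ h1 h2).continuousOn i)
      exact (hbc.continuous.comp
        (continuous_const.prodMk (A.continuous_σ_mul i))).continuousOn
    · have := hTaylor (A.z i, A.y i (ξ * A.h i)) (0, A.σ i (ξ * A.h i) - A.y i (ξ * A.h i))
      rw [Prod.mk_add_mk, add_zero, add_sub_cancel, Prod.norm_mk, norm_zero,
        max_eq_right (norm_nonneg _)] at this
      have hlin : fderiv ℝ b (A.z i, A.y i (ξ * A.h i))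
          (0, A.σ i (ξ * A.h i) - A.y i (ξ * A.h i)) =
          fderiv ℝ b (A.z i, A.y i (ξ * A.h i)) (0, A.σ i (ξ * A.h i)) -
          fderiv ℝ b (A.z i, A.y i (ξ * A.h i)) (0, A.y i (ξ * A.h i)) := by
        rw [← map_sub, Prod.mk_sub_mk, sub_zero]
      rw [hlin] at this
      calc _ = ‖b (A.z i, A.σ i (ξ * A.h i)) - b (A.z i, A.y i (ξ * A.h i)) -
            (fderiv ℝ b (A.z i, A.y i (ξ * A.h i)) (0, A.σ i (ξ * A.h i)) -
          fderiv ℝ b (A.z i, A.y i (ξ * A.h i)) (0, A.y i (ξ * A.h i)))‖ := by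
            congr 1
            simp only [ContinuousLinearMap.comp_apply, ContinuousLinearMap.inr_apply]
            abel
        _ ≤ K * ‖A.σ i (ξ * A.h i) - A.y i (ξ * A.h i)‖ ^ 2 := this
        _ ≤ K * (C * A.h i ^ m) ^ 2 := by gcongr; exact hbd i ξ hξ
        _ = K * C ^ 2 * A.h i ^ (2 * m) := by rw [mul_pow, ← pow_mul, mul_comm m 2]; ring
        _ ≤ _ := mul_le_mul_of_nonneg_left
            (pow_le_pow_of_le_one (A.h_mem i).1.le (A.h_mem i).2 hN) (by positivity)
  exact (HasExpansion.add _ _ h3 (HasExpansion.add _ _ h1 h2)).congr fun i ξ _ => by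
    simp only [sub_add_cancel]

/-- The error bound for a family of steps. -/
theorem exists_bound_error (hT : 1 ≤ T) (hB : ContDiff ℝ ∞ B) (hg : ContDiff ℝ ∞ g)
    (hS : IsCompact S) (hc : Function.Injective c) (hb : ∀ i, weight c i ≠ 0)
    (hr : IsQuadratureOrder c r) (hcT : ∀ j, c j ∈ Icc (-T) T)
    [CompleteSpace E] [CompleteSpace F] (hBs : HasCompactSupport B)
    (hgs : HasCompactSupport g) (hS1 : ∀ w ∈ S, ‖w.2.2 - 1‖ ≤ 1 / 2)
    {C : ℝ} (hC : 0 ≤ C)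
    (hbd : ∀ i, ∀ ξ ∈ Icc (-T) T, ‖A.σ i (ξ * A.h i) - A.y i (ξ * A.h i)‖ ≤
      C * A.h i ^ (min s (r - s + 1) + 1)) :
    ∃ C' : ℝ, 0 ≤ C' ∧ ∀ i, ‖A.σ i (A.h i) - A.y i (A.h i)‖ ≤
      C' * A.h i ^ (min r (2 * r - 2 * s + 2) + 1) := by
  have hsr := card_nodes_le_order hc hr
  have hrs := order_le_two_mul_card_nodes hr
  set p := min r (2 * r - 2 * s + 2) with hp
  set m := min s (r - s + 1) + 1 with hm
  -- This uses r ≤ 2s; it makes the square of the preliminary error negligible at order p.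
  have hpm : p ≤ 2 * m := by omega
  set f := modelField B g with hf
  have hfc := contDiff_modelField hB hg
  obtain ⟨K, hK, hTaylor⟩ := exists_taylor_two_of_hasCompactSupport hfc
    (hasCompactSupport_modelField (B := B) hgs)
  have hZ : HasExpansion A.h T p id (fun i ξ => A.Z i (ξ * A.h i)) :=
    A.hasExpansion_comp hT hB hg hS (b := fun w => w.2.2) (by fun_prop)
  obtain ⟨C₁, hC₁, hΛ⟩ := exists_bound_integral_collocationDefect hT A.h_mem hcT
    (integral_pow_mul_defectMoment_vanishing hc hb hr) hZ
    (A.hasExpansion_comp_σ hT hB hg hS hpm hC hbd hB hBs)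
    (A.hasExpansion_comp_σ hT hB hg hS hpm hC hbd hg hgs)
  obtain ⟨bZ, hbZ, hZb⟩ := hZ.exists_bound A.h_mem
  refine ⟨2 * (C₁ + bZ * (K * C ^ 2)), by positivity, fun i => ?_⟩
  have hhi := (A.h_mem i).1
  set u : ℝ → E := fun ξ => A.σ i (ξ * A.h i) with hu
  set v : ℝ → E := fun ξ => A.y i (ξ * A.h i) with hv
  set R : ℝ → E := fun ξ => f (A.z i, u ξ) - f (A.z i, v ξ) -
    fderiv ℝ f (A.z i, v ξ) (0, u ξ - v ξ) with hR
  set Θ : ℝ → E := collocationDefect c (fun ξ => B (A.z i, u ξ)) (fun ξ => g (A.z i, u ξ)) with hΘ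
  have huc : Continuous u := A.continuous_σ_mul i
  have hvc : ContinuousOn v (Icc (-T) T) := A.continuousOn_y_mul i
  have hRc : ContinuousOn R (Icc (-T) T) := by
    have h1 : ContinuousOn (fun ξ => (A.z i, v ξ)) (Icc (-T) T) := continuousOn_const.prodMk hvc
    refine (((hfc.continuous.comp (continuous_const.prodMk huc)).continuousOn).sub
      (hfc.continuous.comp_continuousOn h1)).sub ?_
    refine ContinuousOn.clm_apply ((hfc.continuous_fderiv (by simp)).comp_continuousOn h1) ?_
    exact continuousOn_const.prodMk (huc.continuousOn.sub hvc)
  have hΘc : ContinuousOn Θ (Icc (-T) T) :=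
    continuousOn_collocationDefect
      (hB.continuous.comp (continuous_const.prodMk huc)).continuousOn
      (hg.continuous.comp (continuous_const.prodMk huc)).continuousOn
  have hZc : ContinuousOn (fun ξ => A.Z i (ξ * A.h i)) (Icc (-T) T) := hZ.continuousOn i
  have hRb : ∀ ξ ∈ Icc (-T) T, ‖R ξ‖ ≤ K * C ^ 2 * A.h i ^ p := fun ξ hξ => by
    have := hTaylor (A.z i, v ξ) (0, u ξ - v ξ)
    rw [Prod.mk_add_mk, add_zero, add_sub_cancel, Prod.norm_mk, norm_zero,
      max_eq_right (norm_nonneg _)] at this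
    calc _ ≤ K * ‖u ξ - v ξ‖ ^ 2 := this
      _ ≤ K * (C * A.h i ^ m) ^ 2 := by gcongr; exact hbd i ξ hξ
      _ = K * C ^ 2 * A.h i ^ (2 * m) := by rw [mul_pow, ← pow_mul, mul_comm m 2]; ring
      _ ≤ _ := mul_le_mul_of_nonneg_left
          (pow_le_pow_of_le_one hhi.le (A.h_mem i).2 hpm) (by positivity)
  have hsub := unitInterval_subset hT
  -- The adjoint variational equation cancels the linear term Df(y)(σ - y). What survives is the
  -- defect along the numerical solution and the quadratic remainder; the outer factor h supplies
  -- the extra power in p + 1.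
  have hder : ∀ ξ ∈ uIcc (0 : ℝ) 1, HasDerivAt (fun ξ => A.Z i (ξ * A.h i) (u ξ - v ξ))
      (A.h i • (A.Z i (ξ * A.h i) (Θ ξ)) + A.h i • (A.Z i (ξ * A.h i) (R ξ))) ξ := by
    intro ξ hξ
    have hξT := hsub hξ
    have h1 := (A.hasDerivAt_Z i (A.mul_mem i hξT)).scomp ξ ((hasDerivAt_id ξ).mul_const (A.h i))
    have h2 := (A.hasDerivAt_σ_mul hc i ξ).sub (A.hasDerivAt_y_mul i hξT)
    refine (h1.clm_apply h2).congr_deriv ?_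
    have h3 : Θ ξ = ∑ j, lagrangeBasis c j ξ • modelStage c B g (A.z i) u j - f (A.z i, u ξ) :=
      collocationDefect_eq_sum_modelStage (A.z i) u ξ
    have h4 : fderiv ℝ f (A.z i, v ξ) (0, u ξ - v ξ) =
        fderiv ℝ f (A.z i, v ξ) (0, u ξ) - fderiv ℝ f (A.z i, v ξ) (0, v ξ) := by
      rw [← map_sub, Prod.mk_sub_mk, sub_zero]
    simp only [hR]
    rw [h3, h4]
    simp only [hf, hu, hv, one_mul, smul_apply, neg_apply,
      ContinuousLinearMap.comp_apply, ContinuousLinearMap.inr_apply, map_sub, map_smul, smul_sub,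
      Function.comp, smul_neg, Pi.sub_apply, id]
    abel
  have hint1 : IntervalIntegrable (fun ξ => A.h i • (A.Z i (ξ * A.h i) (Θ ξ))) volume 0 1 :=
    intervalIntegrable_of_continuousOn hT (continuousOn_const.smul (hZc.clm_apply hΘc))
  have hint2 : IntervalIntegrable (fun ξ => A.h i • (A.Z i (ξ * A.h i) (R ξ))) volume 0 1 :=
    intervalIntegrable_of_continuousOn hT (continuousOn_const.smul (hZc.clm_apply hRc))
  have hFTC := intervalIntegral.integral_eq_sub_of_hasDerivAt hder (hint1.add hint2)
  rw [intervalIntegral.integral_add hint1 hint2, intervalIntegral.integral_smul,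
    intervalIntegral.integral_smul] at hFTC
  have huv0 : u 0 - v 0 = 0 := by simp [hu, hv, y, A.initial i]
  rw [huv0, map_zero, sub_zero, one_mul] at hFTC
  have hI2 : ‖∫ ξ in (0 : ℝ)..1, A.Z i (ξ * A.h i) (R ξ)‖ ≤ bZ * (K * C ^ 2 * A.h i ^ p) := by
    have := intervalIntegral.norm_integral_le_of_norm_le_const (a := (0 : ℝ)) (b := 1)
      (C := bZ * (K * C ^ 2 * A.h i ^ p)) (f := fun ξ => A.Z i (ξ * A.h i) (R ξ))
      (fun ξ hξ => by
        have hξ' := hsub (uIoc_subset_uIcc hξ)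
        refine (ContinuousLinearMap.le_opNorm _ _).trans ?_
        gcongr
        · exact hZb i ξ hξ'
        · exact hRb ξ hξ')
    simpa using this
  have hE : ‖A.Z i (A.h i) (u 1 - v 1)‖ ≤ (C₁ + bZ * (K * C ^ 2)) * A.h i ^ (p + 1) := by
    rw [← hFTC]
    refine (norm_add_le _ _).trans ?_
    rw [norm_smul, norm_smul, Real.norm_eq_abs, abs_of_pos hhi]
    calc _ ≤ A.h i * (C₁ * A.h i ^ p) + A.h i * (bZ * (K * C ^ 2 * A.h i ^ p)) := by
          gcongr
          exact hΛ i
      _ = _ := by ring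
  have hmem1 : (1 : ℝ) * A.h i ∈ Icc (-τ) τ := A.mul_mem i ⟨by linarith, hT⟩
  rw [one_mul] at hmem1
  have hZ1 : ‖A.Z i (A.h i) - 1‖ ≤ 1 / 2 := hS1 _ (A.isIntegralCurve i _ hmem1).2
  -- Z(h) lies within 1/2 of the identity, so it shrinks vectors by at most a factor 2.
  have hlow : ‖u 1 - v 1‖ ≤ 2 * ‖A.Z i (A.h i) (u 1 - v 1)‖ := by
    have h1 : u 1 - v 1 = A.Z i (A.h i) (u 1 - v 1) - (A.Z i (A.h i) - 1) (u 1 - v 1) := by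
      simp
    have h2 : ‖(A.Z i (A.h i) - 1) (u 1 - v 1)‖ ≤ 1 / 2 * ‖u 1 - v 1‖ :=
      (ContinuousLinearMap.le_opNorm _ _).trans (by gcongr)
    have h3 := norm_sub_le (A.Z i (A.h i) (u 1 - v 1)) ((A.Z i (A.h i) - 1) (u 1 - v 1))
    rw [← h1] at h3
    linarith
  have huv1 : u 1 - v 1 = A.σ i (A.h i) - A.y i (A.h i) := by simp [hu, hv]
  rw [← huv1]
  calc _ ≤ 2 * ((C₁ + bZ * (K * C ^ 2)) * A.h i ^ (p + 1)) := hlow.trans (by gcongr)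
    _ = _ := by ring

end ModelFamily

end ModelError

/-! ### The local error theorem in a vector space, uniform in the data. -/

section ModelTheorem

variable {s : ℕ} {P E F : Type*} [NormedAddCommGroup P] [NormedSpace ℝ P] [FiniteDimensional ℝ P]
  [NormedAddCommGroup E] [NormedSpace ℝ E] [FiniteDimensional ℝ E]
  [NormedAddCommGroup F] [NormedSpace ℝ F] [CompleteSpace F]

theorem exists_nodes_bound (c : Fin s → ℝ) : ∃ T : ℝ, 1 ≤ T ∧ ∀ j, c j ∈ Icc (-T) T := by
  refine ⟨1 + ∑ j, |c j|, by simpa using Finset.sum_nonneg fun j _ => abs_nonneg (c j),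
    fun j => abs_le.1 ?_⟩
  have := Finset.single_le_sum (f := fun j => |c j|) (fun _ _ => abs_nonneg _) (Finset.mem_univ j)
  linarith

/-- Existence of the exact solution and the local error bound in a vector space, locally
uniformly. -/
theorem exists_model_solution_and_error {c : Fin s → ℝ} (hc : Function.Injective c)
    (hb : ∀ i, weight c i ≠ 0) {r : ℕ} (hr : IsQuadratureOrder c r)
    {B : P × E → F →L[ℝ] E} {g : P × E → F}
    (hB : ContDiff ℝ ∞ B) (hBs : HasCompactSupport B) (hg : ContDiff ℝ ∞ g)
    (hgs : HasCompactSupport g) (z₀ : P) (x₀ : E) {R : ℝ} (hR : 0 < R) :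
    ∃ ρ > 0, ∃ τ > 0, ∃ h₀ > 0, ∃ C : ℝ, 0 ≤ C ∧ ∀ z ∈ Metric.closedBall z₀ ρ,
      ∀ y₀ ∈ Metric.closedBall x₀ ρ, ∃ y : ℝ → E, y 0 = y₀ ∧
        (∀ t ∈ Icc (-τ) τ, HasDerivAt y (modelField B g (z, y t)) t ∧
          y t ∈ Metric.closedBall x₀ R) ∧
        ∀ h : ℝ, 0 < h → h < h₀ → ∀ σ : ℝ → E, IsModelStep c B g z h σ → σ 0 = y₀ →
          ‖σ h - y h‖ ≤ C * h ^ (min r (2 * r - 2 * s + 2) + 1) := by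
  obtain ⟨T, hT, hcT⟩ := exists_nodes_bound c
  have hE := FiniteDimensional.complete ℝ E
  have hW := FiniteDimensional.proper ℝ (P × E × (E →L[ℝ] E))
  -- The bound R keeps the solution in the prescribed ball; the bound 1/2 keeps Z close to the
  -- identity.
  set R' := min R (1 / 2)
  have hR' : 0 < R' := by positivity
  obtain ⟨ρ, hρ, τ, hτ, hflow⟩ := exists_uniform_local_flow (contDiff_variationalField hB hg)
    (z₀, x₀, (1 : E →L[ℝ] E)) hR'
  set S := Metric.closedBall (z₀, x₀, (1 : E →L[ℝ] E)) R'
  have hS : IsCompact S := isCompact_closedBall _ _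
  obtain ⟨L, hL, hst⟩ := exists_lipschitz_modelStage hT hcT hB hBs hg hgs
  obtain ⟨Cl, hCl, hl⟩ := exists_bound_lagrangeBasis c T
  choose α hα0 hα using hflow
  have hmem : ∀ z ∈ Metric.closedBall z₀ ρ, ∀ y₀ ∈ Metric.closedBall x₀ ρ,
      (z, y₀, (1 : E →L[ℝ] E)) ∈ Metric.closedBall (z₀, x₀, (1 : E →L[ℝ] E)) ρ := by
    intro z hz y₀ hy₀
    rw [Metric.mem_closedBall, Prod.dist_eq, Prod.dist_eq, dist_self]
    exact max_le hz (max_le hy₀ hρ.le)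
  set K := T * (s * Cl * L)
  have hK : 0 ≤ K := by positivity
  -- All admissible data (z, y₀, h, σ) form one family. Constants for a family do not depend on its
  -- index, so the resulting bound is uniform in all of them.
  let ι := {q : P × E × ℝ × (ℝ → E) // q.1 ∈ Metric.closedBall z₀ ρ ∧
    q.2.1 ∈ Metric.closedBall x₀ ρ ∧ 0 < q.2.2.1 ∧ q.2.2.1 ≤ 1 ∧ T * q.2.2.1 ≤ τ ∧
    q.2.2.1 * K ≤ 1 / 2 ∧ IsModelStep c B g q.1 q.2.2.1 q.2.2.2 ∧ q.2.2.2 0 = q.2.1}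
  let A : ModelFamily c B g S T τ ι :=
    { z := fun i => i.1.1
      h := fun i => i.1.2.2.1
      σ := fun i => i.1.2.2.2
      α := fun i => α _ (hmem _ i.2.1 _ i.2.2.1)
      h_mem := fun i => ⟨i.2.2.2.1, i.2.2.2.2.1⟩
      h_le := fun i => i.2.2.2.2.2.1
      isModelStep := fun i => i.2.2.2.2.2.2.2.1
      isIntegralCurve := fun i => hα _ (hmem _ i.2.1 _ i.2.2.1)
      param_zero := fun i => by rw [hα0]
      initial := fun i => by rw [hα0, i.2.2.2.2.2.2.2.2] }
  obtain ⟨C₁, hC₁, hbd⟩ := A.exists_bound_sub hT hB hg hS hc hb hr hcT hL hCl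
    (fun z u hu u' D hu' hD => (hst z u hu).2 u' D hu' hD) hl fun i => i.2.2.2.2.2.2.1
  obtain ⟨C, hC, herr⟩ := A.exists_bound_error hT hB hg hS hc hb hr hcT hBs hgs (fun w hw => by
    have h1 : dist w.2.2 1 ≤ R' :=
      (le_max_right _ _).trans ((le_max_right _ _).trans (Metric.mem_closedBall.1 hw))
    rw [← dist_eq_norm]
    exact h1.trans (min_le_right _ _)) hC₁ hbd
  have hd1 : 0 < τ / T := by positivity
  have hd2 : 0 < 1 / (2 * (K + 1)) := by positivity
  refine ⟨ρ, hρ, τ, hτ, min 1 (min (τ / T) (1 / (2 * (K + 1)))), by positivity, C, hC,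
    fun z hz y₀ hy₀ => ?_⟩
  have hαz := hα _ (hmem z hz y₀ hy₀)
  have hα0z := hα0 _ (hmem z hz y₀ hy₀)
  set β := α _ (hmem z hz y₀ hy₀) with hβ
  have hfst : ∀ t ∈ Icc (-τ) τ, (β t).1 = z := fun t ht => by
    have hd : ∀ x ∈ Icc (-τ) τ, HasDerivWithinAt (fun t => (β t).1) 0 (Icc (-τ) τ) x :=
      fun x hx => ((hasFDerivAt_fst (𝕜 := ℝ) (p := β x)).comp_hasDerivAt x
        (hαz x hx).1).hasDerivWithinAt
    have := (convex_Icc (-τ) τ).norm_image_sub_le_of_norm_hasDerivWithin_le hd (C := 0)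
      (fun x _ => by simp) ⟨by linarith, hτ.le⟩ ht
    simp only [zero_mul, norm_le_zero_iff, sub_eq_zero, hα0z] at this
    exact this
  refine ⟨fun t => (β t).2.1, by simp only [hα0z], fun t ht => ⟨?_, ?_⟩, fun h hh hh₀ σ hσ hσ0 => ?_⟩
  · have h1 : HasDerivAt (fun t => (β t).2.1) _ t :=
      ((hasFDerivAt_fst (𝕜 := ℝ)).comp (β t) hasFDerivAt_snd).comp_hasDerivAt t (hαz t ht).1
    refine h1.congr_deriv ?_
    simp [variationalField, hfst t ht]
  · have h1 : dist (β t).2.1 x₀ ≤ R' :=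
      (le_max_left _ _).trans ((le_max_right _ _).trans (Metric.mem_closedBall.1 (hαz t ht).2))
    exact Metric.mem_closedBall.2 (h1.trans (min_le_left _ _))
  · have h1 : h ≤ 1 := hh₀.le.trans (min_le_left _ _)
    have h2 : T * h ≤ τ := by
      have : h ≤ τ / T := hh₀.le.trans ((min_le_right _ _).trans (min_le_left _ _))
      rw [le_div_iff₀ (by linarith)] at this
      linarith
    have h3 : h * K ≤ 1 / 2 := by
      have : h ≤ 1 / (2 * (K + 1)) := hh₀.le.trans ((min_le_right _ _).trans (min_le_right _ _))
      rw [le_div_iff₀ (by positivity)] at this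
      nlinarith
    exact herr ⟨(z, y₀, h, σ), hz, hy₀, hh, h1, h2, h3, hσ, hσ0⟩

end ModelTheorem

/-! ### Coordinates on the tangent bundle -/

section TangentCoordinates

variable {E : Type*} [NormedAddCommGroup E] [NormedSpace ℝ E]
  {M : Type*} [TopologicalSpace M] [ChartedSpace E M] [IsManifold 𝓘(ℝ, E) ∞ M]

/-- The coordinates of tangent vectors at `p` in the chart around `u₀`. -/
noncomputable def tangentCoord (u₀ p : M) : TangentSpace 𝓘(ℝ, E) p →L[ℝ] E :=
  (trivializationAt E (TangentSpace 𝓘(ℝ, E)) u₀).continuousLinearMapAt ℝ p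

/-- The tangent vector at `p` with given coordinates in the chart around `u₀`. -/
noncomputable def tangentCoordSymm (u₀ p : M) : E →L[ℝ] TangentSpace 𝓘(ℝ, E) p :=
  (trivializationAt E (TangentSpace 𝓘(ℝ, E)) u₀).symmL ℝ p

theorem tangentCoordSymm_tangentCoord {u₀ p : M} (hp : p ∈ (chartAt E u₀).source)
    (v : TangentSpace 𝓘(ℝ, E) p) : tangentCoordSymm u₀ p (tangentCoord u₀ p v) = v :=
  Trivialization.symmL_continuousLinearMapAt _ (by simpa using hp) v

theorem tangentCoord_tangentCoordSymm {u₀ p : M} (hp : p ∈ (chartAt E u₀).source) (a : E) :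
    tangentCoord u₀ p (tangentCoordSymm u₀ p a) = a :=
  Trivialization.continuousLinearMapAt_symmL _ (by simpa using hp) a

theorem hasMFDerivAt_extChartAt_tangentCoord {u₀ p : M} (hp : p ∈ (chartAt E u₀).source) :
    HasMFDerivAt 𝓘(ℝ, E) 𝓘(ℝ, E) (extChartAt 𝓘(ℝ, E) u₀) p (tangentCoord u₀ p) := by
  rw [tangentCoord, TangentBundle.continuousLinearMapAt_trivializationAt hp]
  exact (mdifferentiableAt_extChartAt hp).hasMFDerivAt

theorem extChartAt_tangentBundle_symm_apply (u₀ : M) {w : E × E}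
    (hw : w.1 ∈ (extChartAt 𝓘(ℝ, E) u₀).target) :
    (extChartAt 𝓘(ℝ, E).tangent (⟨u₀, 0⟩ : TangentBundle 𝓘(ℝ, E) M)).symm w =
      ⟨(extChartAt 𝓘(ℝ, E) u₀).symm w.1,
        tangentCoordSymm u₀ ((extChartAt 𝓘(ℝ, E) u₀).symm w.1) w.2⟩ := by
  have hp : (extChartAt 𝓘(ℝ, E) u₀).symm w.1 ∈ (chartAt E u₀).source := by
    simpa using (extChartAt 𝓘(ℝ, E) u₀).map_target hw
  have := (FiberBundle.extChartAt (IB := 𝓘(ℝ, E)) (⟨u₀, 0⟩ : TangentBundle 𝓘(ℝ, E) M))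
  rw [ModelWithCorners.tangent, this]
  simp only [PartialEquiv.coe_trans_symm, PartialEquiv.prod_symm, PartialEquiv.refl_symm,
    Function.comp, PartialEquiv.prod_coe, PartialEquiv.refl_coe, id]
  have hp' : (extChartAt 𝓘(ℝ, E) u₀).symm w.1 ∈
      (trivializationAt E (TangentSpace 𝓘(ℝ, E)) u₀).baseSet := hp
  have h := Trivialization.symmL_apply (R := ℝ) (trivializationAt E (TangentSpace 𝓘(ℝ, E)) u₀)
      hp' w.2
  exact (Trivialization.mk_symm _ hp' w.2).symm.trans (congrArg (TotalSpace.mk _) h.symm)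

/-- On this set the map is the inverse of the chart of the tangent bundle at the zero vector over
u₀. -/
theorem contMDiffOn_tangentCoordSymm (u₀ : M) :
    ContMDiffOn 𝓘(ℝ, E × E) 𝓘(ℝ, E).tangent ∞
      (fun w : E × E => (⟨(extChartAt 𝓘(ℝ, E) u₀).symm w.1,
        tangentCoordSymm u₀ ((extChartAt 𝓘(ℝ, E) u₀).symm w.1) w.2⟩ : TangentBundle 𝓘(ℝ, E) M))
      ((extChartAt 𝓘(ℝ, E) u₀).target ×ˢ univ) := by
  have h := contMDiffOn_extChartAt_symm (I := 𝓘(ℝ, E).tangent) (n := ∞)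
    (⟨u₀, 0⟩ : TangentBundle 𝓘(ℝ, E) M)
  have h2 : 𝓘(ℝ, E × E) = 𝓘(ℝ, E).prod 𝓘(ℝ, E) := modelWithCornersSelf_prod
  refine (h.mono ?_).congr fun w hw => (extChartAt_tangentBundle_symm_apply u₀ hw.1).symm
  intro w hw
  have := FiberBundle.extChartAt_target (IB := 𝓘(ℝ, E)) (⟨u₀, 0⟩ : TangentBundle 𝓘(ℝ, E) M)
  rw [ModelWithCorners.tangent, this]
  refine ⟨⟨hw.1, ?_⟩, trivial⟩
  simpa using (extChartAt 𝓘(ℝ, E) u₀).map_target hw.1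

theorem contMDiffOn_tangentCoordSymm_const (u₀ : M) (a : E) :
    ContMDiffOn 𝓘(ℝ, E) 𝓘(ℝ, E).tangent ∞
      (fun y : E => (⟨(extChartAt 𝓘(ℝ, E) u₀).symm y,
        tangentCoordSymm u₀ ((extChartAt 𝓘(ℝ, E) u₀).symm y) a⟩ : TangentBundle 𝓘(ℝ, E) M))
      (extChartAt 𝓘(ℝ, E) u₀).target :=
  (contMDiffOn_tangentCoordSymm u₀).comp
    (f := fun y : E => (y, a)) ((contDiff_id.prodMk contDiff_const).contMDiff.contMDiffOn)
    fun _ hy => ⟨hy, trivial⟩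

/-- The coordinates of a smooth vector field along a map into the manifold are smooth. -/
theorem contDiffOn_tangentCoord {u₀ : M} {V : Type*} [NormedAddCommGroup V] [NormedSpace ℝ V]
    {S : Set V} {f : V → TangentBundle 𝓘(ℝ, E) M} (hf : ContMDiffOn 𝓘(ℝ, V) 𝓘(ℝ, E).tangent ∞ f S)
    (hS : ∀ y ∈ S, (f y).1 ∈ (chartAt E u₀).source) :
    ContDiffOn ℝ ∞ (fun y => tangentCoord u₀ (f y).1 (f y).2) S := by
  rw [← contMDiffOn_iff_contDiffOn]
  intro y hy
  have hmem : f y ∈ (trivializationAt E (TangentSpace 𝓘(ℝ, E)) u₀).source := by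
    rw [Trivialization.mem_source]; simpa using hS y hy
  have h := (Bundle.Trivialization.contMDiffWithinAt_iff hmem).1 (hf y hy)
  refine h.2.congr_of_mem (fun y hy => ?_) hy
  rw [tangentCoord, Trivialization.continuousLinearMapAt_apply, Trivialization.linearMapAt_apply]
  simp [hS y hy]

end TangentCoordinates

/-! ### The metric and the tensor field in coordinates -/

section TensorCoordinates

variable {E : Type*} [NormedAddCommGroup E] [NormedSpace ℝ E] [FiniteDimensional ℝ E]
  {M : Type*} [TopologicalSpace M] [ChartedSpace E M] [IsManifold 𝓘(ℝ, E) ∞ M]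

/-- The tensor field `Ω` in the chart around `u₀`. -/
noncomputable def tensorCoord (u₀ : M)
    (Ω : ∀ x : M, TangentSpace 𝓘(ℝ, E) x →L[ℝ] TangentSpace 𝓘(ℝ, E) x) (y : E) : E →L[ℝ] E :=
  tangentCoord u₀ ((extChartAt 𝓘(ℝ, E) u₀).symm y) ∘L Ω ((extChartAt 𝓘(ℝ, E) u₀).symm y) ∘L
    tangentCoordSymm u₀ ((extChartAt 𝓘(ℝ, E) u₀).symm y)

theorem extChartAt_symm_mem_chartAt_source (u₀ : M) {y : E}
    (hy : y ∈ (extChartAt 𝓘(ℝ, E) u₀).target) :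
    (extChartAt 𝓘(ℝ, E) u₀).symm y ∈ (chartAt E u₀).source := by
  have := (extChartAt 𝓘(ℝ, E) u₀).map_target hy
  rwa [extChartAt_source] at this

theorem contDiffOn_tensorCoord (u₀ : M)
    {Ω : ∀ x : M, TangentSpace 𝓘(ℝ, E) x →L[ℝ] TangentSpace 𝓘(ℝ, E) x}
    (hΩ : ContMDiff 𝓘(ℝ, E) (𝓘(ℝ, E).prod 𝓘(ℝ, E →L[ℝ] E)) ∞
      (fun x : M => TotalSpace.mk' (E →L[ℝ] E)
        (E := fun x : M => TangentSpace 𝓘(ℝ, E) x →L[ℝ] TangentSpace 𝓘(ℝ, E) x) x (Ω x))) :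
    ContDiffOn ℝ ∞ (tensorCoord u₀ Ω) (extChartAt 𝓘(ℝ, E) u₀).target := by
  rw [contDiffOn_clm_apply]
  intro a
  have h1 : ContMDiffOn 𝓘(ℝ, E) (𝓘(ℝ, E).prod 𝓘(ℝ, E →L[ℝ] E)) ∞
      (fun y : E => TotalSpace.mk' (E →L[ℝ] E)
        (E := fun x : M => TangentSpace 𝓘(ℝ, E) x →L[ℝ] TangentSpace 𝓘(ℝ, E) x)
        ((extChartAt 𝓘(ℝ, E) u₀).symm y) (Ω ((extChartAt 𝓘(ℝ, E) u₀).symm y)))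
      (extChartAt 𝓘(ℝ, E) u₀).target :=
    hΩ.comp_contMDiffOn (contMDiffOn_extChartAt_symm u₀)
  have h2 := ContMDiffOn.clm_bundle_apply h1 (contMDiffOn_tangentCoordSymm_const u₀ a)
  exact contDiffOn_tangentCoord (u₀ := u₀) h2
    fun y hy => extChartAt_symm_mem_chartAt_source u₀ hy

variable [RiemannianBundle (fun x : M => TangentSpace 𝓘(ℝ, E) x)]

/-- The Riemannian metric in the chart around `u₀`. -/
noncomputable def metricCoord (u₀ : M) (y : E) : E →L[ℝ] E →L[ℝ] ℝ :=
  (isBoundedBilinearMap_inner (𝕜 := ℝ)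
    (E := TangentSpace 𝓘(ℝ, E) ((extChartAt 𝓘(ℝ, E) u₀).symm y))).toContinuousLinearMap.bilinearComp
    (tangentCoordSymm u₀ ((extChartAt 𝓘(ℝ, E) u₀).symm y))
    (tangentCoordSymm u₀ ((extChartAt 𝓘(ℝ, E) u₀).symm y))

theorem metricCoord_apply (u₀ : M) (y a b : E) :
    metricCoord u₀ y a b =
      inner ℝ (tangentCoordSymm u₀ ((extChartAt 𝓘(ℝ, E) u₀).symm y) a)
        (tangentCoordSymm u₀ ((extChartAt 𝓘(ℝ, E) u₀).symm y) b) := rfl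

/-- An explicit preimage under the musical isomorphism: it gives surjectivity of the coordinate
metric and, afterwards, the formula for its inverse. -/
theorem metricCoord_toDual_symm {u₀ : M} {y : E} (hy : y ∈ (extChartAt 𝓘(ℝ, E) u₀).target)
    (α : E →L[ℝ] ℝ) :
    metricCoord u₀ y (tangentCoord u₀ ((extChartAt 𝓘(ℝ, E) u₀).symm y)
      ((InnerProductSpace.toDual ℝ (TangentSpace 𝓘(ℝ, E) ((extChartAt 𝓘(ℝ, E) u₀).symm y))).symm
        (α ∘L tangentCoord u₀ ((extChartAt 𝓘(ℝ, E) u₀).symm y)))) = α := by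
  ext b
  have hp := extChartAt_symm_mem_chartAt_source u₀ hy
  rw [metricCoord_apply, tangentCoordSymm_tangentCoord hp, InnerProductSpace.toDual_symm_apply,
    ContinuousLinearMap.comp_apply, tangentCoord_tangentCoordSymm hp]

theorem isInvertible_metricCoord {u₀ : M} {y : E} (hy : y ∈ (extChartAt 𝓘(ℝ, E) u₀).target) :
    (metricCoord u₀ y).IsInvertible := by
  have hp := extChartAt_symm_mem_chartAt_source u₀ hy
  have hbij : Function.Bijective (metricCoord u₀ y : E →ₗ[ℝ] E →L[ℝ] ℝ) := by
    refine ⟨(injective_iff_map_eq_zero _).2 fun a ha => ?_, fun α =>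
      ⟨_, metricCoord_toDual_symm hy α⟩⟩
    have h1 : metricCoord u₀ y a a = 0 := by
      have : metricCoord u₀ y a = 0 := ha
      rw [this]; rfl
    rw [metricCoord_apply, inner_self_eq_zero] at h1
    rw [← tangentCoord_tangentCoordSymm hp a, h1, map_zero]
  exact ⟨(LinearEquiv.ofBijective _ hbij).toContinuousLinearEquiv, by ext; rfl⟩

theorem inverse_metricCoord_apply {u₀ : M} {y : E} (hy : y ∈ (extChartAt 𝓘(ℝ, E) u₀).target)
    (α : E →L[ℝ] ℝ) :
    (metricCoord u₀ y).inverse α = tangentCoord u₀ ((extChartAt 𝓘(ℝ, E) u₀).symm y)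
      ((InnerProductSpace.toDual ℝ (TangentSpace 𝓘(ℝ, E) ((extChartAt 𝓘(ℝ, E) u₀).symm y))).symm
        (α ∘L tangentCoord u₀ ((extChartAt 𝓘(ℝ, E) u₀).symm y))) := by
  rw [(isInvertible_metricCoord hy).inverse_apply_eq, metricCoord_toDual_symm hy]

variable [IsContMDiffRiemannianBundle 𝓘(ℝ, E) ∞ E (fun x : M => TangentSpace 𝓘(ℝ, E) x)]

theorem contDiffOn_metricCoord (u₀ : M) :
    ContDiffOn ℝ ∞ (metricCoord (E := E) u₀) (extChartAt 𝓘(ℝ, E) u₀).target := by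
  rw [contDiffOn_clm_apply]
  intro a
  rw [contDiffOn_clm_apply]
  intro b
  rw [← contMDiffOn_iff_contDiffOn]
  exact ContMDiffOn.inner_bundle (IB := 𝓘(ℝ, E)) (F := E)
    (E := fun x : M => TangentSpace 𝓘(ℝ, E) x)
    (b := (extChartAt 𝓘(ℝ, E) u₀).symm)
    (v := fun y => tangentCoordSymm u₀ ((extChartAt 𝓘(ℝ, E) u₀).symm y) a)
    (w := fun y => tangentCoordSymm u₀ ((extChartAt 𝓘(ℝ, E) u₀).symm y) b)
    (contMDiffOn_tangentCoordSymm_const u₀ a)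
    (contMDiffOn_tangentCoordSymm_const u₀ b)

/-- The map `α ↦ Ω α^♯` from covectors to vectors in the chart around `u₀`. -/
noncomputable def poissonCoord (u₀ : M)
    (Ω : ∀ x : M, TangentSpace 𝓘(ℝ, E) x →L[ℝ] TangentSpace 𝓘(ℝ, E) x) (y : E) :
    (E →L[ℝ] ℝ) →L[ℝ] E :=
  tensorCoord u₀ Ω y ∘L (metricCoord u₀ y).inverse

theorem contDiffOn_poissonCoord (u₀ : M)
    {Ω : ∀ x : M, TangentSpace 𝓘(ℝ, E) x →L[ℝ] TangentSpace 𝓘(ℝ, E) x}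
    (hΩ : ContMDiff 𝓘(ℝ, E) (𝓘(ℝ, E).prod 𝓘(ℝ, E →L[ℝ] E)) ∞
      (fun x : M => TotalSpace.mk' (E →L[ℝ] E)
        (E := fun x : M => TangentSpace 𝓘(ℝ, E) x →L[ℝ] TangentSpace 𝓘(ℝ, E) x) x (Ω x))) :
    ContDiffOn ℝ ∞ (poissonCoord u₀ Ω) (extChartAt 𝓘(ℝ, E) u₀).target := by
  refine (contDiffOn_tensorCoord u₀ hΩ).clm_comp fun y hy => ?_
  obtain ⟨e, he⟩ := isInvertible_metricCoord (u₀ := u₀) hy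
  have h := contDiffAt_map_inverse (𝕜 := ℝ) (n := ∞) e
  rw [he] at h
  exact h.comp_contDiffWithinAt y (contDiffOn_metricCoord u₀ y hy)

end TensorCoordinates

/-! ### The retraction in coordinates -/

section RetractionCoordinates

variable {E : Type*} [NormedAddCommGroup E] [NormedSpace ℝ E]
  {M : Type*} [TopologicalSpace M] [ChartedSpace E M] [IsManifold 𝓘(ℝ, E) ∞ M]
  [RiemannianBundle (fun x : M => TangentSpace 𝓘(ℝ, E) x)]

/-- The retraction, with its argument in the chart around `u₀`. -/
noncomputable def retractionOfCoord (φ : Retraction E M) (u₀ : M) (w : E × E) : M :=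
  φ.toFun ⟨(extChartAt 𝓘(ℝ, E) u₀).symm w.1,
    tangentCoordSymm u₀ ((extChartAt 𝓘(ℝ, E) u₀).symm w.1) w.2⟩

/-- The retraction in the chart around `u₀`. -/
noncomputable def retractionCoord (φ : Retraction E M) (u₀ : M) (w : E × E) : E :=
  extChartAt 𝓘(ℝ, E) u₀ (retractionOfCoord φ u₀ w)

/-- The coordinates of the domain of the retraction. -/
def retractionOfCoordDomain (φ : Retraction E M) (u₀ : M) : Set (E × E) :=
  ((extChartAt 𝓘(ℝ, E) u₀).target ×ˢ univ) ∩
    (fun w : E × E => (⟨(extChartAt 𝓘(ℝ, E) u₀).symm w.1,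
        tangentCoordSymm u₀ ((extChartAt 𝓘(ℝ, E) u₀).symm w.1) w.2⟩ : TangentBundle 𝓘(ℝ, E) M)) ⁻¹'
      {v : TangentBundle 𝓘(ℝ, E) M | ‖v.2‖ₑ < φ.radius v.1}

/-- The coordinates of those points which the retraction maps into the chart around `u₀`. -/
def retractionCoordDomain (φ : Retraction E M) (u₀ : M) : Set (E × E) :=
  retractionOfCoordDomain φ u₀ ∩ retractionOfCoord φ u₀ ⁻¹' (extChartAt 𝓘(ℝ, E) u₀).source

theorem isOpen_retractionOfCoordDomain (φ : Retraction E M) (u₀ : M) :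
    IsOpen (retractionOfCoordDomain φ u₀) :=
  (contMDiffOn_tangentCoordSymm u₀).continuousOn.isOpen_inter_preimage
    ((isOpen_extChartAt_target u₀).prod isOpen_univ) φ.isOpen_domain

theorem contMDiffOn_retractionOfCoord (φ : Retraction E M) (u₀ : M) :
    ContMDiffOn 𝓘(ℝ, E × E) 𝓘(ℝ, E) ∞ (retractionOfCoord φ u₀) (retractionOfCoordDomain φ u₀) :=
  φ.smooth.comp ((contMDiffOn_tangentCoordSymm u₀).mono inter_subset_left) fun _ hw => hw.2

theorem isOpen_retractionCoordDomain (φ : Retraction E M) (u₀ : M) :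
    IsOpen (retractionCoordDomain φ u₀) :=
  (contMDiffOn_retractionOfCoord φ u₀).continuousOn.isOpen_inter_preimage
    (isOpen_retractionOfCoordDomain φ u₀) (isOpen_extChartAt_source u₀)

theorem contDiffOn_retractionCoord (φ : Retraction E M) (u₀ : M) :
    ContDiffOn ℝ ∞ (retractionCoord φ u₀) (retractionCoordDomain φ u₀) :=
  contMDiffOn_iff_contDiffOn.1 ((contMDiffOn_extChartAt (x := u₀)).comp
    ((contMDiffOn_retractionOfCoord φ u₀).mono inter_subset_left)
    fun _ hw => by simpa using hw.2)

theorem retractionOfCoord_extChartAt (φ : Retraction E M) {u₀ p : M}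
    (hp : p ∈ (chartAt E u₀).source) (x : TangentSpace 𝓘(ℝ, E) p) :
    retractionOfCoord φ u₀ (extChartAt 𝓘(ℝ, E) u₀ p, tangentCoord u₀ p x) = φ.at p x := by
  -- The chart followed by its inverse returns p only propositionally, while the tangent space
  -- depends on the point. Generalising to an arbitrary q = p makes substitution possible.
  have h : ∀ q : M, q = p → φ.toFun ⟨q, tangentCoordSymm u₀ q (tangentCoord u₀ p x)⟩ = φ.at p x := by
    rintro q rfl
    rw [tangentCoordSymm_tangentCoord hp]
    rfl
  exact h _ ((extChartAt 𝓘(ℝ, E) u₀).left_inv (by rwa [extChartAt_source]))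

theorem mem_retractionOfCoordDomain_iff (φ : Retraction E M) {u₀ p : M}
    (hp : p ∈ (chartAt E u₀).source) (x : TangentSpace 𝓘(ℝ, E) p) :
    (extChartAt 𝓘(ℝ, E) u₀ p, tangentCoord u₀ p x) ∈ retractionOfCoordDomain φ u₀ ↔
      ‖x‖ₑ < φ.radius p := by
  have h : ∀ q : M, q = p → (‖tangentCoordSymm u₀ q (tangentCoord u₀ p x)‖ₑ < φ.radius q ↔
      ‖x‖ₑ < φ.radius p) := by
    rintro q rfl
    rw [tangentCoordSymm_tangentCoord hp]
  have hp' : p ∈ (extChartAt 𝓘(ℝ, E) u₀).source := by rwa [extChartAt_source]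
  have h' := h _ ((extChartAt 𝓘(ℝ, E) u₀).left_inv hp')
  exact ⟨fun hx => h'.1 hx.2, fun hx => ⟨⟨(extChartAt 𝓘(ℝ, E) u₀).map_source hp', trivial⟩, h'.2 hx⟩⟩

theorem extChartAt_retraction (φ : Retraction E M) {u₀ p : M}
    (hp : p ∈ (chartAt E u₀).source) (x : TangentSpace 𝓘(ℝ, E) p) :
    extChartAt 𝓘(ℝ, E) u₀ (φ.at p x) =
      retractionCoord φ u₀ (extChartAt 𝓘(ℝ, E) u₀ p, tangentCoord u₀ p x) := by
  rw [retractionCoord, retractionOfCoord_extChartAt φ hp]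

theorem retractionCoord_zero (φ : Retraction E M) {u₀ : M} {z : E}
    (hz : z ∈ (extChartAt 𝓘(ℝ, E) u₀).target) :
    (z, 0) ∈ retractionCoordDomain φ u₀ ∧ retractionCoord φ u₀ (z, 0) = z := by
  have h0 : ‖(0 : TangentSpace 𝓘(ℝ, E) ((extChartAt 𝓘(ℝ, E) u₀).symm z))‖ₑ <
      φ.radius ((extChartAt 𝓘(ℝ, E) u₀).symm z) := by
    rw [enorm_zero]
    exact φ.radius_pos _
  have h1 : retractionOfCoord φ u₀ (z, 0) = (extChartAt 𝓘(ℝ, E) u₀).symm z := by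
    rw [retractionOfCoord]
    simp only [map_zero]
    exact (φ.eq_base_iff _ _ h0).2 rfl
  refine ⟨⟨⟨⟨hz, trivial⟩, ?_⟩, ?_⟩, ?_⟩
  · simpa only [mem_preimage, mem_ofPred_eq, map_zero] using h0
  · rw [mem_preimage, h1]
    exact (extChartAt 𝓘(ℝ, E) u₀).map_target hz
  · rw [retractionCoord, h1, (extChartAt 𝓘(ℝ, E) u₀).right_inv hz]

/-- The derivative of the retraction along the fibres, in the chart around `u₀`. -/
noncomputable def retractionDerivCoord (φ : Retraction E M) (u₀ : M) (w : E × E) : E →L[ℝ] E :=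
  fderiv ℝ (retractionCoord φ u₀) w ∘L ContinuousLinearMap.inr ℝ E E

theorem contDiffOn_retractionDerivCoord (φ : Retraction E M) (u₀ : M) :
    ContDiffOn ℝ ∞ (retractionDerivCoord φ u₀) (retractionCoordDomain φ u₀) :=
  ((contDiffOn_retractionCoord φ u₀).fderiv_of_isOpen (isOpen_retractionCoordDomain φ u₀)
    (by simp)).clm_comp contDiffOn_const

theorem hasFDerivAt_retractionCoord_snd (φ : Retraction E M) {u₀ : M} {z x : E}
    (hw : (z, x) ∈ retractionCoordDomain φ u₀) :
    HasFDerivAt (fun x => retractionCoord φ u₀ (z, x)) (retractionDerivCoord φ u₀ (z, x)) x := by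
  have h := ((contDiffOn_retractionCoord φ u₀).contDiffAt
    ((isOpen_retractionCoordDomain φ u₀).mem_nhds hw)).differentiableAt (by simp)
  exact HasFDerivAt.comp x h.hasFDerivAt (hasFDerivAt_prodMk_right z x)

theorem hasFDerivAt_extChartAt_retraction (φ : Retraction E M) {u₀ p : M}
    (hp : p ∈ (chartAt E u₀).source) {x : TangentSpace 𝓘(ℝ, E) p}
    (hw : (extChartAt 𝓘(ℝ, E) u₀ p, tangentCoord u₀ p x) ∈ retractionCoordDomain φ u₀) :
    HasFDerivAt (fun x => extChartAt 𝓘(ℝ, E) u₀ (φ.at p x))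
      (retractionDerivCoord φ u₀ (extChartAt 𝓘(ℝ, E) u₀ p, tangentCoord u₀ p x) ∘L
        tangentCoord u₀ p) x := by
  have h := (hasFDerivAt_retractionCoord_snd φ hw).comp x (tangentCoord u₀ p).hasFDerivAt
  refine h.congr_of_eventuallyEq (Filter.Eventually.of_forall fun x => ?_)
  exact extChartAt_retraction φ hp x

theorem hasFDerivAt_extChartAt_comp {V : Type*} [NormedAddCommGroup V] [NormedSpace ℝ V]
    {u₀ : M} {f : V → M} {x : V} (hU : f x ∈ (chartAt E u₀).source)
    {f' : V →L[ℝ] TangentSpace 𝓘(ℝ, E) (f x)}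
    (hf : HasMFDerivAt 𝓘(ℝ, V) 𝓘(ℝ, E) f x f') :
    HasFDerivAt (fun x => extChartAt 𝓘(ℝ, E) u₀ (f x)) (tangentCoord u₀ (f x) ∘L f') x :=
  ((hasMFDerivAt_extChartAt_tangentCoord hU).comp x hf).hasFDerivAt

theorem mdifferentiableAt_comp_prodMk_clm {V : Type*} [NormedAddCommGroup V] [NormedSpace ℝ V]
    {f : E × E → M} {z : E} {A : V →L[ℝ] E} {x : V}
    (hf : MDifferentiableAt 𝓘(ℝ, E × E) 𝓘(ℝ, E) f (z, A x)) :
    MDifferentiableAt 𝓘(ℝ, V) 𝓘(ℝ, E) (fun x => f (z, A x)) x :=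
  hf.comp x (f := fun x => (z, A x))
    ((differentiableAt_const _).prodMk A.differentiableAt).mdifferentiableAt

theorem mdifferentiableAt_retraction (φ : Retraction E M) {u₀ p : M}
    (hp : p ∈ (chartAt E u₀).source) {x : TangentSpace 𝓘(ℝ, E) p}
    (hw : (extChartAt 𝓘(ℝ, E) u₀ p, tangentCoord u₀ p x) ∈ retractionOfCoordDomain φ u₀) :
    MDifferentiableAt 𝓘(ℝ, TangentSpace 𝓘(ℝ, E) p) 𝓘(ℝ, E) (φ.at p) x := by
  have h1 : MDifferentiableAt 𝓘(ℝ, E × E) 𝓘(ℝ, E) (retractionOfCoord φ u₀)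
      (extChartAt 𝓘(ℝ, E) u₀ p, tangentCoord u₀ p x) :=
    ((contMDiffOn_retractionOfCoord φ u₀).contMDiffAt
      ((isOpen_retractionOfCoordDomain φ u₀).mem_nhds hw)).mdifferentiableAt (by simp)
  refine (mdifferentiableAt_comp_prodMk_clm h1).congr_of_eventuallyEq
    (Filter.Eventually.of_forall fun x => ?_)
  exact (retractionOfCoord_extChartAt φ hp x).symm

/-- Both sides are the derivative of the chart composed with φ_p, computed once on M and once in
coordinates. -/
theorem tangentCoord_tangentMap (φ : Retraction E M) {u₀ p : M}
    (hp : p ∈ (chartAt E u₀).source) {x : TangentSpace 𝓘(ℝ, E) p}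
    (hw : (extChartAt 𝓘(ℝ, E) u₀ p, tangentCoord u₀ p x) ∈ retractionCoordDomain φ u₀) :
    tangentCoord u₀ (φ.at p x) ∘L φ.tangentMap p x =
      retractionDerivCoord φ u₀ (extChartAt 𝓘(ℝ, E) u₀ p, tangentCoord u₀ p x) ∘L
        tangentCoord u₀ p := by
  have hU : φ.at p x ∈ (chartAt E u₀).source := by
    have := hw.2
    rwa [mem_preimage, retractionOfCoord_extChartAt φ hp, extChartAt_source] at this
  exact (hasFDerivAt_extChartAt_comp hU
    (mdifferentiableAt_retraction φ hp hw.1).hasMFDerivAt).unique (hasFDerivAt_extChartAt_retraction φ hp hw)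

/-- This is the axiom T_0 φ = Id read in the chart. The derivative takes values over φ(0), which
equals u₀ only propositionally, hence the transport in the proof. -/
theorem retractionDerivCoord_self (φ : Retraction E M) (u₀ : M) :
    retractionDerivCoord φ u₀ (extChartAt 𝓘(ℝ, E) u₀ u₀, 0) = ContinuousLinearMap.id ℝ E := by
  have hp := mem_chart_source E u₀
  have hw := (retractionCoord_zero φ (mem_extChartAt_target (I := 𝓘(ℝ, E)) u₀)).1
  rw [← map_zero (tangentCoord u₀ u₀)] at hw ⊢
  have h := hasFDerivAt_extChartAt_retraction φ hp hw
  have hval : φ.toFun ⟨u₀, 0⟩ = u₀ :=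
    (φ.eq_base_iff u₀ 0 (by rw [enorm_zero]; exact φ.radius_pos _)).2 rfl
  have h1 := hasFDerivAt_extChartAt_comp (u₀ := u₀) (by rw [hval]; exact hp)
    (φ.tangentMap_zero u₀)
  have h2 := h.unique h1
  ext a
  have h3 := congrArg (fun L : TangentSpace 𝓘(ℝ, E) u₀ →L[ℝ] E => L (tangentCoordSymm u₀ u₀ a)) h2
  have h4 := tangentCoord_tangentCoordSymm hp a
  have h5 : ∀ q : M, q = u₀ →
      tangentCoord u₀ q (tangentCoordSymm u₀ u₀ a : E) = tangentCoord u₀ u₀ (tangentCoordSymm u₀ u₀ a) := by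
    rintro q rfl
    rfl
  simp only [ContinuousLinearMap.comp_apply] at h3
  rw [h4] at h3
  exact h3.trans ((h5 _ hval).trans h4)

end RetractionCoordinates

/-! ### The method in coordinates -/

/-- Under Riesz duality, adjoints acting on gradients are pullbacks of covectors; this removes the
intermediate metrics from the averaged gradient. -/
theorem adjoint_toDual_symm {V W : Type*} [NormedAddCommGroup V] [InnerProductSpace ℝ V]
    [CompleteSpace V] [NormedAddCommGroup W] [InnerProductSpace ℝ W] [CompleteSpace W]
    (A : V →L[ℝ] W) (m : W →L[ℝ] ℝ) :
    ContinuousLinearMap.adjoint A ((InnerProductSpace.toDual ℝ W).symm m) =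
      (InnerProductSpace.toDual ℝ V).symm (m ∘L A) := by
  refine ext_inner_right ℝ fun v => ?_
  rw [ContinuousLinearMap.adjoint_inner_left, InnerProductSpace.toDual_symm_apply,
    InnerProductSpace.toDual_symm_apply, ContinuousLinearMap.comp_apply]

theorem integral_smul_eq_clm_apply {F V : Type*} [NormedAddCommGroup F] [NormedSpace ℝ F]
    [CompleteSpace F] [NormedAddCommGroup V] [NormedSpace ℝ V] [CompleteSpace V] (L : F →L[ℝ] V)
    {w : ℝ → ℝ} {f : ℝ → V} {g : ℝ → F} (hg : ContinuousOn (fun ξ => w ξ • g ξ) (Icc 0 1))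
    (hf : ∀ ξ ∈ Icc (0 : ℝ) 1, f ξ = L (g ξ)) :
    ∫ ξ in (0 : ℝ)..1, w ξ • f ξ = L (∫ ξ in (0 : ℝ)..1, w ξ • g ξ) := by
  rw [← L.intervalIntegral_comp_comm (hg.intervalIntegrable_of_Icc zero_le_one)]
  refine intervalIntegral.integral_congr fun ξ hξ => ?_
  rw [uIcc_of_le zero_le_one] at hξ
  simp only [hf ξ hξ, map_smul]

section

variable {E : Type*} [NormedAddCommGroup E] [NormedSpace ℝ E] [FiniteDimensional ℝ E]
  {M : Type*} [TopologicalSpace M] [ChartedSpace E M] [IsManifold 𝓘(ℝ, E) ∞ M]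

theorem tensorCoord_extChartAt {u₀ U : M} (hU : U ∈ (chartAt E u₀).source)
    (Ω : ∀ x : M, TangentSpace 𝓘(ℝ, E) x →L[ℝ] TangentSpace 𝓘(ℝ, E) x) (a : E) :
    tensorCoord u₀ Ω (extChartAt 𝓘(ℝ, E) u₀ U) a =
      tangentCoord u₀ U (Ω U (tangentCoordSymm u₀ U a)) := by
  have h : ∀ q : M, q = U → tangentCoord u₀ q (Ω q (tangentCoordSymm u₀ q a)) =
      tangentCoord u₀ U (Ω U (tangentCoordSymm u₀ U a)) := by
    rintro q rfl
    rfl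
  exact h _ ((extChartAt 𝓘(ℝ, E) u₀).left_inv (by rwa [extChartAt_source]))

theorem mfderiv_eq_fderiv_comp_tangentCoord {u₀ U : M} (hU : U ∈ (chartAt E u₀).source)
    {H : M → ℝ} (hH : ContMDiff 𝓘(ℝ, E) 𝓘(ℝ, ℝ) ∞ H) :
    (mfderiv 𝓘(ℝ, E) 𝓘(ℝ, ℝ) H U : TangentSpace 𝓘(ℝ, E) U →L[ℝ] ℝ) =
      fderiv ℝ (fun y => H ((extChartAt 𝓘(ℝ, E) u₀).symm y)) (extChartAt 𝓘(ℝ, E) u₀ U) ∘L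
        tangentCoord u₀ U := by
  have hU' : U ∈ (extChartAt 𝓘(ℝ, E) u₀).source := by rwa [extChartAt_source]
  have h1 : ContDiffOn ℝ ∞ (fun y => H ((extChartAt 𝓘(ℝ, E) u₀).symm y))
      (extChartAt 𝓘(ℝ, E) u₀).target :=
    contMDiffOn_iff_contDiffOn.1 (hH.comp_contMDiffOn (contMDiffOn_extChartAt_symm u₀))
  have h2 := ((h1.contDiffAt ((isOpen_extChartAt_target u₀).mem_nhds
    ((extChartAt 𝓘(ℝ, E) u₀).map_source hU'))).differentiableAt (by simp)).hasFDerivAt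
  have h3 := h2.hasMFDerivAt.comp U (hasMFDerivAt_extChartAt_tangentCoord hU)
  refine HasMFDerivAt.mfderiv (h3.congr_of_eventuallyEq ?_)
  filter_upwards [(isOpen_extChartAt_source (I := 𝓘(ℝ, E)) u₀).mem_nhds hU'] with q hq
  rw [Function.comp, (extChartAt 𝓘(ℝ, E) u₀).left_inv hq]

variable [RiemannianBundle (fun x : M => TangentSpace 𝓘(ℝ, E) x)]

theorem toDual_symm_comp_tangentCoord {u₀ U : M} (hU : U ∈ (chartAt E u₀).source)
    (α : E →L[ℝ] ℝ) :
    (InnerProductSpace.toDual ℝ (TangentSpace 𝓘(ℝ, E) U)).symm (α ∘L tangentCoord u₀ U) =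
      tangentCoordSymm u₀ U ((metricCoord u₀ (extChartAt 𝓘(ℝ, E) u₀ U)).inverse α) := by
  have hU' : U ∈ (extChartAt 𝓘(ℝ, E) u₀).source := by rwa [extChartAt_source]
  rw [inverse_metricCoord_apply ((extChartAt 𝓘(ℝ, E) u₀).map_source hU')]
  have h : ∀ q : M, q = U →
      (InnerProductSpace.toDual ℝ (TangentSpace 𝓘(ℝ, E) U)).symm (α ∘L tangentCoord u₀ U) =
      tangentCoordSymm u₀ U (tangentCoord u₀ q
        ((InnerProductSpace.toDual ℝ (TangentSpace 𝓘(ℝ, E) q)).symm (α ∘L tangentCoord u₀ q))) := by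
    rintro q rfl
    rw [tangentCoordSymm_tangentCoord hU]
  exact h _ ((extChartAt 𝓘(ℝ, E) u₀).left_inv hU')

theorem riemannianGradient_eq_toDual_symm {u₀ U : M} (hU : U ∈ (chartAt E u₀).source)
    {H : M → ℝ} (hH : ContMDiff 𝓘(ℝ, E) 𝓘(ℝ, ℝ) ∞ H) :
    riemannianGradient H U = (InnerProductSpace.toDual ℝ (TangentSpace 𝓘(ℝ, E) U)).symm
      (fderiv ℝ (fun y => H ((extChartAt 𝓘(ℝ, E) u₀).symm y)) (extChartAt 𝓘(ℝ, E) u₀ U) ∘L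
        tangentCoord u₀ U) := by
  rw [riemannianGradient, mfderiv_eq_fderiv_comp_tangentCoord hU hH]

theorem riemannianGradient_eq {u₀ U : M} (hU : U ∈ (chartAt E u₀).source)
    {H : M → ℝ} (hH : ContMDiff 𝓘(ℝ, E) 𝓘(ℝ, ℝ) ∞ H) :
    riemannianGradient H U =
      tangentCoordSymm u₀ U ((metricCoord u₀ (extChartAt 𝓘(ℝ, E) u₀ U)).inverse
        (fderiv ℝ (fun y => H ((extChartAt 𝓘(ℝ, E) u₀).symm y)) (extChartAt 𝓘(ℝ, E) u₀ U))) := by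
  rw [riemannianGradient_eq_toDual_symm hU hH, toDual_symm_comp_tangentCoord hU]

theorem tangentCoord_hamiltonian_field {u₀ U : M} (hU : U ∈ (chartAt E u₀).source)
    (Ω : ∀ x : M, TangentSpace 𝓘(ℝ, E) x →L[ℝ] TangentSpace 𝓘(ℝ, E) x)
    {H : M → ℝ} (hH : ContMDiff 𝓘(ℝ, E) 𝓘(ℝ, ℝ) ∞ H) :
    tangentCoord u₀ U (Ω U (riemannianGradient H U)) =
      poissonCoord u₀ Ω (extChartAt 𝓘(ℝ, E) u₀ U)
        (fderiv ℝ (fun y => H ((extChartAt 𝓘(ℝ, E) u₀).symm y)) (extChartAt 𝓘(ℝ, E) u₀ U)) := by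
  rw [riemannianGradient_eq hU hH, poissonCoord, ContinuousLinearMap.comp_apply,
    tensorCoord_extChartAt hU]

/-- The covector `d(H ∘ φ_p)` in the chart around `u₀`. -/
noncomputable def covectorCoord (φ : Retraction E M) (H : M → ℝ) (u₀ : M) (w : E × E) :
    E →L[ℝ] ℝ :=
  fderiv ℝ (fun y => H ((extChartAt 𝓘(ℝ, E) u₀).symm y)) (retractionCoord φ u₀ w) ∘L
    retractionDerivCoord φ u₀ w

/-- The operator that assigns to a covector on `T_pM` the pullback by `φ_p` of the corresponding
vector `Ω α^♯`, in the chart around `u₀`. -/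
noncomputable def operatorCoord (φ : Retraction E M)
    (Ω : ∀ x : M, TangentSpace 𝓘(ℝ, E) x →L[ℝ] TangentSpace 𝓘(ℝ, E) x) (u₀ : M) (w : E × E) :
    (E →L[ℝ] ℝ) →L[ℝ] E :=
  (retractionDerivCoord φ u₀ w).inverse ∘L poissonCoord u₀ Ω (retractionCoord φ u₀ w) ∘L
    (ContinuousLinearMap.compL ℝ E E ℝ).flip (retractionDerivCoord φ u₀ w).inverse

theorem operatorCoord_apply (φ : Retraction E M)
    (Ω : ∀ x : M, TangentSpace 𝓘(ℝ, E) x →L[ℝ] TangentSpace 𝓘(ℝ, E) x) (u₀ : M) (w : E × E)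
    (α : E →L[ℝ] ℝ) :
    operatorCoord φ Ω u₀ w α = (retractionDerivCoord φ u₀ w).inverse
      (poissonCoord u₀ Ω (retractionCoord φ u₀ w) (α ∘L (retractionDerivCoord φ u₀ w).inverse)) :=
  rfl

/-- The coordinates of the points at which `φ_p` is a local diffeomorphism. -/
def regularDomain (φ : Retraction E M) (u₀ : M) : Set (E × E) :=
  retractionCoordDomain φ u₀ ∩ {w | (retractionDerivCoord φ u₀ w).IsInvertible}

/-- At the zero vector over u₀ the fibre derivative is the identity, and invertibility is an open
condition. -/
theorem regularDomain_mem_nhds (φ : Retraction E M) (u₀ : M) :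
    regularDomain φ u₀ ∈ 𝓝 (extChartAt 𝓘(ℝ, E) u₀ u₀, (0 : E)) := by
  have hw := (retractionCoord_zero φ (mem_extChartAt_target (I := 𝓘(ℝ, E)) u₀)).1
  have hD := (isOpen_retractionCoordDomain φ u₀).mem_nhds hw
  refine Filter.inter_mem hD ?_
  have hc := ((contDiffOn_retractionDerivCoord φ u₀).contDiffAt hD).continuousAt
  have h1 := ContinuousLinearEquiv.nhds (ContinuousLinearEquiv.refl ℝ E)
  have h2 : ((ContinuousLinearEquiv.refl ℝ E : E ≃L[ℝ] E) : E →L[ℝ] E) =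
      retractionDerivCoord φ u₀ (extChartAt 𝓘(ℝ, E) u₀ u₀, (0 : E)) := by
    rw [retractionDerivCoord_self]
    rfl
  rw [h2] at h1
  exact hc h1

theorem contDiffOn_inverse_retractionDerivCoord (φ : Retraction E M) (u₀ : M) :
    ContDiffOn ℝ ∞ (fun w => (retractionDerivCoord φ u₀ w).inverse) (regularDomain φ u₀) := by
  intro w hw
  obtain ⟨e, he⟩ := hw.2
  have h := contDiffAt_map_inverse (𝕜 := ℝ) (n := ∞) e
  rw [he] at h
  exact h.comp_contDiffWithinAt w
    ((contDiffOn_retractionDerivCoord φ u₀ w hw.1).mono inter_subset_left)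

theorem retractionCoord_mem_target (φ : Retraction E M) {u₀ : M} {w : E × E}
    (hw : w ∈ retractionCoordDomain φ u₀) :
    retractionCoord φ u₀ w ∈ (extChartAt 𝓘(ℝ, E) u₀).target :=
  (extChartAt 𝓘(ℝ, E) u₀).map_source hw.2

theorem contDiffOn_covectorCoord (φ : Retraction E M) {H : M → ℝ}
    (hH : ContMDiff 𝓘(ℝ, E) 𝓘(ℝ, ℝ) ∞ H) (u₀ : M) :
    ContDiffOn ℝ ∞ (covectorCoord φ H u₀) (regularDomain φ u₀) := by
  have h1 : ContDiffOn ℝ ∞ (fun y => H ((extChartAt 𝓘(ℝ, E) u₀).symm y))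
      (extChartAt 𝓘(ℝ, E) u₀).target :=
    contMDiffOn_iff_contDiffOn.1 (hH.comp_contMDiffOn (contMDiffOn_extChartAt_symm u₀))
  have h2 := h1.fderiv_of_isOpen (m := ∞) (isOpen_extChartAt_target u₀) (by simp)
  exact (h2.comp ((contDiffOn_retractionCoord φ u₀).mono inter_subset_left)
    fun w hw => retractionCoord_mem_target φ hw.1).clm_comp
      ((contDiffOn_retractionDerivCoord φ u₀).mono inter_subset_left)

theorem retraction_mem_source (φ : Retraction E M) {u₀ p : M}
    (hp : p ∈ (chartAt E u₀).source) {x : TangentSpace 𝓘(ℝ, E) p}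
    (hw : (extChartAt 𝓘(ℝ, E) u₀ p, tangentCoord u₀ p x) ∈ retractionCoordDomain φ u₀) :
    φ.at p x ∈ (chartAt E u₀).source := by
  have := hw.2
  rwa [mem_preimage, retractionOfCoord_extChartAt φ hp, extChartAt_source] at this

theorem tangentMap_eq (φ : Retraction E M) {u₀ p : M}
    (hp : p ∈ (chartAt E u₀).source) {x : TangentSpace 𝓘(ℝ, E) p}
    (hw : (extChartAt 𝓘(ℝ, E) u₀ p, tangentCoord u₀ p x) ∈ retractionCoordDomain φ u₀)
    (a : TangentSpace 𝓘(ℝ, E) p) :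
    φ.tangentMap p x a = tangentCoordSymm u₀ (φ.at p x)
      (retractionDerivCoord φ u₀ (extChartAt 𝓘(ℝ, E) u₀ p, tangentCoord u₀ p x)
        (tangentCoord u₀ p a)) := by
  have h := congrArg (fun L : TangentSpace 𝓘(ℝ, E) p →L[ℝ] E => L a)
    (tangentCoord_tangentMap φ hp hw)
  simp only [ContinuousLinearMap.comp_apply] at h
  rw [← h, tangentCoordSymm_tangentCoord (retraction_mem_source φ hp hw)]

theorem isInvertible_tangentMap (φ : Retraction E M) {u₀ p : M}
    (hp : p ∈ (chartAt E u₀).source) {x : TangentSpace 𝓘(ℝ, E) p}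
    (hw : (extChartAt 𝓘(ℝ, E) u₀ p, tangentCoord u₀ p x) ∈ regularDomain φ u₀) :
    (φ.tangentMap p x).IsInvertible := by
  have hU := retraction_mem_source φ hp hw.1
  have hJ : (retractionDerivCoord φ u₀ (extChartAt 𝓘(ℝ, E) u₀ p, tangentCoord u₀ p x)).IsInvertible :=
    hw.2
  refine ⟨ContinuousLinearEquiv.equivOfInverse (φ.tangentMap p x)
    (tangentCoordSymm u₀ p ∘L
      (retractionDerivCoord φ u₀ (extChartAt 𝓘(ℝ, E) u₀ p, tangentCoord u₀ p x)).inverse ∘L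
        tangentCoord u₀ (φ.at p x)) (fun a => ?_) (fun a => ?_), by ext; rfl⟩
  · simp only [ContinuousLinearMap.comp_apply]
    rw [tangentMap_eq φ hp hw.1, tangentCoord_tangentCoordSymm hU, hJ.inverse_apply_self,
      tangentCoordSymm_tangentCoord hp]
  · simp only [ContinuousLinearMap.comp_apply]
    rw [tangentMap_eq φ hp hw.1, tangentCoord_tangentCoordSymm hp, hJ.self_apply_inverse,
      tangentCoordSymm_tangentCoord hU]

theorem tangentCoord_tangentMapInv (φ : Retraction E M) {u₀ p : M}
    (hp : p ∈ (chartAt E u₀).source) {x : TangentSpace 𝓘(ℝ, E) p}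
    (hw : (extChartAt 𝓘(ℝ, E) u₀ p, tangentCoord u₀ p x) ∈ regularDomain φ u₀)
    (a : TangentSpace 𝓘(ℝ, E) (φ.at p x)) :
    tangentCoord u₀ p (φ.tangentMapInv p x a) =
      (retractionDerivCoord φ u₀ (extChartAt 𝓘(ℝ, E) u₀ p, tangentCoord u₀ p x)).inverse
        (tangentCoord u₀ (φ.at p x) a) := by
  have hU := retraction_mem_source φ hp hw.1
  have hJ : (retractionDerivCoord φ u₀ (extChartAt 𝓘(ℝ, E) u₀ p, tangentCoord u₀ p x)).IsInvertible :=
    hw.2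
  have hT := isInvertible_tangentMap φ hp hw
  symm
  rw [hJ.inverse_apply_eq]
  have h := tangentMap_eq φ hp hw.1 (φ.tangentMapInv p x a)
  have h2 : φ.tangentMap p x (φ.tangentMapInv p x a) = a := hT.self_apply_inverse a
  rw [h2] at h
  have h3 := congrArg (tangentCoord u₀ (φ.at p x)) h
  rwa [tangentCoord_tangentCoordSymm hU] at h3

/-- The vector field `F` pulled back by `φ_p`, in the chart around `u₀`. -/
theorem tangentMap_modelField (φ : Retraction E M)
    (Ω : ∀ x : M, TangentSpace 𝓘(ℝ, E) x →L[ℝ] TangentSpace 𝓘(ℝ, E) x)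
    {H : M → ℝ} (hH : ContMDiff 𝓘(ℝ, E) 𝓘(ℝ, ℝ) ∞ H) {u₀ p : M}
    (hp : p ∈ (chartAt E u₀).source) {x : TangentSpace 𝓘(ℝ, E) p}
    (hw : (extChartAt 𝓘(ℝ, E) u₀ p, tangentCoord u₀ p x) ∈ regularDomain φ u₀) :
    φ.tangentMap p x (tangentCoordSymm u₀ p
      (modelField (operatorCoord φ Ω u₀) (covectorCoord φ H u₀)
        (extChartAt 𝓘(ℝ, E) u₀ p, tangentCoord u₀ p x))) =
      Ω (φ.at p x) (riemannianGradient H (φ.at p x)) := by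
  have hU := retraction_mem_source φ hp hw.1
  have hJ : (retractionDerivCoord φ u₀ (extChartAt 𝓘(ℝ, E) u₀ p, tangentCoord u₀ p x)).IsInvertible :=
    hw.2
  -- With J the fibre derivative, the outer J cancels J⁻¹ in the operator, and the inner J⁻¹ cancels
  -- the J contained in the covector. What remains is Ω applied to the dual of dH.
  rw [tangentMap_eq φ hp hw.1, tangentCoord_tangentCoordSymm hp, modelField, operatorCoord_apply,
    hJ.self_apply_inverse, covectorCoord, ContinuousLinearMap.comp_assoc, hJ.self_comp_inverse,
    ContinuousLinearMap.comp_id, ← extChartAt_retraction φ hp,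
    ← tangentCoord_hamiltonian_field hU Ω hH, tangentCoordSymm_tangentCoord hU]

variable {s : ℕ}

/-- The two adjoints pull dH back to T_pM at x and push it forward at y. The metric is needed only
for the final duality at φ_p(y), which does not depend on x; this allows averaging over x. -/
theorem adjoint_adjoint_riemannianGradient (φ : Retraction E M)
    {H : M → ℝ} (hH : ContMDiff 𝓘(ℝ, E) 𝓘(ℝ, ℝ) ∞ H) {u₀ p : M}
    (hp : p ∈ (chartAt E u₀).source) {x y : TangentSpace 𝓘(ℝ, E) p}
    (hx : (extChartAt 𝓘(ℝ, E) u₀ p, tangentCoord u₀ p x) ∈ regularDomain φ u₀)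
    (hy : (extChartAt 𝓘(ℝ, E) u₀ p, tangentCoord u₀ p y) ∈ regularDomain φ u₀) :
    ContinuousLinearMap.adjoint (φ.tangentMapInv p y)
      (ContinuousLinearMap.adjoint (φ.tangentMap p x) (riemannianGradient H (φ.at p x))) =
    tangentCoordSymm u₀ (φ.at p y)
      ((metricCoord u₀ (extChartAt 𝓘(ℝ, E) u₀ (φ.at p y))).inverse
        (covectorCoord φ H u₀ (extChartAt 𝓘(ℝ, E) u₀ p, tangentCoord u₀ p x) ∘L
          (retractionDerivCoord φ u₀ (extChartAt 𝓘(ℝ, E) u₀ p, tangentCoord u₀ p y)).inverse)) := by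
  have hUx := retraction_mem_source φ hp hx.1
  have hUy := retraction_mem_source φ hp hy.1
  rw [riemannianGradient_eq_toDual_symm hUx hH, adjoint_toDual_symm, adjoint_toDual_symm,
    ← toDual_symm_comp_tangentCoord hUy]
  congr 1
  ext a
  have h1 := congrArg (fun L : TangentSpace 𝓘(ℝ, E) p →L[ℝ] E => L (φ.tangentMapInv p y a))
    (tangentCoord_tangentMap φ hp hx.1)
  simp only [ContinuousLinearMap.comp_apply] at h1
  simp only [covectorCoord, ContinuousLinearMap.comp_apply, h1, tangentCoord_tangentMapInv φ hp hy,
    extChartAt_retraction φ hp]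

/-- The right-hand side of the equations of the method, in the chart around `u₀`. -/
theorem tangentCoord_stage (c : Fin s → ℝ) (φ : Retraction E M)
    (Ω : ∀ x : M, TangentSpace 𝓘(ℝ, E) x →L[ℝ] TangentSpace 𝓘(ℝ, E) x)
    {H : M → ℝ} (hH : ContMDiff 𝓘(ℝ, E) 𝓘(ℝ, ℝ) ∞ H) {u₀ p : M}
    (hp : p ∈ (chartAt E u₀).source) (h : ℝ) {σ : ℝ → TangentSpace 𝓘(ℝ, E) p}
    (hσ : Continuous fun t => tangentCoord u₀ p (σ t))
    (hmem : ∀ ξ ∈ Icc (0 : ℝ) 1,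
      (extChartAt 𝓘(ℝ, E) u₀ p, tangentCoord u₀ p (σ (ξ * h))) ∈ regularDomain φ u₀) {j : Fin s}
    (hj : (extChartAt 𝓘(ℝ, E) u₀ p, tangentCoord u₀ p (σ (c j * h))) ∈ regularDomain φ u₀) :
    tangentCoord u₀ p (φ.tangentMapInv p (σ (c j * h))
      (Ω (φ.at p (σ (c j * h))) (stageGradient c φ H p h σ j))) =
    modelStage c (operatorCoord φ Ω u₀) (covectorCoord φ H u₀) (extChartAt 𝓘(ℝ, E) u₀ p)
      (fun ξ => tangentCoord u₀ p (σ (ξ * h))) j := by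
  have hU := retraction_mem_source φ hp hj.1
  have hcont : ContinuousOn (fun ξ : ℝ => (lagrangeBasis c j ξ / weight c j) •
      covectorCoord φ H u₀ (extChartAt 𝓘(ℝ, E) u₀ p, tangentCoord u₀ p (σ (ξ * h))))
      (Icc 0 1) := by
    refine ((continuous_lagrangeBasis c j).div_const _).continuousOn.smul ?_
    refine (contDiffOn_covectorCoord φ hH u₀).continuousOn.comp ?_ hmem
    exact (continuous_const.prodMk (hσ.comp (continuous_id.mul continuous_const))).continuousOn
  have hint : stageGradient c φ H p h σ j =
      tangentCoordSymm u₀ (φ.at p (σ (c j * h)))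
        ((metricCoord u₀ (extChartAt 𝓘(ℝ, E) u₀ (φ.at p (σ (c j * h))))).inverse
          ((∫ ξ in (0 : ℝ)..1, (lagrangeBasis c j ξ / weight c j) •
            covectorCoord φ H u₀ (extChartAt 𝓘(ℝ, E) u₀ p, tangentCoord u₀ p (σ (ξ * h)))) ∘L
          (retractionDerivCoord φ u₀
            (extChartAt 𝓘(ℝ, E) u₀ p, tangentCoord u₀ p (σ (c j * h)))).inverse)) := by
    -- All dependence on ξ sits in a covector in a fixed dual space. The rest is one continuous
    -- linear map, into the tangent space with its Riemannian norm, and it commutes with the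
    -- integral.
    refine @integral_smul_eq_clm_apply (E →L[ℝ] ℝ) (TangentSpace 𝓘(ℝ, E) (φ.at p (σ (c j * h))))
      inferInstance inferInstance inferInstance inferInstance inferInstance inferInstance
      (tangentCoordSymm u₀ (φ.at p (σ (c j * h))) ∘L
        (metricCoord u₀ (extChartAt 𝓘(ℝ, E) u₀ (φ.at p (σ (c j * h))))).inverse ∘L
        (ContinuousLinearMap.compL ℝ E E ℝ).flip (retractionDerivCoord φ u₀
            (extChartAt 𝓘(ℝ, E) u₀ p, tangentCoord u₀ p (σ (c j * h)))).inverse) _ _ _ hcont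
      fun ξ hξ => ?_
    exact adjoint_adjoint_riemannianGradient φ hH hp (hmem ξ hξ) hj
  rw [tangentCoord_tangentMapInv φ hp hj, hint, ← tensorCoord_extChartAt hU,
    extChartAt_retraction φ hp]
  rfl

variable [IsContMDiffRiemannianBundle 𝓘(ℝ, E) ∞ E (fun x : M => TangentSpace 𝓘(ℝ, E) x)]

theorem contDiffOn_operatorCoord (φ : Retraction E M)
    {Ω : ∀ x : M, TangentSpace 𝓘(ℝ, E) x →L[ℝ] TangentSpace 𝓘(ℝ, E) x}
    (hΩ : ContMDiff 𝓘(ℝ, E) (𝓘(ℝ, E).prod 𝓘(ℝ, E →L[ℝ] E)) ∞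
      (fun x : M => TotalSpace.mk' (E →L[ℝ] E)
        (E := fun x : M => TangentSpace 𝓘(ℝ, E) x →L[ℝ] TangentSpace 𝓘(ℝ, E) x) x (Ω x)))
    (u₀ : M) :
    ContDiffOn ℝ ∞ (operatorCoord φ Ω u₀) (regularDomain φ u₀) := by
  have hJ := contDiffOn_inverse_retractionDerivCoord φ u₀
  have hP := (contDiffOn_poissonCoord u₀ hΩ).comp
    ((contDiffOn_retractionCoord φ u₀).mono inter_subset_left)
    fun w (hw : w ∈ regularDomain φ u₀) => retractionCoord_mem_target φ hw.1
  exact hJ.clm_comp (hP.clm_comp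
    (contDiffOn_clm_apply.2 fun α => (contDiffOn_const (c := α)).clm_comp hJ))

end

/-! ### Distances, integral curves and local inverses in charts -/

section

variable {E : Type*} [NormedAddCommGroup E] [NormedSpace ℝ E] [FiniteDimensional ℝ E]
  {M : Type*} [TopologicalSpace M] [ChartedSpace E M] [IsManifold 𝓘(ℝ, E) ∞ M]
  [RiemannianBundle (fun x : M => TangentSpace 𝓘(ℝ, E) x)]

/-- At (z₀, 0) the map (z, x) ↦ (z, φ_z(x)) has a block triangular derivative with identity
diagonal, so it maps neighbourhoods onto neighbourhoods. This inverts the retraction simultaneously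
for all nearby base points. -/
theorem exists_retractionCoord_eq (φ : Retraction E M) (u₀ : M) {N : Set (E × E)}
    (hN : N ∈ 𝓝 (extChartAt 𝓘(ℝ, E) u₀ u₀, (0 : E))) :
    ∃ η > 0, ∀ z ∈ Metric.ball (extChartAt 𝓘(ℝ, E) u₀ u₀) η,
      ∀ y ∈ Metric.ball (extChartAt 𝓘(ℝ, E) u₀ u₀) η,
        ∃ x, (z, x) ∈ N ∧ retractionCoord φ u₀ (z, x) = y := by
  set z₀ := extChartAt 𝓘(ℝ, E) u₀ u₀ with hz₀
  obtain ⟨hw, hval⟩ := retractionCoord_zero φ (mem_extChartAt_target (I := 𝓘(ℝ, E)) u₀)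
  have hs := ((contDiffOn_retractionCoord φ u₀).contDiffAt
    ((isOpen_retractionCoordDomain φ u₀).mem_nhds hw)).hasStrictFDerivAt (by simp)
  have hG : HasStrictFDerivAt (fun w : E × E => (w.1, retractionCoord φ u₀ w)) _ (z₀, (0 : E)) :=
    hasStrictFDerivAt_fst.prodMk hs
  have hJ := retractionDerivCoord_self φ u₀
  have hsurj := hG.map_nhds_eq_of_surj (by
    rw [LinearMap.range_eq_top]
    rintro ⟨a, b⟩
    refine ⟨(a, b - fderiv ℝ (retractionCoord φ u₀) (z₀, 0) (a, 0)), Prod.ext rfl ?_⟩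
    have h1 : fderiv ℝ (retractionCoord φ u₀) (z₀, 0)
        (0, b - fderiv ℝ (retractionCoord φ u₀) (z₀, 0) (a, 0)) =
        b - fderiv ℝ (retractionCoord φ u₀) (z₀, 0) (a, 0) := by
      have := congrArg (fun L : E →L[ℝ] E =>
        L (b - fderiv ℝ (retractionCoord φ u₀) (z₀, 0) (a, 0))) hJ
      simpa only [retractionDerivCoord, ContinuousLinearMap.comp_apply, ContinuousLinearMap.inr_apply,
        ContinuousLinearMap.id_apply] using this
    have h2 : ((a, b - fderiv ℝ (retractionCoord φ u₀) (z₀, 0) (a, 0)) : E × E) =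
        (a, 0) + (0, b - fderiv ℝ (retractionCoord φ u₀) (z₀, 0) (a, 0)) := by simp
    change fderiv ℝ (retractionCoord φ u₀) (z₀, 0) _ = b
    rw [h2, map_add, h1]
    abel)
  have h1 := Filter.image_mem_map (m := fun w : E × E => (w.1, retractionCoord φ u₀ w)) hN
  rw [hsurj, hval] at h1
  obtain ⟨η, hη, hsub⟩ := Metric.mem_nhds_iff.1 h1
  refine ⟨η, hη, fun z hz y hy => ?_⟩
  have hzy : (z, y) ∈ Metric.ball (z₀, z₀) η := by
    rw [← ball_prod_same]
    exact ⟨hz, hy⟩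
  obtain ⟨⟨z', x⟩, hx, hx2⟩ := hsub hzy
  obtain ⟨rfl, h⟩ := Prod.ext_iff.1 hx2
  exact ⟨x, hx, h⟩

variable [IsContMDiffRiemannianBundle 𝓘(ℝ, E) ∞ E (fun x : M => TangentSpace 𝓘(ℝ, E) x)]

theorem exists_norm_tangentCoord_le (u₀ : M) :
    ∃ C > 0, ∀ᶠ p in 𝓝 u₀, (∀ v : TangentSpace 𝓘(ℝ, E) p, ‖tangentCoord u₀ p v‖ ≤ C * ‖v‖) ∧
      ∀ a : E, ‖tangentCoordSymm u₀ p a‖ ≤ C * ‖a‖ := by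
  have : IsContinuousRiemannianBundle E (fun x : M => TangentSpace 𝓘(ℝ, E) x) := by
    obtain ⟨g, hg, hg'⟩ := IsContMDiffRiemannianBundle.exists_contMDiff (IB := 𝓘(ℝ, E)) (n := ∞)
      (F := E) (E := fun x : M => TangentSpace 𝓘(ℝ, E) x)
    exact ⟨g, hg.continuous, hg'⟩
  obtain ⟨C₁, hC₁, h₁⟩ := eventually_norm_trivializationAt_lt E
    (fun x : M => TangentSpace 𝓘(ℝ, E) x) u₀
  obtain ⟨C₂, hC₂, h₂⟩ := eventually_norm_symmL_trivializationAt_lt E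
    (fun x : M => TangentSpace 𝓘(ℝ, E) x) u₀
  refine ⟨max C₁ C₂, lt_max_of_lt_left hC₁, ?_⟩
  filter_upwards [h₁, h₂] with p hp₁ hp₂
  refine ⟨fun v => ?_, fun a => ?_⟩
  · exact ContinuousLinearMap.le_of_opNorm_le _ (hp₁.le.trans (le_max_left _ _)) v
  · exact ContinuousLinearMap.le_of_opNorm_le _ (hp₂.le.trans (le_max_right _ _)) a

theorem contMDiff_hamiltonian_field
    {Ω : ∀ x : M, TangentSpace 𝓘(ℝ, E) x →L[ℝ] TangentSpace 𝓘(ℝ, E) x}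
    (hΩ : ContMDiff 𝓘(ℝ, E) (𝓘(ℝ, E).prod 𝓘(ℝ, E →L[ℝ] E)) ∞
      (fun x : M => TotalSpace.mk' (E →L[ℝ] E)
        (E := fun x : M => TangentSpace 𝓘(ℝ, E) x →L[ℝ] TangentSpace 𝓘(ℝ, E) x) x (Ω x)))
    {H : M → ℝ} (hH : ContMDiff 𝓘(ℝ, E) 𝓘(ℝ, ℝ) ∞ H) :
    ContMDiff 𝓘(ℝ, E) 𝓘(ℝ, E).tangent ∞
      (fun x => (⟨x, Ω x (riemannianGradient H x)⟩ : TangentBundle 𝓘(ℝ, E) M)) := by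
  intro u₀
  have h1 : ContDiffOn ℝ ∞ (fun y => H ((extChartAt 𝓘(ℝ, E) u₀).symm y))
      (extChartAt 𝓘(ℝ, E) u₀).target :=
    contMDiffOn_iff_contDiffOn.1 (hH.comp_contMDiffOn (contMDiffOn_extChartAt_symm u₀))
  have h2 := h1.fderiv_of_isOpen (m := ∞) (isOpen_extChartAt_target u₀) (by simp)
  have h3 := (contDiffOn_poissonCoord u₀ hΩ).clm_apply h2
  have h4 := (contMDiffOn_tangentCoordSymm u₀).comp
    (contDiffOn_id.prodMk h3).contMDiffOn (fun y hy => ⟨hy, trivial⟩)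
  have h5 := h4.comp (contMDiffOn_extChartAt (I := 𝓘(ℝ, E)) (x := u₀) (n := ∞))
    fun x hx => (extChartAt 𝓘(ℝ, E) u₀).map_source (by rwa [extChartAt_source])
  have hu : (chartAt E u₀).source ∈ 𝓝 u₀ := chart_source_mem_nhds E u₀
  refine (h5.contMDiffAt hu).congr_of_eventuallyEq ?_
  filter_upwards [hu] with x hx
  have hq : ∀ q : M, q = x → (⟨x, Ω x (riemannianGradient H x)⟩ : TangentBundle 𝓘(ℝ, E) M) =
      ⟨q, tangentCoordSymm u₀ q (tangentCoord u₀ x (Ω x (riemannianGradient H x)))⟩ := by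
    rintro q rfl
    rw [tangentCoordSymm_tangentCoord hx]
  simp only [Function.comp, id]
  rw [← tangentCoord_hamiltonian_field hx Ω hH]
  exact hq _ ((extChartAt 𝓘(ℝ, E) u₀).left_inv (by rwa [extChartAt_source]))

end

section

variable {E : Type*} [NormedAddCommGroup E] [NormedSpace ℝ E] [CompleteSpace E]
  {M : Type*} [TopologicalSpace M] [T2Space M] [ChartedSpace E M] [IsManifold 𝓘(ℝ, E) ∞ M]

theorem hasMFDerivWithinAt_field_congr {v : ∀ x : M, TangentSpace 𝓘(ℝ, E) x} {f g : ℝ → M}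
    {S : Set ℝ} {t : ℝ}
    (hg : HasMFDerivWithinAt 𝓘(ℝ, ℝ) 𝓘(ℝ, E) g S t ((1 : ℝ →L[ℝ] ℝ).smulRight (v (g t))))
    (hfg : f =ᶠ[𝓝[S] t] g) (ht : f t = g t) :
    HasMFDerivWithinAt 𝓘(ℝ, ℝ) 𝓘(ℝ, E) f S t ((1 : ℝ →L[ℝ] ℝ).smulRight (v (f t))) := by
  have h := hg.congr_of_eventuallyEq hfg ht
  have hv : (v (f t) : E) = v (g t) := congrArg (fun q => (v q : E)) ht
  exact ⟨h.1, h.2.congr_fderiv (congrArg (fun e : E => (1 : ℝ →L[ℝ] ℝ).smulRight e) hv.symm)⟩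

/-- Uniqueness of integral curves on a closed interval that starts at the initial time. -/
theorem eqOn_Icc_of_isMIntegralCurveOn {v : ∀ x : M, TangentSpace 𝓘(ℝ, E) x}
    (hv : ContMDiff 𝓘(ℝ, E) 𝓘(ℝ, E).tangent 1 (fun x => (⟨x, v x⟩ : TangentBundle 𝓘(ℝ, E) M)))
    {γ γ₁ : ℝ → M} {τ h : ℝ} (hh : 0 < h) (hτ : h < τ)
    (hγ : IsMIntegralCurveOn γ v (Icc 0 h)) (hγ₁ : IsMIntegralCurveOn γ₁ v (Ioo (-τ) τ))
    (h0 : γ 0 = γ₁ 0) : EqOn γ γ₁ (Icc 0 h) := by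
  -- Uniqueness is applied on an open interval around the initial time, so γ is prolonged backwards
  -- by γ₁. At 0 the one-sided derivatives agree, and the endpoint h is recovered by continuity.
  set γ₂ : ℝ → M := fun t => if t ≤ 0 then γ₁ t else γ t with hγ₂
  have e1 : ∀ t ≤ 0, γ₂ t = γ₁ t := fun t ht => if_pos ht
  have e2 : ∀ t, 0 ≤ t → γ₂ t = γ t := fun t ht => by
    rcases ht.eq_or_lt with rfl | ht
    · rw [e1 0 le_rfl, h0]
    · exact if_neg (not_le.2 ht)
  have hcurve : IsMIntegralCurveOn γ₂ v (Ioo (-τ) h) := by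
    intro t ht
    rcases lt_trichotomy t 0 with h1 | rfl | h1
    · refine hasMFDerivWithinAt_field_congr ((hγ₁ t ⟨ht.1, by linarith⟩).hasMFDerivAt
        (Ioo_mem_nhds ht.1 (by linarith))).hasMFDerivWithinAt ?_ (e1 t h1.le)
      filter_upwards [mem_nhdsWithin_of_mem_nhds (Iio_mem_nhds h1)] with x hx using e1 x (le_of_lt hx)
    · rw [← Ioc_union_Ico_eq_Ioo ht.1 hh]
      refine HasMFDerivWithinAt.union ?_ ?_
      · exact hasMFDerivWithinAt_field_congr
          ((hγ₁ 0 ⟨ht.1, by linarith⟩).mono (s := Ioc (-τ) 0) fun x hx =>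
            ⟨hx.1, hx.2.trans_lt (by linarith)⟩)
          (by filter_upwards [self_mem_nhdsWithin] with x hx using e1 x hx.2) (e1 0 le_rfl)
      · exact hasMFDerivWithinAt_field_congr
          ((hγ 0 ⟨le_rfl, hh.le⟩).mono (s := Ico 0 h) Ico_subset_Icc_self)
          (by filter_upwards [self_mem_nhdsWithin] with x hx using e2 x hx.1) (e2 0 le_rfl)
    · refine hasMFDerivWithinAt_field_congr ((hγ t ⟨h1.le, ht.2.le⟩).hasMFDerivAt
        (Icc_mem_nhds h1 ht.2)).hasMFDerivWithinAt ?_ (e2 t h1.le)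
      filter_upwards [mem_nhdsWithin_of_mem_nhds (Ioi_mem_nhds h1)] with x hx using e2 x (le_of_lt hx)
  have heq := isMIntegralCurveOn_Ioo_eqOn_of_contMDiff_boundaryless (t₀ := 0)
    ⟨by linarith, hh⟩ hv hcurve (hγ₁.mono (Ioo_subset_Ioo_right hτ.le)) (e1 0 le_rfl)
  have hIco : EqOn γ γ₁ (Ico 0 h) := fun t ht => by
    rw [← e2 t ht.1]
    exact heq ⟨by linarith [ht.1], ht.2⟩
  have hcl := hIco.of_subset_closure (t := Icc 0 h) hγ.continuousOn
    (hγ₁.continuousOn.mono fun x hx => ⟨by linarith [hx.1], by linarith [hx.2]⟩)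
    Ico_subset_Icc_self (by rw [closure_Ico hh.ne])
  exact hcl

end

section

variable {E : Type*} [NormedAddCommGroup E] [NormedSpace ℝ E] [FiniteDimensional ℝ E]
  {M : Type*} [EMetricSpace M] [ChartedSpace E M] [IsManifold 𝓘(ℝ, E) ∞ M]
  [RiemannianBundle (fun x : M => TangentSpace 𝓘(ℝ, E) x)]
  [IsContMDiffRiemannianBundle 𝓘(ℝ, E) ∞ E (fun x : M => TangentSpace 𝓘(ℝ, E) x)]
  [IsRiemannianManifold 𝓘(ℝ, E) M]

/-- The inverse of a chart is locally Lipschitz for the Riemannian distance. -/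
theorem exists_edist_extChartAt_symm_le (u₀ : M) :
    ∃ C > 0, ∃ ρ > 0, ∀ a ∈ Metric.ball (extChartAt 𝓘(ℝ, E) u₀ u₀) ρ,
      ∀ b ∈ Metric.ball (extChartAt 𝓘(ℝ, E) u₀ u₀) ρ,
        edist ((extChartAt 𝓘(ℝ, E) u₀).symm a) ((extChartAt 𝓘(ℝ, E) u₀).symm b) ≤
          ENNReal.ofReal (C * ‖a - b‖) := by
  obtain ⟨C, hC, hCev⟩ := exists_norm_tangentCoord_le (E := E) u₀
  have hcont : Filter.Tendsto (extChartAt 𝓘(ℝ, E) u₀).symm (𝓝 (extChartAt 𝓘(ℝ, E) u₀ u₀)) (𝓝 u₀) := by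
    have := continuousAt_extChartAt_symm (I := 𝓘(ℝ, E)) u₀
    rwa [ContinuousAt, extChartAt_to_inv] at this
  obtain ⟨ρ, hρ, hball⟩ := Metric.mem_nhds_iff.1
    (Filter.inter_mem (extChartAt_target_mem_nhds (I := 𝓘(ℝ, E)) u₀) (hcont hCev))
  refine ⟨C, hC, ρ, hρ, fun a ha b hb => ?_⟩
  -- The competitor for the distance is the image of a straight segment, with constant coordinate
  -- velocity b - a and hence length at most C‖a - b‖.
  set η : ℝ → E := fun t => a + t • (b - a) with hη
  have hηball : ∀ t ∈ Icc (0 : ℝ) 1, η t ∈ Metric.ball (extChartAt 𝓘(ℝ, E) u₀ u₀) ρ :=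
    fun t ht => (convex_ball _ _).add_smul_sub_mem ha hb ht
  have hηd : ∀ t, HasDerivAt η (b - a) t := fun t => by
    have h := ((hasDerivAt_id t).smul_const (b - a)).const_add a
    rwa [one_smul] at h
  have hηs : ContDiff ℝ ∞ η := contDiff_const.add (contDiff_id.smul contDiff_const)
  have hγs : ContMDiffOn 𝓘(ℝ, ℝ) 𝓘(ℝ, E) ∞ ((extChartAt 𝓘(ℝ, E) u₀).symm ∘ η)
      (η ⁻¹' (extChartAt 𝓘(ℝ, E) u₀).target) :=
    (contMDiffOn_extChartAt_symm u₀).comp hηs.contMDiff.contMDiffOn fun t ht => ht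
  have hopen : IsOpen (η ⁻¹' (extChartAt 𝓘(ℝ, E) u₀).target) :=
    (isOpen_extChartAt_target u₀).preimage hηs.continuous
  have hsub : Icc (0 : ℝ) 1 ⊆ η ⁻¹' (extChartAt 𝓘(ℝ, E) u₀).target :=
    fun t ht => (hball (hηball t ht)).1
  rw [IsRiemannianManifold.out (I := 𝓘(ℝ, E))]
  refine (riemannianEDist_le_pathELength ((hγs.of_le (by simp)).mono hsub) (by simp [η])
    (by simp [η]) zero_le_one).trans ?_
  rw [pathELength_eq_lintegral_mfderiv_Icc]
  refine (setLIntegral_mono' (g := fun _ => ENNReal.ofReal (C * ‖a - b‖)) measurableSet_Icc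
    fun t ht => ?_).trans (by simp)
  have hp : (extChartAt 𝓘(ℝ, E) u₀).symm (η t) ∈ (chartAt E u₀).source :=
    extChartAt_symm_mem_chartAt_source u₀ (hsub ht)
  have hd : MDifferentiableAt 𝓘(ℝ, ℝ) 𝓘(ℝ, E) ((extChartAt 𝓘(ℝ, E) u₀).symm ∘ η) t :=
    (hγs.contMDiffAt (hopen.mem_nhds (hsub ht))).mdifferentiableAt (by simp)
  have h1 := hasFDerivAt_extChartAt_comp (u₀ := u₀) (x := t)
    (f := (extChartAt 𝓘(ℝ, E) u₀).symm ∘ η) hp hd.hasMFDerivAt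
  have h2 : HasFDerivAt (fun x => extChartAt 𝓘(ℝ, E) u₀ (((extChartAt 𝓘(ℝ, E) u₀).symm ∘ η) x))
      (ContinuousLinearMap.toSpanSingleton ℝ (b - a)) t := by
    refine (hηd t).hasFDerivAt.congr_of_eventuallyEq ?_
    filter_upwards [hopen.mem_nhds (hsub ht)] with x hx
    exact (extChartAt 𝓘(ℝ, E) u₀).right_inv hx
  have h3 := congrArg (fun L : ℝ →L[ℝ] E => L 1) (h1.unique h2)
  have h4 := congrArg (tangentCoordSymm u₀ ((extChartAt 𝓘(ℝ, E) u₀).symm (η t))) h3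
  have h5 : mfderiv 𝓘(ℝ, ℝ) 𝓘(ℝ, E) ((extChartAt 𝓘(ℝ, E) u₀).symm ∘ η) t (1 : ℝ) =
      tangentCoordSymm u₀ ((extChartAt 𝓘(ℝ, E) u₀).symm (η t)) (b - a) := by
    have h6 := tangentCoordSymm_tangentCoord hp
      (mfderiv 𝓘(ℝ, ℝ) 𝓘(ℝ, E) ((extChartAt 𝓘(ℝ, E) u₀).symm ∘ η) t (1 : ℝ))
    have h7 : (ContinuousLinearMap.toSpanSingleton ℝ (b - a)) (1 : ℝ) = b - a := by simp
    exact h6.symm.trans (h4.trans (congrArg _ h7))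
  have h8 := (hball (hηball t ht)).2.2 (b - a)
  rw [← h5, norm_sub_rev] at h8
  rw [← ofReal_norm]
  exact ENNReal.ofReal_le_ofReal h8

end

/-! ### Transfer between the manifold and the chart -/

section

variable {E : Type*} [NormedAddCommGroup E] [NormedSpace ℝ E]
  {M : Type*} [TopologicalSpace M] [ChartedSpace E M]
  {V : Type*} [NormedAddCommGroup V] [NormedSpace ℝ V]

theorem hasMFDerivAt_comp_hasDerivAt {f : V → M} {η : ℝ → V} {e : V} {t : ℝ}
    (hf : MDifferentiableAt 𝓘(ℝ, V) 𝓘(ℝ, E) f (η t)) (hη : HasDerivAt η e t) :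
    HasMFDerivAt 𝓘(ℝ, ℝ) 𝓘(ℝ, E) (fun t => f (η t)) t
      ((1 : ℝ →L[ℝ] ℝ).smulRight (mfderiv 𝓘(ℝ, V) 𝓘(ℝ, E) f (η t) e)) := by
  have h := hf.hasMFDerivAt.comp t hη.hasFDerivAt.hasMFDerivAt
  have key : ∀ x : ℝ, mfderiv 𝓘(ℝ, V) 𝓘(ℝ, E) f (η t) (x • e) =
      x • mfderiv 𝓘(ℝ, V) 𝓘(ℝ, E) f (η t) e := fun x => map_smul _ x e
  exact h.congr_mfderiv (ContinuousLinearMap.ext key)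

theorem hasMFDerivWithinAt_field_of_hasDerivAt {v : ∀ x : M, TangentSpace 𝓘(ℝ, E) x} {f : V → M}
    {η : ℝ → V} {e : V} {t : ℝ} {S : Set ℝ} (hf : MDifferentiableAt 𝓘(ℝ, V) 𝓘(ℝ, E) f (η t))
    (hη : HasDerivAt η e t) (hv : mfderiv 𝓘(ℝ, V) 𝓘(ℝ, E) f (η t) e = v (f (η t))) :
    HasMFDerivWithinAt 𝓘(ℝ, ℝ) 𝓘(ℝ, E) (fun t => f (η t)) S t
      ((1 : ℝ →L[ℝ] ℝ).smulRight (v (f (η t)))) := by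
  rw [← hv]
  exact (hasMFDerivAt_comp_hasDerivAt hf hη).hasMFDerivWithinAt

theorem hasDerivAt_of_polynomial {s : ℕ} {σ : ℝ → V}
    (hσ : ∃ a : Fin (s + 1) → V, ∀ t, σ t = ∑ k : Fin (s + 1), t ^ (k : ℕ) • a k) (t : ℝ) :
    HasDerivAt σ (deriv σ t) t := by
  obtain ⟨a, ha⟩ := hσ
  rw [show σ = fun t => ∑ k : Fin (s + 1), t ^ (k : ℕ) • a k from funext ha]
  refine DifferentiableAt.hasDerivAt (DifferentiableAt.fun_sum fun k _ => ?_)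
  fun_prop

theorem hasDerivAt_clm_comp {W : Type*} [NormedAddCommGroup W] [NormedSpace ℝ W]
    (L : V →L[ℝ] W) {y : ℝ → V} {e : V} {t : ℝ} (hy : HasDerivAt y e t) :
    HasDerivAt (fun t => L (y t)) (L e) t :=
  L.hasFDerivAt.comp_hasDerivAt t hy

theorem polynomial_clm_comp {W : Type*} [NormedAddCommGroup W] [NormedSpace ℝ W] {s : ℕ}
    {σ : ℝ → V} (L : V →L[ℝ] W)
    (hσ : ∃ a : Fin (s + 1) → V, ∀ t, σ t = ∑ k : Fin (s + 1), t ^ (k : ℕ) • a k) :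
    (∃ a : Fin (s + 1) → W, ∀ t, L (σ t) = ∑ k : Fin (s + 1), t ^ (k : ℕ) • a k) ∧
      (∀ t, deriv (fun t => L (σ t)) t = L (deriv σ t)) := by
  refine ⟨?_, fun t => (L.hasFDerivAt.comp_hasDerivAt t (hasDerivAt_of_polynomial hσ t)).deriv⟩
  obtain ⟨a, ha⟩ := hσ
  exact ⟨fun k => L (a k), fun t => by simp [ha]⟩

end

theorem modelStage_congr {s : ℕ} {P E F : Type*}
    [NormedAddCommGroup E] [NormedSpace ℝ E] [NormedAddCommGroup F] [NormedSpace ℝ F]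
    (c : Fin s → ℝ) {B B' : P × E → F →L[ℝ] E} {g g' : P × E → F} {z : P} {u : ℝ → E} {j : Fin s}
    (hB : B (z, u (c j)) = B' (z, u (c j)))
    (hg : ∀ ξ ∈ Icc (0 : ℝ) 1, g (z, u ξ) = g' (z, u ξ)) :
    modelStage c B g z u j = modelStage c B' g' z u j := by
  rw [modelStage, modelStage, hB]
  congr 1
  refine intervalIntegral.integral_congr fun ξ hξ => ?_
  rw [uIcc_of_le zero_le_one] at hξ
  simp only [hg ξ hξ]

section

variable {E : Type*} [NormedAddCommGroup E] [NormedSpace ℝ E] [FiniteDimensional ℝ E]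
  {M : Type*} [EMetricSpace M] [ChartedSpace E M] [IsManifold 𝓘(ℝ, E) ∞ M]
  [RiemannianBundle (fun x : M => TangentSpace 𝓘(ℝ, E) x)]

/-- The vector field and the method near `u₀` in coordinates, extended to globally defined maps. -/
structure LocalModel (φ : Retraction E M)
    (Ω : ∀ x : M, TangentSpace 𝓘(ℝ, E) x →L[ℝ] TangentSpace 𝓘(ℝ, E) x) (H : M → ℝ) (u₀ : M) where
  B : E × E → (E →L[ℝ] ℝ) →L[ℝ] E
  g : E × E → E →L[ℝ] ℝ
  ρ : ℝ
  C : ℝ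
  contDiff_B : ContDiff ℝ ∞ B
  hasCompactSupport_B : HasCompactSupport B
  contDiff_g : ContDiff ℝ ∞ g
  hasCompactSupport_g : HasCompactSupport g
  ρ_pos : 0 < ρ
  C_pos : 0 < C
  mem_regularDomain : ∀ w ∈ Metric.ball (extChartAt 𝓘(ℝ, E) u₀ u₀, (0 : E)) ρ,
    w ∈ regularDomain φ u₀
  B_eq : ∀ w ∈ Metric.ball (extChartAt 𝓘(ℝ, E) u₀ u₀, (0 : E)) ρ, B w = operatorCoord φ Ω u₀ w
  g_eq : ∀ w ∈ Metric.ball (extChartAt 𝓘(ℝ, E) u₀ u₀, (0 : E)) ρ, g w = covectorCoord φ H u₀ w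
  edist_le : ∀ w ∈ Metric.ball (extChartAt 𝓘(ℝ, E) u₀ u₀, (0 : E)) ρ,
    ∀ w' ∈ Metric.ball (extChartAt 𝓘(ℝ, E) u₀ u₀, (0 : E)) ρ,
      edist (retractionOfCoord φ u₀ w) (retractionOfCoord φ u₀ w') ≤
        ENNReal.ofReal (C * ‖w - w'‖)
  eventually_norm_le : ∀ᶠ p in 𝓝 u₀, p ∈ (chartAt E u₀).source ∧
    (∀ v : TangentSpace 𝓘(ℝ, E) p, ‖tangentCoord u₀ p v‖ ≤ C * ‖v‖) ∧
      ∀ a : E, ‖tangentCoordSymm u₀ p a‖ ≤ C * ‖a‖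

theorem nonempty_localModel
    [IsContMDiffRiemannianBundle 𝓘(ℝ, E) ∞ E (fun x : M => TangentSpace 𝓘(ℝ, E) x)]
    [IsRiemannianManifold 𝓘(ℝ, E) M] (φ : Retraction E M)
    {Ω : ∀ x : M, TangentSpace 𝓘(ℝ, E) x →L[ℝ] TangentSpace 𝓘(ℝ, E) x}
    (hΩ : ContMDiff 𝓘(ℝ, E) (𝓘(ℝ, E).prod 𝓘(ℝ, E →L[ℝ] E)) ∞
      (fun x : M => TotalSpace.mk' (E →L[ℝ] E)
        (E := fun x : M => TangentSpace 𝓘(ℝ, E) x →L[ℝ] TangentSpace 𝓘(ℝ, E) x) x (Ω x)))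
    {H : M → ℝ} (hH : ContMDiff 𝓘(ℝ, E) 𝓘(ℝ, ℝ) ∞ H) (u₀ : M) :
    Nonempty (LocalModel φ Ω H u₀) := by
  have hreg := regularDomain_mem_nhds φ u₀
  obtain ⟨B, hB, hBs, ρ₁, hρ₁, hB_eq⟩ :=
    exists_contDiff_hasCompactSupport hreg (contDiffOn_operatorCoord φ hΩ u₀)
  obtain ⟨g, hg, hgs, ρ₂, hρ₂, hg_eq⟩ :=
    exists_contDiff_hasCompactSupport hreg (contDiffOn_covectorCoord φ hH u₀)
  obtain ⟨C₁, hC₁, hnorm⟩ := exists_norm_tangentCoord_le (E := E) u₀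
  obtain ⟨C₂, hC₂, ρ₃, hρ₃, hdist⟩ := exists_edist_extChartAt_symm_le (E := E) u₀
  obtain ⟨hw, hval⟩ := retractionCoord_zero φ (mem_extChartAt_target (I := 𝓘(ℝ, E)) u₀)
  have hΦ := (contDiffOn_retractionCoord φ u₀).contDiffAt
    ((isOpen_retractionCoordDomain φ u₀).mem_nhds hw)
  -- The distance estimate of the model composes this Lipschitz constant with that of the inverse
  -- chart.
  obtain ⟨L, S, hS, hL⟩ := (hΦ.of_le (m := 1) (by simp)).exists_lipschitzOnWith
  have hΦc : retractionCoord φ u₀ ⁻¹' Metric.ball (extChartAt 𝓘(ℝ, E) u₀ u₀) ρ₃ ∈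
      𝓝 (extChartAt 𝓘(ℝ, E) u₀ u₀, (0 : E)) :=
    hΦ.continuousAt (by rw [hval]; exact Metric.ball_mem_nhds _ hρ₃)
  obtain ⟨ρ₄, hρ₄, hball⟩ := Metric.mem_nhds_iff.1
    (Filter.inter_mem hreg (Filter.inter_mem hS hΦc))
  have h1 : Metric.ball (extChartAt 𝓘(ℝ, E) u₀ u₀, (0 : E)) (min ρ₁ (min ρ₂ ρ₄)) ⊆
      Metric.ball (extChartAt 𝓘(ℝ, E) u₀ u₀, (0 : E)) ρ₁ :=
    Metric.ball_subset_ball (min_le_left _ _)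
  have h2 : Metric.ball (extChartAt 𝓘(ℝ, E) u₀ u₀, (0 : E)) (min ρ₁ (min ρ₂ ρ₄)) ⊆
      Metric.ball (extChartAt 𝓘(ℝ, E) u₀ u₀, (0 : E)) ρ₂ :=
    Metric.ball_subset_ball ((min_le_right _ _).trans (min_le_left _ _))
  have h4 : Metric.ball (extChartAt 𝓘(ℝ, E) u₀ u₀, (0 : E)) (min ρ₁ (min ρ₂ ρ₄)) ⊆
      Metric.ball (extChartAt 𝓘(ℝ, E) u₀ u₀, (0 : E)) ρ₄ :=
    Metric.ball_subset_ball ((min_le_right _ _).trans (min_le_right _ _))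
  refine ⟨⟨B, g, min ρ₁ (min ρ₂ ρ₄), max C₁ (C₂ * L), hB, hBs, hg, hgs, by positivity,
    lt_max_of_lt_left hC₁, fun w hw => (hball (h4 hw)).1, fun w hw => hB_eq w (h1 hw),
    fun w hw => hg_eq w (h2 hw), fun w hw w' hw' => ?_, ?_⟩⟩
  · obtain ⟨hwr, hwS, hwb⟩ := hball (h4 hw)
    obtain ⟨hwr', hwS', hwb'⟩ := hball (h4 hw')
    have h := hdist _ hwb _ hwb'
    rw [retractionCoord, retractionCoord, (extChartAt 𝓘(ℝ, E) u₀).left_inv hwr.1.2,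
      (extChartAt 𝓘(ℝ, E) u₀).left_inv hwr'.1.2] at h
    refine h.trans (ENNReal.ofReal_le_ofReal ?_)
    have hl := hL.dist_le_mul _ hwS _ hwS'
    rw [dist_eq_norm, dist_eq_norm] at hl
    calc C₂ * _ ≤ C₂ * (L * ‖w - w'‖) := by gcongr; exact hl
      _ = C₂ * L * ‖w - w'‖ := by ring
      _ ≤ _ := by gcongr; exact le_max_right _ _
  · filter_upwards [hnorm, chart_source_mem_nhds E u₀] with p hp hps
    refine ⟨hps, fun v => (hp.1 v).trans ?_, fun a => (hp.2 a).trans ?_⟩ <;>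
    · gcongr
      exact le_max_left _ _

namespace LocalModel

variable {φ : Retraction E M} {Ω : ∀ x : M, TangentSpace 𝓘(ℝ, E) x →L[ℝ] TangentSpace 𝓘(ℝ, E) x}
  {H : M → ℝ} {u₀ : M} (m : LocalModel φ Ω H u₀)

/-- The coordinates of the points near the zero section over `u₀` at which the model is exact. -/
def domain : Set (E × E) := Metric.ball (extChartAt 𝓘(ℝ, E) u₀ u₀, (0 : E)) m.ρ

/-- While the curve stays where the cut-off is inactive, the model field is the pullback of F, so
φ_p carries its integral curves to those of F. -/
theorem isMIntegralCurveOn (hH : ContMDiff 𝓘(ℝ, E) 𝓘(ℝ, ℝ) ∞ H) {p : M}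
    (hp : p ∈ (chartAt E u₀).source) {y : ℝ → E} {τ : ℝ}
    (hy : ∀ t ∈ Icc (-τ) τ,
      HasDerivAt y (modelField m.B m.g (extChartAt 𝓘(ℝ, E) u₀ p, y t)) t)
    (hmem : ∀ t ∈ Icc (-τ) τ, (extChartAt 𝓘(ℝ, E) u₀ p, y t) ∈ m.domain) :
    IsMIntegralCurveOn (fun t => φ.at p (tangentCoordSymm u₀ p (y t)))
      (fun x => Ω x (riemannianGradient H x)) (Icc (-τ) τ) := by
  intro t ht
  have hw := m.mem_regularDomain _ (hmem t ht)
  have hw' : (extChartAt 𝓘(ℝ, E) u₀ p, tangentCoord u₀ p (tangentCoordSymm u₀ p (y t))) ∈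
      regularDomain φ u₀ := by rwa [tangentCoord_tangentCoordSymm hp]
  have h1 := @hasDerivAt_clm_comp E _ _ (TangentSpace 𝓘(ℝ, E) p) inferInstance inferInstance
    (tangentCoordSymm u₀ p) _ _ _ (hy t ht)
  have h3 := tangentMap_modelField φ Ω hH hp hw'
  rw [tangentCoord_tangentCoordSymm hp] at h3
  have h4 : modelField m.B m.g (extChartAt 𝓘(ℝ, E) u₀ p, y t) =
      modelField (operatorCoord φ Ω u₀) (covectorCoord φ H u₀) (extChartAt 𝓘(ℝ, E) u₀ p, y t) := by
    rw [modelField, modelField, m.B_eq _ (hmem t ht), m.g_eq _ (hmem t ht)]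
  rw [← h4] at h3
  exact hasMFDerivWithinAt_field_of_hasDerivAt (v := fun x => Ω x (riemannianGradient H x))
    (f := φ.at p) (η := fun t => tangentCoordSymm u₀ p (y t))
    (mdifferentiableAt_retraction φ hp hw'.1.1) h1 h3

variable {s : ℕ} {c : Fin s → ℝ}

theorem tangentCoord_stage_eq (hH : ContMDiff 𝓘(ℝ, E) 𝓘(ℝ, ℝ) ∞ H) {p : M}
    (hp : p ∈ (chartAt E u₀).source) {h : ℝ} {σ : ℝ → TangentSpace 𝓘(ℝ, E) p}
    (hσ : Continuous fun t => tangentCoord u₀ p (σ t))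
    (hmem : ∀ ξ ∈ Icc (0 : ℝ) 1,
      (extChartAt 𝓘(ℝ, E) u₀ p, tangentCoord u₀ p (σ (ξ * h))) ∈ m.domain) {j : Fin s}
    (hj : (extChartAt 𝓘(ℝ, E) u₀ p, tangentCoord u₀ p (σ (c j * h))) ∈ m.domain) :
    tangentCoord u₀ p (φ.tangentMapInv p (σ (c j * h))
      (Ω (φ.at p (σ (c j * h))) (stageGradient c φ H p h σ j))) =
    modelStage c m.B m.g (extChartAt 𝓘(ℝ, E) u₀ p)
      (fun ξ => tangentCoord u₀ p (σ (ξ * h))) j := by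
  rw [tangentCoord_stage c φ Ω hH hp h hσ (fun ξ hξ => m.mem_regularDomain _ (hmem ξ hξ))
    (m.mem_regularDomain _ hj)]
  exact modelStage_congr c (m.B_eq _ hj).symm fun ξ hξ => (m.g_eq _ (hmem ξ hξ)).symm

theorem isModelStep_of_isStep (hH : ContMDiff 𝓘(ℝ, E) 𝓘(ℝ, ℝ) ∞ H) {p u v : M}
    (hp : p ∈ (chartAt E u₀).source) {h : ℝ} {σ : ℝ → TangentSpace 𝓘(ℝ, E) p}
    (hσ : IsStep c φ Ω H p h u v σ)
    (hmem : ∀ ξ ∈ Icc (0 : ℝ) 1,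
      (extChartAt 𝓘(ℝ, E) u₀ p, tangentCoord u₀ p (σ (ξ * h))) ∈ m.domain)
    (hj : ∀ j, (extChartAt 𝓘(ℝ, E) u₀ p, tangentCoord u₀ p (σ (c j * h))) ∈ m.domain) :
    IsModelStep c m.B m.g (extChartAt 𝓘(ℝ, E) u₀ p) h (fun t => tangentCoord u₀ p (σ t)) := by
  obtain ⟨h1, h2⟩ := @polynomial_clm_comp (TangentSpace 𝓘(ℝ, E) p) inferInstance inferInstance E _ _ s
    σ (tangentCoord u₀ p) hσ.polynomial
  refine ⟨h1, fun j => ?_⟩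
  rw [h2, hσ.collocation]
  exact m.tangentCoord_stage_eq hH hp
    (continuous_iff_continuousAt.2 fun t => (hasDerivAt_of_polynomial h1 t).continuousAt) hmem (hj j)

theorem isStep_of_isModelStep (hH : ContMDiff 𝓘(ℝ, E) 𝓘(ℝ, ℝ) ∞ H) {p : M}
    (hp : p ∈ (chartAt E u₀).source) {h : ℝ} {σ : ℝ → E}
    (hσ : IsModelStep c m.B m.g (extChartAt 𝓘(ℝ, E) u₀ p) h σ)
    (hmem : ∀ ξ ∈ Icc (0 : ℝ) 1, (extChartAt 𝓘(ℝ, E) u₀ p, σ (ξ * h)) ∈ m.domain)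
    (hj : ∀ j, (extChartAt 𝓘(ℝ, E) u₀ p, σ (c j * h)) ∈ m.domain) :
    IsStep c φ Ω H p h (φ.at p (tangentCoordSymm u₀ p (σ 0)))
      (φ.at p (tangentCoordSymm u₀ p (σ h))) (fun t => tangentCoordSymm u₀ p (σ t)) := by
  obtain ⟨h1, h2⟩ := @polynomial_clm_comp E _ _ (TangentSpace 𝓘(ℝ, E) p) inferInstance inferInstance s
    σ (tangentCoordSymm u₀ p) hσ.polynomial
  have hA : ∀ t, tangentCoord u₀ p (tangentCoordSymm u₀ p (σ t)) = σ t := fun t =>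
    tangentCoord_tangentCoordSymm hp _
  have hdom : ∀ t, (extChartAt 𝓘(ℝ, E) u₀ p, σ t) ∈ m.domain →
      (extChartAt 𝓘(ℝ, E) u₀ p, tangentCoord u₀ p (tangentCoordSymm u₀ p (σ t))) ∈
        regularDomain φ u₀ := fun t ht => by
    rw [hA]
    exact m.mem_regularDomain _ ht
  refine ⟨h1, fun ξ hξ => ?_, fun j => ?_, fun j => ?_, rfl, fun j => ?_, rfl⟩
  · exact (mem_retractionOfCoordDomain_iff φ hp _).1 (hdom _ (hmem ξ hξ)).1.1
  · exact (mem_retractionOfCoordDomain_iff φ hp _).1 (hdom _ (hj j)).1.1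
  · exact isInvertible_tangentMap φ hp (hdom _ (hj j))
  · rw [h2, hσ.collocation]
    have h3 := m.tangentCoord_stage_eq (c := c) (j := j) (h := h) hH hp
      (σ := fun t => tangentCoordSymm u₀ p (σ t))
      (by simp only [hA]; exact continuous_iff_continuousAt.2 fun t => (hσ.hasDerivAt t).continuousAt)
      (by simpa only [hA] using hmem) (by simpa only [hA] using hj j)
    simp only [hA] at h3
    rw [← h3, tangentCoordSymm_tangentCoord hp]

end LocalModel

end

/-! ### Local error bound and solvability -/

/-- All local constants are merged into one parameter, and the property persists when it shrinks;
the minimum then works for unions, which is what compactness induction needs. -/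
theorem exists_uniform_of_isCompact {X : Type*} [TopologicalSpace X] {K : Set X} (hK : IsCompact K)
    {Q : ℝ → X → Prop} (hmono : ∀ a b u, 0 < a → a ≤ b → Q b u → Q a u)
    (hloc : ∀ u ∈ K, ∃ a > 0, ∀ᶠ u' in 𝓝 u, Q a u') : ∃ a > 0, ∀ u ∈ K, Q a u := by
  refine hK.induction_on (p := fun S => ∃ a > 0, ∀ u ∈ S, Q a u) ⟨1, one_pos, by simp⟩ ?_ ?_ ?_
  · rintro S T hST ⟨a, ha, h⟩
    exact ⟨a, ha, fun u hu => h u (hST hu)⟩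
  · rintro S T ⟨a, ha, h⟩ ⟨b, hb, h'⟩
    refine ⟨min a b, lt_min ha hb, ?_⟩
    rintro u (hu | hu)
    · exact hmono _ _ _ (lt_min ha hb) (min_le_left _ _) (h u hu)
    · exact hmono _ _ _ (lt_min ha hb) (min_le_right _ _) (h' u hu)
  · intro u hu
    obtain ⟨a, ha, h⟩ := hloc u hu
    exact ⟨_, mem_nhdsWithin_of_mem_nhds h, a, ha, fun u' hu' => hu'⟩

theorem exists_edist_lt_imp_mem {X : Type*} [PseudoEMetricSpace X] {u₀ : X} {N : Set X}
    (hN : N ∈ 𝓝 u₀) :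
    ∃ δ > (0 : ℝ), ∀ᶠ u in 𝓝 u₀, ∀ v, edist v u < ENNReal.ofReal δ → v ∈ N := by
  obtain ⟨e, he, hball⟩ := EMetric.mem_nhds_iff.1 hN
  obtain ⟨δ, hδ, hδe⟩ := ENNReal.lt_iff_exists_nnreal_btwn.1 (ENNReal.half_pos he.ne')
  refine ⟨δ, by exact_mod_cast hδ, ?_⟩
  filter_upwards [Metric.eball_mem_nhds u₀ (ENNReal.half_pos he.ne')] with u hu v hv
  refine hball ?_
  rw [ENNReal.ofReal_coe_nnreal] at hv
  calc edist v u₀ ≤ edist v u + edist u u₀ := edist_triangle _ _ _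
    _ < e / 2 + e / 2 := ENNReal.add_lt_add (hv.trans hδe) hu
    _ = e := ENNReal.add_halves e

section

variable {E : Type*} [NormedAddCommGroup E] [NormedSpace ℝ E] [FiniteDimensional ℝ E]
  {M : Type*} [EMetricSpace M] [ChartedSpace E M] [IsManifold 𝓘(ℝ, E) ∞ M]
  [RiemannianBundle (fun x : M => TangentSpace 𝓘(ℝ, E) x)]
  {φ : Retraction E M} {Ω : ∀ x : M, TangentSpace 𝓘(ℝ, E) x →L[ℝ] TangentSpace 𝓘(ℝ, E) x}
  {H : M → ℝ} {u₀ : M} {s : ℕ} {c : Fin s → ℝ} {r : ℕ}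

namespace LocalModel

variable (m : LocalModel φ Ω H u₀)

theorem mem_domain_iff {z x : E} :
    (z, x) ∈ m.domain ↔ z ∈ Metric.ball (extChartAt 𝓘(ℝ, E) u₀ u₀) m.ρ ∧ ‖x‖ < m.ρ := by
  rw [domain, ← ball_prod_same, mem_prod, mem_ball_zero_iff]

theorem edist_at_le {p : M} (hp : p ∈ (chartAt E u₀).source) {x y : TangentSpace 𝓘(ℝ, E) p}
    (hx : (extChartAt 𝓘(ℝ, E) u₀ p, tangentCoord u₀ p x) ∈ m.domain)
    (hy : (extChartAt 𝓘(ℝ, E) u₀ p, tangentCoord u₀ p y) ∈ m.domain) :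
    edist (φ.at p x) (φ.at p y) ≤
      ENNReal.ofReal (m.C * ‖tangentCoord u₀ p x - tangentCoord u₀ p y‖) := by
  have h := m.edist_le _ hx _ hy
  rw [retractionOfCoord_extChartAt φ hp, retractionOfCoord_extChartAt φ hp] at h
  simpa [Prod.norm_def] using h

/-- The points near `u₀` that can serve as base points. -/
theorem eventually_mem (m : LocalModel φ Ω H u₀) {η : ℝ} (hη : 0 < η) :
    ∀ᶠ p in 𝓝 u₀, extChartAt 𝓘(ℝ, E) u₀ p ∈ Metric.ball (extChartAt 𝓘(ℝ, E) u₀ u₀) η ∧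
      p ∈ (chartAt E u₀).source ∧
      (∀ v : TangentSpace 𝓘(ℝ, E) p, ‖tangentCoord u₀ p v‖ ≤ m.C * ‖v‖) ∧
        ∀ a : E, ‖tangentCoordSymm u₀ p a‖ ≤ m.C * ‖a‖ :=
  ((continuousAt_extChartAt (I := 𝓘(ℝ, E)) u₀).eventually
    (Metric.ball_mem_nhds _ hη)).and m.eventually_norm_le

theorem exists_flow_and_error (m : LocalModel φ Ω H u₀) (hH : ContMDiff 𝓘(ℝ, E) 𝓘(ℝ, ℝ) ∞ H)
    (hc : Function.Injective c)
    (hb : ∀ i, weight c i ≠ 0) (hr : IsQuadratureOrder c r) :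
    ∃ η > 0, ∃ h₀ > 0, ∃ C : ℝ, 0 ≤ C ∧ η ≤ m.ρ ∧ ∀ p ∈ (chartAt E u₀).source,
      extChartAt 𝓘(ℝ, E) u₀ p ∈ Metric.ball (extChartAt 𝓘(ℝ, E) u₀ u₀) η →
      ∀ y₀ : E, ‖y₀‖ < η → ∃ y : ℝ → E, y 0 = y₀ ∧
        (∀ t ∈ Icc (-h₀) h₀, (extChartAt 𝓘(ℝ, E) u₀ p, y t) ∈ m.domain) ∧
        IsMIntegralCurveOn (fun t => φ.at p (tangentCoordSymm u₀ p (y t)))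
          (fun x => Ω x (riemannianGradient H x)) (Icc (-h₀) h₀) ∧
        ∀ h : ℝ, 0 < h → h < h₀ → ∀ σ : ℝ → E,
          IsModelStep c m.B m.g (extChartAt 𝓘(ℝ, E) u₀ p) h σ → σ 0 = y₀ →
          ‖σ h - y h‖ ≤ C * h ^ (min r (2 * r - 2 * s + 2) + 1) := by
  have hρ := m.ρ_pos
  obtain ⟨ρ, hρ', τ, hτ, h₀, hh₀, C, hC, hmain⟩ := exists_model_solution_and_error hc hb hr
    m.contDiff_B m.hasCompactSupport_B m.contDiff_g m.hasCompactSupport_g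
    (extChartAt 𝓘(ℝ, E) u₀ u₀) (0 : E) (half_pos hρ)
  refine ⟨min ρ m.ρ, lt_min hρ' hρ, min τ h₀, lt_min hτ hh₀, C, hC, min_le_right _ _,
    fun p hp hpz y₀ hy₀ => ?_⟩
  rw [Metric.mem_ball, lt_min_iff] at hpz
  obtain ⟨y, hy0, hy, herr⟩ := hmain _ (Metric.mem_closedBall.2 hpz.1.le) y₀
    (mem_closedBall_zero_iff.2 (hy₀.le.trans (min_le_left _ _)))
  have hsub : Icc (-min τ h₀) (min τ h₀) ⊆ Icc (-τ) τ :=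
    Icc_subset_Icc (neg_le_neg (min_le_left _ _)) (min_le_left _ _)
  have hdom : ∀ t ∈ Icc (-min τ h₀) (min τ h₀), (extChartAt 𝓘(ℝ, E) u₀ p, y t) ∈ m.domain :=
    fun t ht => m.mem_domain_iff.2 ⟨hpz.2,
      (mem_closedBall_zero_iff.1 (hy t (hsub ht)).2).trans_lt (by linarith)⟩
  exact ⟨y, hy0, hdom, m.isMIntegralCurveOn hH hp (fun t ht => (hy t (hsub ht)).1) hdom,
    fun h hh hh' => herr h hh (hh'.trans_le (min_le_right _ _))⟩

/-- Take u itself as base point and start the model equation at 0, since φ_u(0) = u. -/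
theorem exists_integral_curve (m : LocalModel φ Ω H u₀) (hH : ContMDiff 𝓘(ℝ, E) 𝓘(ℝ, ℝ) ∞ H)
    (hc : Function.Injective c)
    (hb : ∀ i, weight c i ≠ 0) (hr : IsQuadratureOrder c r) :
    ∃ τ > 0, ∀ᶠ u in 𝓝 u₀, ∃ γ : ℝ → M, γ 0 = u ∧
      IsMIntegralCurveOn γ (fun x => Ω x (riemannianGradient H x)) (Icc (-τ) τ) := by
  obtain ⟨η, hη, h₀, hh₀, C, -, -, hmain⟩ := m.exists_flow_and_error hH hc hb hr
  refine ⟨h₀, hh₀, ?_⟩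
  filter_upwards [m.eventually_mem hη] with u hu
  obtain ⟨y, hy0, -, hcurve, -⟩ := hmain u hu.2.1 hu.1 0 (by simpa using hη)
  refine ⟨_, ?_, hcurve⟩
  simp only [hy0, map_zero]
  exact (φ.eq_base_iff u 0 (by rw [enorm_zero]; exact φ.radius_pos _)).2 rfl

/-- Solve φ_p(x) = u with x small, then take a model step from x. Its points move by O(h), so ε may
be prescribed before δ and h₀. -/
theorem exists_step (m : LocalModel φ Ω H u₀) (hH : ContMDiff 𝓘(ℝ, E) 𝓘(ℝ, ℝ) ∞ H)
    (hc : Function.Injective c)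
    {ε : ℝ} (hε : 0 < ε) :
    ∃ h₀ > 0, ∃ δ > 0, ∀ᶠ u in 𝓝 u₀, ∀ h : ℝ, 0 < h → h < h₀ →
      ∀ p : M, edist p u < ENNReal.ofReal δ → ∃ (v : M) (σ : ℝ → TangentSpace 𝓘(ℝ, E) p),
        IsStep c φ Ω H p h u v σ ∧ edist v u < ENNReal.ofReal ε ∧ IsSmall c p h σ ε := by
  have hC := m.C_pos
  have hρ := m.ρ_pos
  -- Coordinates of norm below ρ' lie where the model is exact and give tangent vectors of norm
  -- below ε. Half of ρ' is reserved for x and half for the displacement D h.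
  set ρ' := min m.ρ (ε / m.C)
  have hρ' : 0 < ρ' := lt_min hρ (by positivity)
  have hCρ : m.C * ρ' ≤ ε := by
    calc m.C * ρ' ≤ m.C * (ε / m.C) := by gcongr; exact min_le_right _ _
      _ = ε := by field_simp
  obtain ⟨η, hη, hsol⟩ := exists_retractionCoord_eq φ u₀
    (Metric.ball_mem_nhds (extChartAt 𝓘(ℝ, E) u₀ u₀, (0 : E)) (half_pos hρ'))
  obtain ⟨T, hT, hcT⟩ := exists_nodes_bound c
  obtain ⟨h₁, hh₁, D, hD, hstep⟩ := exists_isModelStep (E := E) hc hT hcT m.contDiff_B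
    m.hasCompactSupport_B m.contDiff_g m.hasCompactSupport_g
  obtain ⟨δ, hδ, hδN⟩ := exists_edist_lt_imp_mem (m.eventually_mem (lt_min hη hρ))
  refine ⟨min h₁ (ρ' / (2 * (D + 1))), by positivity, δ, hδ, ?_⟩
  filter_upwards [m.eventually_mem hη, hδN] with u hu huN h hh hh₀ p hp
  obtain ⟨hpz, hps, hA, hA'⟩ := huN p hp
  obtain ⟨x, hx, hxu⟩ := hsol _ (Metric.ball_subset_ball (min_le_left _ _) hpz) _ hu.1
  rw [← ball_prod_same, mem_prod, mem_ball_zero_iff] at hx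
  obtain ⟨σ, hσ, hσ0, hσx⟩ := hstep (extChartAt 𝓘(ℝ, E) u₀ p) x h hh
    (hh₀.trans_le (min_le_left _ _))
  have hDh : D * h < ρ' / 2 := by
    have h1 : h < ρ' / (2 * (D + 1)) := hh₀.trans_le (min_le_right _ _)
    rw [lt_div_iff₀ (by positivity)] at h1
    nlinarith
  have hσρ : ∀ ξ ∈ Icc (-T) T, ‖σ (ξ * h)‖ < ρ' := fun ξ hξ => by
    have h1 := hσx ξ hξ
    have h2 := norm_le_norm_add_norm_sub x (σ (ξ * h))
    rw [norm_sub_rev] at h2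
    linarith [hx.2]
  have hIcc : Icc (0 : ℝ) 1 ⊆ Icc (-T) T := Icc_subset_Icc (by linarith) hT
  have hdom : ∀ ξ ∈ Icc (-T) T, (extChartAt 𝓘(ℝ, E) u₀ p, σ (ξ * h)) ∈ m.domain := fun ξ hξ =>
    m.mem_domain_iff.2 ⟨Metric.ball_subset_ball (min_le_right _ _) hpz,
      (hσρ ξ hξ).trans_le (min_le_left _ _)⟩
  have hnorm : ∀ ξ ∈ Icc (-T) T, ‖tangentCoordSymm u₀ p (σ (ξ * h))‖ < ε := fun ξ hξ =>
    (hA' _).trans_lt (((mul_lt_mul_iff_right₀ hC).2 (hσρ ξ hξ)).trans_le hCρ)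
  have hS := m.isStep_of_isModelStep hH hps hσ (fun ξ hξ => hdom ξ (hIcc hξ))
    fun j => hdom _ (hcT j)
  have h0 : (0 : ℝ) ∈ Icc (-T) T := hIcc ⟨le_rfl, zero_le_one⟩
  have h1 : (1 : ℝ) ∈ Icc (-T) T := hIcc ⟨zero_le_one, le_rfl⟩
  have hd0 := hdom 0 h0
  have hd1 := hdom 1 h1
  rw [zero_mul] at hd0
  rw [one_mul] at hd1
  rw [← tangentCoord_tangentCoordSymm hps (σ 0)] at hd0
  rw [← tangentCoord_tangentCoordSymm hps (σ h)] at hd1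
  have hinit : φ.at p (tangentCoordSymm u₀ p (σ 0)) = u := by
    refine (extChartAt 𝓘(ℝ, E) u₀).injOn ?_ ?_ ?_
    · rw [extChartAt_source]
      exact retraction_mem_source φ hps (m.mem_regularDomain _ hd0).1
    · rw [extChartAt_source]
      exact hu.2.1
    · rw [extChartAt_retraction φ hps, tangentCoord_tangentCoordSymm hps, hσ0, hxu]
  rw [hinit] at hS
  refine ⟨_, _, hS, ?_, fun ξ hξ => hnorm ξ (hIcc hξ), fun j => hnorm _ (hcT j)⟩
  rw [← hinit]
  refine (m.edist_at_le hps hd1 hd0).trans_lt ((ENNReal.ofReal_lt_ofReal_iff hε).2 ?_)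
  rw [tangentCoord_tangentCoordSymm hps, tangentCoord_tangentCoordSymm hps, hσ0]
  have h2 := hσx 1 h1
  rw [one_mul] at h2
  calc m.C * ‖σ h - x‖ ≤ m.C * (D * h) := by gcongr
    _ < m.C * ρ' := by gcongr; linarith
    _ ≤ ε := hCρ

end LocalModel

/-- The error of every step of the method with base point near the starting point. -/
theorem LocalModel.exists_error_bound
    [IsContMDiffRiemannianBundle 𝓘(ℝ, E) ∞ E (fun x : M => TangentSpace 𝓘(ℝ, E) x)]
    (m : LocalModel φ Ω H u₀)
    (hΩ : ContMDiff 𝓘(ℝ, E) (𝓘(ℝ, E).prod 𝓘(ℝ, E →L[ℝ] E)) ∞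
      (fun x : M => TotalSpace.mk' (E →L[ℝ] E)
        (E := fun x : M => TangentSpace 𝓘(ℝ, E) x →L[ℝ] TangentSpace 𝓘(ℝ, E) x) x (Ω x)))
    (hH : ContMDiff 𝓘(ℝ, E) 𝓘(ℝ, ℝ) ∞ H) (hc : Function.Injective c)
    (hb : ∀ i, weight c i ≠ 0) (hr : IsQuadratureOrder c r)
    {ctr : M → M → M} (hctr : Continuous (fun x : M × M => ctr x.1 x.2))
    (hctr_diag : ∀ u, ctr u u = u) :
    ∃ h₀ > (0 : ℝ), ∃ ε > (0 : ℝ), ∃ C > (0 : ℝ), ∀ᶠ u in 𝓝 u₀, ∀ h : ℝ, 0 < h → h < h₀ →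
      ∀ (v : M) (σ : ℝ → TangentSpace 𝓘(ℝ, E) (ctr u v)) (γ : ℝ → M),
        IsStep c φ Ω H (ctr u v) h u v σ →
        edist v u < ENNReal.ofReal ε → IsSmall c (ctr u v) h σ ε → γ 0 = u →
        IsMIntegralCurveOn γ (fun x => Ω x (riemannianGradient H x)) (Icc 0 h) →
        edist v (γ h) ≤ ENNReal.ofReal (C * h ^ (min r (2 * r - 2 * s + 2) + 1)) := by
  have hC := m.C_pos
  obtain ⟨η, hη, h₀, hh₀, C, hC', hηρ, hmain⟩ := m.exists_flow_and_error hH hc hb hr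
  -- Continuity together with ctr(u₀, u₀) = u₀ forces the base point near u₀ once u and v are, so
  -- one local model covers the whole step.
  have hcont : Filter.Tendsto (fun x : M × M => ctr x.1 x.2) (𝓝 (u₀, u₀)) (𝓝 u₀) := by
    have := hctr.tendsto (u₀, u₀)
    rwa [hctr_diag] at this
  have hev := hcont (m.eventually_mem hη)
  rw [nhds_prod_eq] at hev
  obtain ⟨S₁, hS₁, S₂, hS₂, hS⟩ := Filter.mem_prod_iff.1 hev
  obtain ⟨δ, hδ, hδN⟩ := exists_edist_lt_imp_mem hS₂
  -- The bound δ confines v and hence the base point, while η / m.C confines the coordinates of σ. C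
  -- is only known to be nonnegative, hence C + 1.
  refine ⟨h₀, hh₀, min δ (η / m.C), by positivity, m.C * (C + 1), by positivity, ?_⟩
  filter_upwards [hS₁, hδN] with u hu huN h hh hh' v σ γ hstep hvu hsmall hγ0 hγ
  have hp : (u, v) ∈ S₁ ×ˢ S₂ :=
    ⟨hu, huN v (hvu.trans_le (ENNReal.ofReal_le_ofReal (min_le_left _ _)))⟩
  obtain ⟨hpz, hps, hA, -⟩ := hS hp
  dsimp only at hpz hps hA
  have hbound : ∀ x : TangentSpace 𝓘(ℝ, E) (ctr u v), ‖x‖ < min δ (η / m.C) →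
      ‖tangentCoord u₀ (ctr u v) x‖ < η := fun x hx => by
    refine (hA x).trans_lt ?_
    rw [← lt_div_iff₀' hC]
    exact hx.trans_le (min_le_right _ _)
  have hdom : ∀ x : TangentSpace 𝓘(ℝ, E) (ctr u v), ‖x‖ < min δ (η / m.C) →
      (extChartAt 𝓘(ℝ, E) u₀ (ctr u v), tangentCoord u₀ (ctr u v) x) ∈ m.domain := fun x hx =>
    m.mem_domain_iff.2 ⟨Metric.ball_subset_ball hηρ hpz, (hbound x hx).trans_le hηρ⟩
  have hmodel := m.isModelStep_of_isStep hH hps hstep (fun ξ hξ => hdom _ (hsmall.1 ξ hξ))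
    fun j => hdom _ (hsmall.2 j)
  have hσ0 := hsmall.1 0 ⟨le_rfl, zero_le_one⟩
  have hσ1 := hsmall.1 1 ⟨zero_le_one, le_rfl⟩
  rw [zero_mul] at hσ0
  rw [one_mul] at hσ1
  obtain ⟨y, hy0, hydom, hcurve, herr⟩ := hmain _ hps hpz _ (hbound _ hσ0)
  have hfield := (contMDiff_hamiltonian_field hΩ hH).of_le (m := 1) (by simp)
  -- The given exact solution coincides with the image of the model solution, so the error can be
  -- measured in T_pM and carried over by the Lipschitz bound.
  have heq := eqOn_Icc_of_isMIntegralCurveOn hfield hh hh' hγ (hcurve.mono Ioo_subset_Icc_self)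
    (by
      rw [hγ0]
      simp only [hy0, tangentCoordSymm_tangentCoord hps]
      exact hstep.initial.symm) ⟨hh.le, le_rfl⟩
  rw [heq]
  refine (congrArg (fun q => edist q _) hstep.final).le.trans ?_
  have hyh := hydom h ⟨by linarith, hh'.le⟩
  rw [← tangentCoord_tangentCoordSymm hps (y h)] at hyh
  refine (m.edist_at_le hps (hdom _ hσ1) hyh).trans (ENNReal.ofReal_le_ofReal ?_)
  rw [tangentCoord_tangentCoordSymm hps, mul_assoc]
  gcongr
  refine (herr h hh hh' _ hmodel rfl).trans ?_
  gcongr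
  linarith

end

end CollocationMethod

/-! ### Uniform constants on the compact set. -/

theorem mainTheorem2
    {E : Type*} [NormedAddCommGroup E] [NormedSpace ℝ E] [FiniteDimensional ℝ E]
    {M : Type*} [EMetricSpace M] [ChartedSpace E M] [IsManifold 𝓘(ℝ, E) ∞ M]
    [RiemannianBundle (fun x : M => TangentSpace 𝓘(ℝ, E) x)]
    [IsContMDiffRiemannianBundle 𝓘(ℝ, E) ∞ E (fun x : M => TangentSpace 𝓘(ℝ, E) x)]
    [IsRiemannianManifold 𝓘(ℝ, E) M]
    -- the vector field `F = Ω grad H`, with `Ω` a smooth skew-symmetric tensor field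
    (H : M → ℝ) (hH : ContMDiff 𝓘(ℝ, E) 𝓘(ℝ, ℝ) ∞ H)
    (Ω : ∀ x : M, TangentSpace 𝓘(ℝ, E) x →L[ℝ] TangentSpace 𝓘(ℝ, E) x)
    (hΩ : ContMDiff 𝓘(ℝ, E) (𝓘(ℝ, E).prod 𝓘(ℝ, E →L[ℝ] E)) ∞
      (fun x : M => TotalSpace.mk' (E →L[ℝ] E)
        (E := fun x : M => TangentSpace 𝓘(ℝ, E) x →L[ℝ] TangentSpace 𝓘(ℝ, E) x) x (Ω x)))
    (hskew : ∀ (x : M) (y z : TangentSpace 𝓘(ℝ, E) x),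
      inner ℝ (Ω x y) z = - inner ℝ y (Ω x z))
    -- the retraction and the centre point function
    (φ : CollocationMethod.Retraction E M)
    (ctr : M → M → M) (hctr : Continuous (fun x : M × M => ctr x.1 x.2))
    (hctr_diag : ∀ u, ctr u u = u)
    -- the nodes and the order of the quadrature formula
    (s : ℕ) (c : Fin s → ℝ) (hc : Function.Injective c)
    (hb : ∀ i, CollocationMethod.weight c i ≠ 0)
    (r : ℕ) (hr : CollocationMethod.IsQuadratureOrder c r)
    (K : Set M) (hK : IsCompact K) :
    ∃ C > (0 : ℝ), ∃ h₀ > (0 : ℝ), ∃ ε > (0 : ℝ), ∃ δ > (0 : ℝ),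
      ∀ u ∈ K, ∀ h : ℝ, 0 < h → h < h₀ →
        -- the exact flow `φ_h(u)` is defined
        (∃ γ : ℝ → M, γ 0 = u ∧ IsMIntegralCurveOn γ
          (fun x => Ω x (CollocationMethod.riemannianGradient H x)) (Icc 0 h)) ∧
        -- the method is solvable near `u`, for every base point near `u`
        (∀ p : M, edist p u < ENNReal.ofReal δ →
          ∃ (v : M) (σ : ℝ → TangentSpace 𝓘(ℝ, E) p),
            CollocationMethod.IsStep c φ Ω H p h u v σ ∧
            edist v u < ENNReal.ofReal ε ∧ CollocationMethod.IsSmall c p h σ ε) ∧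
        -- every step `v = ψ_h(u)` of the method near `u` satisfies the error bound
        (∀ (v : M) (σ : ℝ → TangentSpace 𝓘(ℝ, E) (ctr u v)) (γ : ℝ → M),
          CollocationMethod.IsStep c φ Ω H (ctr u v) h u v σ →
          edist v u < ENNReal.ofReal ε → CollocationMethod.IsSmall c (ctr u v) h σ ε →
          γ 0 = u →
          IsMIntegralCurveOn γ (fun x => Ω x (CollocationMethod.riemannianGradient H x)) (Icc 0 h) →
          edist v (γ h) ≤ ENNReal.ofReal (C * h ^ (min r (2 * r - 2 * s + 2) + 1))) := by
  set k := min r (2 * r - 2 * s + 2) + 1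
  -- The single parameter a bounds the existence time, the step size and the locality radius, and
  -- a⁻¹ is the error constant; every clause weakens as a decreases.
  obtain ⟨a, ha, hQ⟩ := CollocationMethod.exists_uniform_of_isCompact hK
    (Q := fun a u => (∃ γ : ℝ → M, γ 0 = u ∧ IsMIntegralCurveOn γ
        (fun x => Ω x (CollocationMethod.riemannianGradient H x)) (Icc (-a) a)) ∧
      ∀ h : ℝ, 0 < h → h < a →
        ∀ (v : M) (σ : ℝ → TangentSpace 𝓘(ℝ, E) (ctr u v)) (γ : ℝ → M),
          CollocationMethod.IsStep c φ Ω H (ctr u v) h u v σ →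
          edist v u < ENNReal.ofReal a → CollocationMethod.IsSmall c (ctr u v) h σ a →
          γ 0 = u →
          IsMIntegralCurveOn γ (fun x => Ω x (CollocationMethod.riemannianGradient H x))
            (Icc 0 h) →
          edist v (γ h) ≤ ENNReal.ofReal (a⁻¹ * h ^ k))
    (by
      rintro a b u ha hab ⟨⟨γ, hγ0, hγ⟩, h⟩
      refine ⟨⟨γ, hγ0, hγ.mono (Icc_subset_Icc (neg_le_neg hab) hab)⟩,
        fun t ht hta v σ γ hstep hv hsmall h0 hcurve => ?_⟩
      refine (h t ht (hta.trans_le hab) v σ γ hstep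
        (hv.trans_le (ENNReal.ofReal_le_ofReal hab))
        ⟨fun ξ hξ => (hsmall.1 ξ hξ).trans_le hab, fun j => (hsmall.2 j).trans_le hab⟩
        h0 hcurve).trans (ENNReal.ofReal_le_ofReal ?_)
      gcongr)
    (fun u₀ _ => by
      obtain ⟨m⟩ := CollocationMethod.nonempty_localModel φ hΩ hH u₀
      obtain ⟨τ, hτ, h1⟩ := m.exists_integral_curve hH hc hb hr
      obtain ⟨h₀, hh₀, ε, hε, C, hC, h2⟩ :=
        m.exists_error_bound hΩ hH hc hb hr hctr hctr_diag
      have e1 : min (min τ h₀) (min ε C⁻¹) ≤ τ := (min_le_left _ _).trans (min_le_left _ _)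
      have e2 : min (min τ h₀) (min ε C⁻¹) ≤ h₀ := (min_le_left _ _).trans (min_le_right _ _)
      have e3 : min (min τ h₀) (min ε C⁻¹) ≤ ε := (min_le_right _ _).trans (min_le_left _ _)
      have e4 : min (min τ h₀) (min ε C⁻¹) ≤ C⁻¹ := (min_le_right _ _).trans (min_le_right _ _)
      have ha : 0 < min (min τ h₀) (min ε C⁻¹) := by positivity
      have e5 : C ≤ (min (min τ h₀) (min ε C⁻¹))⁻¹ := by
        rw [le_inv_comm₀ hC ha]
        exact e4
      refine ⟨min (min τ h₀) (min ε C⁻¹), ha, ?_⟩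
      filter_upwards [h1, h2] with u hu1 hu2
      obtain ⟨γ, hγ0, hγ⟩ := hu1
      refine ⟨⟨γ, hγ0, hγ.mono (Icc_subset_Icc (neg_le_neg e1) e1)⟩,
        fun t ht hta v σ γ hstep hv hsmall h0 hcurve => ?_⟩
      refine (hu2 t ht (hta.trans_le e2) v σ γ hstep
        (hv.trans_le (ENNReal.ofReal_le_ofReal e3))
        ⟨fun ξ hξ => (hsmall.1 ξ hξ).trans_le e3, fun j => (hsmall.2 j).trans_le e3⟩
        h0 hcurve).trans (ENNReal.ofReal_le_ofReal ?_)
      gcongr)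
  -- Solvability is required at the locality radius a fixed by the error bound, so δ = b is chosen
  -- in a second compactness argument.
  obtain ⟨b, hb', hR⟩ := CollocationMethod.exists_uniform_of_isCompact hK
    (Q := fun b u => ∀ h : ℝ, 0 < h → h < b → ∀ p : M, edist p u < ENNReal.ofReal b →
      ∃ (v : M) (σ : ℝ → TangentSpace 𝓘(ℝ, E) p),
        CollocationMethod.IsStep c φ Ω H p h u v σ ∧
        edist v u < ENNReal.ofReal a ∧ CollocationMethod.IsSmall c p h σ a)
    (fun b b' u _ hbb h t ht htb p hp =>
      h t ht (htb.trans_le hbb) p (hp.trans_le (ENNReal.ofReal_le_ofReal hbb)))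
    (fun u₀ _ => by
      obtain ⟨m⟩ := CollocationMethod.nonempty_localModel φ hΩ hH u₀
      obtain ⟨h₀, hh₀, δ, hδ, h1⟩ := m.exists_step hH hc ha
      refine ⟨min h₀ δ, by positivity, ?_⟩
      filter_upwards [h1] with u hu t ht htb p hp
      exact hu t ht (htb.trans_le (min_le_left _ _)) p
        (hp.trans_le (ENNReal.ofReal_le_ofReal (min_le_right _ _))))
  refine ⟨a⁻¹, by positivity, min a b, by positivity, a, ha, b, hb', fun u hu h hh hh' => ?_⟩
  obtain ⟨⟨γ, hγ0, hγ⟩, herr⟩ := hQ u hu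
  have hha : h < a := hh'.trans_le (min_le_left _ _)
  have hhb : h < b := hh'.trans_le (min_le_right _ _)
  exact ⟨⟨γ, hγ0, hγ.mono (Icc_subset_Icc (by linarith) hha.le)⟩, hR u hu h hh hhb,
    herr h hh hha⟩
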